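/- **Theorem (z-measures are coherent probability measures).** Let $a\ge b\ge -\tfrac12$ be real and put $\epsilon=\frac{a+b+1}{2}$. For $N\ge 1$ let $\mathbb{GT}^+_N$ be the set of integer tuples $\lambda=(\lambda_1\ge\dots\ge\lambda_N\ge 0)$, and for $\lambda\in\mathbb{GT}^+_N$ put $l_i=\lambda_i+N-i$ and $\widehat l_i=(l_i+\epsilon)^2$. *Parameters.* Let $\mathcal Z_{princ}=\{(z,z')\in\mathbb C^2\setminus\mathbb R^2: z'=\bar z\}$ and $\mathcal Z_{compl}=\{(z,z')\in\mathbb R^2:\exists\, m\in\mathbb Z,\ m<z,z'<m+1\}$. Let $\mathcal H$ be the set of pairs $(z,z')\in\mathbb C^2$ such that both $(z,z')$ and $(z+2\epsilon,z'+2\epsilon)$ lie in $\mathcal Z_{princ}\sqcup\mathcal Z_{compl}$ and $z+z'+b>-1$. *The expressions.* For $(z,z')\in\mathcal H$, $N\ge 1$, $\lambda\in\mathbb{GT}^+_N$ put $$M_{z,z',a,b|N}(\lambda)=C_{z,z',a,b|N}^{-1}\prod_{1\le i<j\le N}(\widehat l_i-\widehat l_j)^2\prod_{i=1}^N W_{z,z',a,b|N}(l_i),$$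 $$W_{z,z',a,b|N}(x)=\frac{(x+\epsilon)\,\Gamma(x+2\epsilon)\,\Gamma(x+a+1)}{\Gamma(x+b+1)\,\Gamma(x+1)}\cdot\frac{1}{\Gamma(z-x+N)\,\Gamma(z'-x+N)\,\Gamma(z+x+N+2\epsilon)\,\Gamma(z'+x+N+2\epsilon)},$$ $$C_{z,z',a,b|N}=2^{-N}\prod_{i=1}^N\frac{\Gamma(a+i)\,\Gamma(b+z+z'+i)\,\Gamma(i)}{\Gamma(z+i)\,\Gamma(z'+i)\,\Gamma(z+b+i)\,\Gamma(z'+b+i)\,\Gamma(z+z'+N+a+b+i)},$$ where for $x=0$, $\epsilon=0$ the factor $(x+\epsilon)\Gamma(x+2\epsilon)$ is read as its limit $\tfrac12$. *The links.* Let $\mathfrak P_0,\mathfrak P_1,\dots$ be the polynomials obtained by orthogonalizing $1,x,x^2,\dots$ in $L^2([-1,1],(1-x)^a(1+x)^b\,dx)$. For $\lambda\in\mathbb{GT}^+_N$ let $\mathfrak P_\lambda(x_1,\dots,x_N)=\det[\mathfrak P_{l_i}(x_j)]_{i,j=1}^N/\prod_{i<j}(x_i-x_j)$ and $\Phi_\lambda=\mathfrak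 P_\lambda/\mathfrak P_\lambda(1,\dots,1)$. For $\lambda\in\mathbb{GT}^+_{N+1}$ the numbers $\Lambda^{N+1}_N(\lambda,\mu)$ are the coefficients of the unique finite expansion $$\Phi_\lambda(x_1,\dots,x_N,1)=\sum_{\mu\in\mathbb{GT}^+_N}\Lambda^{N+1}_N(\lambda,\mu)\,\Phi_\mu(x_1,\dots,x_N).$$ *The boundary.* A coherent system is a sequence $(M_N)_{N\ge1}$ of probability measures on the sets $\mathbb{GT}^+_N$ with $M_N(\mu)=\sum_{\lambda\in\mathbb{GT}^+_{N+1}}M_{N+1}(\lambda)\Lambda^{N+1}_N(\lambda,\mu)$ for all $N\ge1$, $\mu\in\mathbb{GT}^+_N$. The boundary $\Omega_\infty$ is the set of extreme points of the convex set of coherent systems, with the Borel $\sigma$-algebra of the projective limit topology, i.e. the one generated by the coordinates $\omega=(\omega_N)_{N\ge 1}\mapsto\omega_N(\lambda)$. *Claim.* For every $(z,z')\in\mathcal H$: 1. for every $N\ge 1$, all the numbers $M_{z,z',a,b|N}(\lambda)$, $\lambda\in\mathbb{GT}^+_N$, are real and strictly positive, and $\sum_{\lambda\in\mathbb{GT}^+_N}M_{z,z',a,b|N}(\lambda)=1$,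 so that $M_{z,z',a,b|N}$ is a probability measure on $\mathbb{GT}^+_N$ charging every element; 2. for every $N\ge1$ and $\mu\in\mathbb{GT}^+_N$, $$M_{z,z',a,b|N}(\mu)=\sum_{\lambda\in\mathbb{GT}^+_{N+1}}M_{z,z',a,b|N+1}(\lambda)\,\Lambda^{N+1}_N(\lambda,\mu);$$ 3. the coherent system $(M_{z,z',a,b|N})_{N\ge1}$ determines a probability measure on $\Omega_\infty$: there is exactly one probability measure $M_{z,z',a,b|\infty}$ on $\Omega_\infty$ with $\int_{\Omega_\infty}\omega_N(\lambda)\,M_{z,z',a,b|\infty}(d\omega)=M_{z,z',a,b|N}(\lambda)$ for all $N\ge1$ and $\lambda\in\mathbb{GT}^+_N$. -/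

import Mathlib

noncomputable section

namespace BCZMeasure

open MeasureTheory

/-- Positive signatures of length `N`: weakly decreasing `N`-tuples of nonnegative integers. -/
abbrev GT (N : ℕ) : Type := {lam : Fin N → ℕ // Antitone lam}

/-- The strictly decreasing tuple `l_i = λ_i + N - i` (here `i` runs over `0, …, N - 1`,
so that `i.rev = N - 1 - i` is the required shift). -/
def shifted {N : ℕ} (lam : GT N) (i : Fin N) : ℕ := lam.1 i + (i.rev : ℕ)

/-! ### Jacobi polynomials -/

/-- The inner product of `L²([-1, 1], (1 - x)^a (1 + x)^b dx)` on real polynomials. -/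
def jacobiInner (a b : ℝ) (p q : Polynomial ℝ) : ℝ :=
  ∫ x in (-1 : ℝ)..1, p.eval x * q.eval x * ((1 - x) ^ a * (1 + x) ^ b)

/-- The univariate Jacobi polynomials: the Gram-Schmidt orthogonalization of `1, x, x², …`
in `L²([-1, 1], (1 - x)^a (1 + x)^b dx)`, in monic normalization. -/
def jacobi (a b : ℝ) (k : ℕ) : Polynomial ℝ :=
  Polynomial.X ^ k - ∑ j : Fin k,
    Polynomial.C (jacobiInner a b (Polynomial.X ^ k) (jacobi a b j) /
      jacobiInner a b (jacobi a b j) (jacobi a b j)) * jacobi a b j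
termination_by k
decreasing_by all_goals exact j.2

/-- The pairs `i < j` in `Fin N`. -/
def ltPairs (N : ℕ) : Finset (Fin N × Fin N) := Finset.univ.filter fun p => p.1 < p.2

/-- The Vandermonde polynomial `∏_{i < j} (x_i - x_j)`. -/
def vandermondePoly (N : ℕ) : MvPolynomial (Fin N) ℝ :=
  ∏ p ∈ ltPairs N, (MvPolynomial.X p.1 - MvPolynomial.X p.2)

/-- The alternant `det [P_{λ_i + N - i}(x_j)]`. -/
def jacobiAlternant (a b : ℝ) {N : ℕ} (lam : GT N) : MvPolynomial (Fin N) ℝ :=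
  Matrix.det (Matrix.of fun i j : Fin N =>
    Polynomial.aeval (MvPolynomial.X j : MvPolynomial (Fin N) ℝ) (jacobi a b (shifted lam i)))

theorem X_sub_X_dvd_jacobiAlternant (a b : ℝ) {N : ℕ} (lam : GT N) {i j : Fin N} (hij : i ≠ j) :
    (MvPolynomial.X i - MvPolynomial.X j : MvPolynomial (Fin N) ℝ) ∣ jacobiAlternant a b lam := by
  rw [← Ideal.mem_span_singleton, ← Ideal.Quotient.eq_zero_iff_mem]
  set I : Ideal (MvPolynomial (Fin N) ℝ) :=
    Ideal.span {(MvPolynomial.X i - MvPolynomial.X j : MvPolynomial (Fin N) ℝ)}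
  have hX : Ideal.Quotient.mkₐ ℝ I (MvPolynomial.X i) = Ideal.Quotient.mkₐ ℝ I (MvPolynomial.X j) :=
    Ideal.Quotient.eq.2 (Ideal.mem_span_singleton_self _)
  change Ideal.Quotient.mkₐ ℝ I (jacobiAlternant a b lam) = 0
  rw [jacobiAlternant, AlgHom.map_det]
  refine Matrix.det_zero_of_column_eq hij fun k => ?_
  simp only [AlgHom.mapMatrix_apply, Matrix.map_apply, Matrix.of_apply]
  rw [← Polynomial.aeval_algHom_apply, ← Polynomial.aeval_algHom_apply, hX]

theorem irreducible_X_sub_X {N : ℕ} {i j : Fin N} (hij : i ≠ j) :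
    Irreducible (MvPolynomial.X i - MvPolynomial.X j : MvPolynomial (Fin N) ℝ) := by
  classical
  have h := MvPolynomial.irreducible_sumSMulX
    (Finsupp.single i (1 : ℝ) - Finsupp.single j (1 : ℝ))
    ⟨i, by simp [hij.symm]⟩
    (fun r hr => by
      have := hr i
      simp only [Finsupp.coe_sub, Pi.sub_apply, Finsupp.single_apply, if_true, hij.symm,
        if_false, sub_zero] at this
      exact isUnit_of_dvd_one this)
  simpa [MvPolynomial.sumSMulX] using h

theorem vandermondePoly_dvd_jacobiAlternant (a b : ℝ) {N : ℕ} (lam : GT N) :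
    vandermondePoly N ∣ jacobiAlternant a b lam := by
  refine Finset.prod_dvd_of_isRelPrime ?_ ?_
  · rintro ⟨i, j⟩ hij ⟨k, l⟩ hkl hne
    simp only [ltPairs, Finset.coe_filter, Finset.mem_univ, true_and, Set.mem_ofPred_eq] at hij hkl
    refine ((irreducible_X_sub_X hij.ne).isRelPrime_iff_not_dvd).2 ?_
    rintro ⟨q, hq⟩
    have key : ∀ v : Fin N → ℝ, v i = v j → v k = v l := by
      intro v hv
      have := congrArg (MvPolynomial.eval v) hq
      simp only [map_sub, map_mul, MvPolynomial.eval_X, hv, sub_self, zero_mul] at this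
      exact sub_eq_zero.1 this
    by_cases hk : k = i ∨ k = j
    · have hl : l ≠ i ∧ l ≠ j := by
        constructor
        · rintro rfl
          rcases hk with rfl | rfl
          · exact lt_irrefl _ hkl
          · exact lt_asymm hij hkl
        · rintro rfl
          rcases hk with rfl | rfl
          · exact hne rfl
          · exact lt_irrefl _ hkl
      have := key (Pi.single l 1) (by simp [hl.1.symm, hl.2.symm])
      simp [hkl.ne] at this
    · push Not at hk
      have := key (Pi.single k 1) (by simp [hk.1.symm, hk.2.symm])
      simp [hkl.ne'] at this
  · intro p hp
    exact X_sub_X_dvd_jacobiAlternant a b lam (Finset.mem_filter.1 hp).2.ne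

/-- The multivariate Jacobi polynomial
`𝔓_λ(x_1, …, x_N | a, b) = det [P_{λ_i + N - i}(x_j)] / ∏_{i < j} (x_i - x_j)`. -/
def jacobiMv (a b : ℝ) {N : ℕ} (lam : GT N) : MvPolynomial (Fin N) ℝ :=
  (vandermondePoly_dvd_jacobiAlternant a b lam).choose

theorem vandermondePoly_mul_jacobiMv (a b : ℝ) {N : ℕ} (lam : GT N) :
    vandermondePoly N * jacobiMv a b lam = jacobiAlternant a b lam :=
  (vandermondePoly_dvd_jacobiAlternant a b lam).choose_spec.symm

/-- The normalized Jacobi polynomial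
`Φ_λ(x | a, b) = 𝔓_λ(x | a, b) / 𝔓_λ(1, …, 1 | a, b)`, as a function of `x`.
It does not depend on the normalization of the univariate polynomials. -/
def normJacobi (a b : ℝ) {N : ℕ} (lam : GT N) (x : Fin N → ℝ) : ℝ :=
  MvPolynomial.eval x (jacobiMv a b lam) / MvPolynomial.eval (fun _ => 1) (jacobiMv a b lam)

/-! ### The links -/

/-- `c` is the family of coefficients of the branching
`Φ_λ(x_1, …, x_N, 1) = ∑_μ c(μ) Φ_μ(x_1, …, x_N)`, a finite sum over signatures `μ`. -/
def IsBranching (a b : ℝ) {N : ℕ} (lam : GT (N + 1)) (c : GT N →₀ ℝ) : Prop :=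
  ∀ x : Fin N → ℝ,
    normJacobi a b lam (Fin.snoc x 1 : Fin (N + 1) → ℝ) = c.sum fun mu r => r * normJacobi a b mu x

open Classical in
/-- The link `Λ^{N+1}_N(λ, μ)`: the coefficients of the unique branching expansion of `Φ_λ`. -/
def link (a b : ℝ) {N : ℕ} (lam : GT (N + 1)) (mu : GT N) : ℝ :=
  if h : ∃! c : GT N →₀ ℝ, IsBranching a b lam c then h.choose mu else 0

/-! ### Parameters -/

/-- `ε = (a + b + 1) / 2`. -/
def eps (a b : ℝ) : ℝ := (a + b + 1) / 2

/-- The principal series of pairs. -/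
def Zprinc : Set (ℂ × ℂ) :=
  {p | ¬ (p.1.im = 0 ∧ p.2.im = 0) ∧ p.2 = (starRingEnd ℂ) p.1}

/-- The complementary series of pairs. -/
def Zcompl : Set (ℂ × ℂ) :=
  {p | (p.1.im = 0 ∧ p.2.im = 0) ∧
    ∃ m : ℤ, ((m : ℝ) < p.1.re ∧ p.1.re < m + 1) ∧ ((m : ℝ) < p.2.re ∧ p.2.re < m + 1)}

/-- The set `ℋ` of admissible pairs `(z, z')`. For the pairs in question `z + z'` is real, so that
the last inequality is the real inequality `z + z' + b > -1`. -/
def admissible (a b : ℝ) : Set (ℂ × ℂ) :=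
  {p | p ∈ Zprinc ∪ Zcompl ∧
    (p.1 + ((2 * eps a b : ℝ) : ℂ), p.2 + ((2 * eps a b : ℝ) : ℂ)) ∈ Zprinc ∪ Zcompl ∧
    -1 < (p.1 + p.2 + b).re}

/-! ### The z-measures -/

/-- The factor `(x + ε) Γ(x + 2ε)`, extended by continuity to its only removable singularity
`x = 0`, `ε = 0`, where `ε Γ(2ε) = Γ(2ε + 1) / 2` takes the value `1 / 2`. -/
def leadingFactor (a b : ℝ) (x : ℕ) : ℝ :=
  if x = 0 ∧ eps a b = 0 then 1 / 2 else (x + eps a b) * Real.Gamma (x + 2 * eps a b)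

/-- The weight `W_{z, z', a, b | N}(x)`. -/
def weight (a b : ℝ) (z z' : ℂ) (N x : ℕ) : ℂ :=
  leadingFactor a b x * Complex.Gamma (x + a + 1) /
      (Complex.Gamma (x + b + 1) * Complex.Gamma (x + 1)) *
    (1 / (Complex.Gamma (z - x + N) * Complex.Gamma (z' - x + N) *
      Complex.Gamma (z + x + N + 2 * eps a b) * Complex.Gamma (z' + x + N + 2 * eps a b)))

/-- The normalization constant `C_{z, z', a, b | N}` (the index `i` runs over `1, …, N`). -/
def normConst (a b : ℝ) (z z' : ℂ) (N : ℕ) : ℂ :=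
  ∏ i ∈ Finset.Icc 1 N,
    Complex.Gamma (a + i) * Complex.Gamma (b + z + z' + i) * Complex.Gamma i /
      (2 * (Complex.Gamma (z + i) * Complex.Gamma (z' + i) * Complex.Gamma (z + b + i) *
        Complex.Gamma (z' + b + i) * Complex.Gamma (z + z' + N + a + b + i)))

/-- The expression
`M_{z, z', a, b | N}(λ) = C⁻¹ ∏_{i < j} ((l_i + ε)² - (l_j + ε)²)² ∏_i W(l_i)`. -/
def zMeasure (a b : ℝ) (z z' : ℂ) (N : ℕ) (lam : GT N) : ℂ :=
  (normConst a b z z' N)⁻¹ *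
    (∏ p ∈ ltPairs N,
      (((shifted lam p.1 : ℂ) + eps a b) ^ 2 - ((shifted lam p.2 : ℂ) + eps a b) ^ 2) ^ 2) *
    ∏ i : Fin N, weight a b z z' N (shifted lam i)

/-! ### The boundary of the branching graph -/

/-- The convex set `lim M_p(GT_N)` of coherent systems of probability measures on the levels
`N = 1, 2, …`; the measure on level `n + 1` is listed under the index `n`. -/
def coherentSystems (a b : ℝ) : Set ((n : ℕ) → GT (n + 1) → ℝ) :=
  {M | (∀ n lam, 0 ≤ M n lam) ∧ (∀ n, HasSum (M n) 1) ∧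
    ∀ n (mu : GT (n + 1)), HasSum (fun lam : GT (n + 2) => M (n + 1) lam * link a b lam mu) (M n mu)}

/-- The boundary: the set of extreme points of the convex set of coherent systems. It carries the
`σ`-algebra generated by the coordinates `ω ↦ ω n λ`, which is the Borel `σ`-algebra of the
projective limit topology. -/
abbrev Boundary (a b : ℝ) : Type := (coherentSystems a b).extremePoints ℝ

end BCZMeasure

end

/-!
The weight `W_N` is the product of a positive function `U`, up to a constant the density of the
Plancherel measure of the Jacobi polynomials `p_l` normalized by `p_l(1) = 1`, and of a product
`G_N` of four values of `1 / Γ`, in which `z` and `z'` enter (`weight_eq`). The proof rests on the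
interplay of these two factors with the three-term recurrence of the `p_l`, whose tridiagonal
operator is symmetric with respect to `U`; write `A_l` for its upper coefficients.

*The links.* The recurrence telescopes to `p_l(x) - 1 = (x - 1) / 2 * ∑_m B(l, m) p_m(x)` with
`B(l, m) = U(m) ∑_{m ≤ k < l} 1 / (U(k) A_k)` (`jacobiOne_sub_one`). Hence the alternant of the `p_l`
at `(x, 1)`, a determinant with a column of ones, expands by the Cauchy-Binet formula into alternants
in `N` variables (`altOne_snoc`). With the value of a Jacobi polynomial at `(1, …, 1)`
(`eval_one_jacobiMv`) and the linear independence of the normalized polynomials this gives the link as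
an explicit multiple of `det [B(l_i, m_j) | 1]` (`link_eq`). The links are stochastic on
evaluating at `(1, …, 1)`, and nonnegative because this determinant is, by Cauchy-Binet again, a
positive combination of products of two determinants of `0`-`1` matrices attached to intervals
(`linkDet_nonneg`).

*Coherence.* The recurrence operator maps `G_N` to `G_{N+1}` times a linear polynomial in
`(l + ε)²` (`flux_succ_sub`). Lowering `z` by `j` multiplies `G_N` by a polynomial of degree `j` in
`(l + ε)²`, so the images of these functions, together with `W_{N+1}`, span the products of `W_{N+1}`
with polynomials of degree at most `N` in `(l + ε)²`. Summation by parts against `B(·, m)` recovers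
the function `U(m) G_N(m)` from its image, while the sum of the image alone vanishes
(`tsum_weight_mul_imagePoly_mul_branchKernel`, `tsum_weight_mul_imagePoly`). The Andréief identity
`hasSum_det_mul_det` therefore evaluates the sum over the upper level as a Vandermonde determinant
times weights of level `N` and the total mass of `W_{N+1}` (`hasSum_weight_mul_linkDet`). That mass is
given by Dougall's formula (`hasSum_weight_one`), proved here by showing that its normalized form is
invariant under `b → b + 1`, with a telescoping certificate, and by letting `b → ∞`. The result is
exactly the ratio of consecutive normalization constants (`normConst_succ`). The condition
`z + z' + b > -1` is what makes all these series converge.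

*Mass one.* Every weight is positive because `(z, z')` and `(z + 2ε, z' + 2ε)` lie in the principal or
complementary series (`weight_pos`). The level `N = 0` consists of one point of mass `1`, and
coherence with respect to stochastic links carries the total mass upwards by Tonelli's theorem.

*The boundary.* The integral representation holds for every sequence of countable sets with stochastic
kernels that have finite rows (`BranchingSystem`). The levels of a coherent system `M` are pushed to
the compact cube of all `[0, 1]`-valued functions on the vertices, a vertex going to the composite
links that start from it, and a limit `ν` along an ultrafilter is taken. Almost every point of
`ν` is a coherent system, because mass and coherence pass to the limit as inequalities and the mean
value is `M`. Comparing second moments of the composite links shows that almost every point is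
also regular, that is, has vanishing limiting variances (`IsLimit.ae_regular`). Regular systems are
the extreme points: the limiting second moment is affine on coherent systems and bounded below by
the strictly convex square, and conversely a coordinate of positive variance under `ν` splits `M` into a
convex combination. The levels of a regular system converge weakly to the unit mass at the system
(`IsRegular.tendsto`), so any representing measure is the limit of the levels of `M`, which gives
uniqueness.
-/

noncomputable section

namespace BCZMeasure

open Filter Topology Asymptotics
open scoped Nat

/-! ### Growth of the Gamma function along arithmetic progressions -/

theorem Gamma_add_natCast_succ {s : ℂ} (hs : ∀ j : ℕ, s + j ≠ 0) (n : ℕ) :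
    Complex.Gamma (n + (s + 1)) = (∏ j ∈ Finset.range (n + 1), (s + j)) * Complex.Gamma s := by
  induction n with
  | zero => simpa [add_comm] using Complex.Gamma_add_one s (by simpa using hs 0)
  | succ n ih =>
    rw [Finset.prod_range_succ, mul_right_comm, ← ih, mul_comm]
    have := Complex.Gamma_add_one (n + (s + 1)) (by
      have := hs (n + 1)
      push_cast at this
      convert this using 1
      ring)
    convert this using 2 <;> push_cast <;> ring

/-- Stirling's formula for quotients: `Γ(n + s) ~ n! n ^ (s - 1)`. -/
theorem tendsto_Gamma_div_factorial (s : ℂ) :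
    Tendsto (fun n : ℕ => Complex.Gamma (n + s) / (n ! * (n : ℂ) ^ (s - 1))) atTop (𝓝 1) := by
  suffices ∀ m : ℕ, ∀ s : ℂ, 1 - s.re < m →
      Tendsto (fun n : ℕ => Complex.Gamma (n + s) / (n ! * (n : ℂ) ^ (s - 1))) atTop (𝓝 1) by
    obtain ⟨m, hm⟩ := exists_nat_gt (1 - s.re)
    exact this m s hm
  intro m
  induction m with
  | zero =>
    intro s hs
    -- Euler's limit formula, applied at `s - 1`, which has positive real part
    have hs' : 0 < (s - 1).re := by simp at hs ⊢; linarith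
    have hne : ∀ j : ℕ, (s - 1) + j ≠ 0 := fun j h => by
      have := congrArg Complex.re h
      simp at this hs'
      have := Nat.cast_nonneg (α := ℝ) j
      linarith
    have hG := Complex.Gamma_ne_zero_of_re_pos hs'
    have h := (tendsto_const_nhds (x := Complex.Gamma (s - 1))).div
      (Complex.GammaSeq_tendsto_Gamma (s - 1)) hG
    rw [div_self hG] at h
    refine h.congr' ?_
    filter_upwards [eventually_ne_atTop 0] with n hn
    have h1 := Gamma_add_natCast_succ hne n
    rw [sub_add_cancel] at h1
    simp only [Pi.div_apply]
    rw [h1, Complex.GammaSeq, div_div_eq_mul_div, mul_comm ((n : ℂ) ^ _)]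
    ring
  | succ m ih =>
    intro s hs
    have h1 := ih (s + 1) (by simp at hs ⊢; linarith)
    have h2 : Tendsto (fun n : ℕ => (n : ℂ) / (n + s)) atTop (𝓝 1) := by
      simpa [add_comm] using tendsto_natCast_div_add_atTop (𝕜 := ℂ) s
    have h3 := h1.mul h2
    rw [one_mul] at h3
    refine h3.congr' ?_
    obtain ⟨k, hk⟩ := exists_nat_gt (-s.re)
    filter_upwards [eventually_ge_atTop (k + 1)] with n hn
    have hn0 : (n : ℂ) ≠ 0 := by exact_mod_cast (by lia : n ≠ 0)
    have hns : (n : ℂ) + s ≠ 0 := fun h => by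
      have := congrArg Complex.re h
      have h4 : (k : ℝ) + 1 ≤ n := by exact_mod_cast hn
      simp at this
      linarith
    have hp : (n : ℂ) ^ s ≠ 0 := by simp [Complex.cpow_eq_zero_iff, hn0]
    have hf : (n ! : ℂ) ≠ 0 := by exact_mod_cast n.factorial_ne_zero
    rw [← add_assoc, Complex.Gamma_add_one _ hns, add_sub_cancel_right,
      Complex.cpow_sub _ _ hn0, Complex.cpow_one]
    field_simp

theorem isTheta_Gamma (s : ℂ) :
    (fun n : ℕ => Complex.Gamma (n + s)) =Θ[atTop]
      fun n : ℕ => (n ! : ℝ) * (n : ℝ) ^ (s.re - 1) := by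
  have h1 : (fun n : ℕ => Complex.Gamma (n + s)) =Θ[atTop]
      fun n : ℕ => (n ! : ℂ) * (n : ℂ) ^ (s - 1) := by
    refine (isEquivalent_of_tendsto_one ?_).isTheta
    exact tendsto_Gamma_div_factorial s
  refine h1.trans_eventuallyEq ?_ |>.trans ?_ (g := fun n : ℕ => (n ! : ℂ) * (n : ℂ) ^ (s - 1))
  · rfl
  refine IsTheta.of_norm_eventuallyEq_norm ?_
  filter_upwards [eventually_gt_atTop 0] with n hn
  rw [norm_mul, norm_mul, Complex.norm_natCast_cpow_of_pos hn, Complex.norm_natCast,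
    RCLike.norm_natCast, Real.norm_of_nonneg (by positivity)]
  simp

theorem isBigO_inv_Gamma_sub (s : ℂ) :
    (fun n : ℕ => (Complex.Gamma (s - n))⁻¹) =O[atTop]
      fun n : ℕ => (n ! : ℝ) * (n : ℝ) ^ (-s.re) := by
  have h : (fun n : ℕ => (Complex.Gamma (s - n))⁻¹) =O[atTop]
      fun n : ℕ => Complex.Gamma (n + (1 - s)) := by
    refine IsBigO.of_bound (‖Complex.sin (Real.pi * s)‖ / Real.pi) ?_
    obtain ⟨k, hk⟩ := exists_nat_gt s.re
    filter_upwards [eventually_ge_atTop k] with n hn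
    -- the reflection formula moves `s - n` into the right half plane
    have h1 := Complex.Gamma_mul_Gamma_one_sub (n + (1 - s))
    have hre : 0 < ((n : ℂ) + (1 - s)).re := by
      have : (k : ℝ) ≤ n := by exact_mod_cast hn
      simp; linarith
    have hG := Complex.Gamma_ne_zero_of_re_pos hre
    have e : 1 - ((n : ℂ) + (1 - s)) = s - n := by ring
    rw [e] at h1
    have hs : ‖Complex.sin (Real.pi * (n + (1 - s)))‖ = ‖Complex.sin (Real.pi * s)‖ := by
      have : (Real.pi : ℂ) * (n + (1 - s)) = (n + 1 : ℕ) * Real.pi - Real.pi * s := by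
        push_cast; ring
      rw [this, Complex.sin_sub, Complex.sin_nat_mul_pi, zero_mul, zero_sub, norm_neg, norm_mul]
      have h3 : ‖Complex.cos ((n + 1 : ℕ) * Real.pi)‖ = 1 := by
        have := Real.cos_nat_mul_pi (n + 1)
        rw [← Complex.ofReal_natCast, ← Complex.ofReal_mul, ← Complex.ofReal_cos, this]
        simp
      rw [h3, one_mul]
    have h2 : (Complex.Gamma (s - n))⁻¹ = Complex.sin (Real.pi * (n + (1 - s))) / Real.pi *
        Complex.Gamma (n + (1 - s)) := by
      have hpi : (Real.pi : ℂ) ≠ 0 := by exact_mod_cast Real.pi_ne_zero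
      rcases eq_or_ne (Complex.Gamma (s - n)) 0 with h0 | h0
      · rw [h0, mul_zero] at h1
        have h4 : Complex.sin (Real.pi * (n + (1 - s))) = 0 := by
          by_contra h5
          exact div_ne_zero hpi h5 h1.symm
        rw [h0, h4]; simp
      · have h5 : Complex.sin (Real.pi * (n + (1 - s))) ≠ 0 := fun h6 => by
          rw [h6, div_zero] at h1
          exact mul_ne_zero hG h0 h1
        rw [eq_div_iff h5] at h1
        refine inv_eq_of_mul_eq_one_right ?_
        rw [div_mul_eq_mul_div, ← mul_div_assoc, div_eq_one_iff_eq hpi]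
        linear_combination h1
    rw [h2, norm_mul, norm_div, hs, Complex.norm_real, Real.norm_of_nonneg Real.pi_pos.le]
  have := h.trans (isTheta_Gamma (1 - s)).1
  simpa using this

end BCZMeasure

namespace BCZMeasure

open Filter Topology Asymptotics
open scoped Nat

/-! ### The two factors of the weight -/

/-- The factor `(x + ε) Γ(x + 2ε) Γ(x + a + 1) / (Γ(x + b + 1) Γ(x + 1))` of the weight. Up to a
constant it is the Plancherel density of the Jacobi polynomials normalized at `1`. -/
def plancherel (a b : ℝ) (x : ℕ) : ℝ :=
  leadingFactor a b x * Real.Gamma (x + a + 1) / (Real.Gamma (x + b + 1) * Real.Gamma (x + 1))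

/-- The factor of the weight that depends on `z` and `z'`; here `A` stands for `2ε`. -/
def gammaFactor (A : ℝ) (z z' : ℂ) (N x : ℕ) : ℂ :=
  (Complex.Gamma (z - x + N))⁻¹ * (Complex.Gamma (z' - x + N))⁻¹ *
    ((Complex.Gamma (z + x + N + A))⁻¹ * (Complex.Gamma (z' + x + N + A))⁻¹)

theorem weight_eq (a b : ℝ) (z z' : ℂ) (N x : ℕ) :
    weight a b z z' N x = plancherel a b x * gammaFactor (2 * eps a b) z z' N x := by
  simp only [weight, plancherel, gammaFactor, Complex.ofReal_div, Complex.ofReal_mul,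
    ← Complex.Gamma_ofReal, Complex.ofReal_add, Complex.ofReal_natCast, Complex.ofReal_one,
    one_div, mul_inv, Complex.ofReal_ofNat]
  ring

theorem inv_Gamma_eq (s : ℂ) : (Complex.Gamma s)⁻¹ = s * (Complex.Gamma (s + 1))⁻¹ := by
  simpa using Complex.one_div_Gamma_eq_self_mul_one_div_Gamma_add_one s

section gammaFactor

variable (A : ℝ) (z z' : ℂ) (N x : ℕ)

theorem gammaFactor_level :
    gammaFactor A z z' N x = gammaFactor A z z' (N + 1) x *
      ((z - x + N) * (z' - x + N) * ((z + x + N + A) * (z' + x + N + A))) := by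
  simp only [gammaFactor]
  rw [inv_Gamma_eq (z - x + N), inv_Gamma_eq (z' - x + N), inv_Gamma_eq (z + x + N + A),
    inv_Gamma_eq (z' + x + N + A)]
  push_cast
  simp only [← add_assoc, add_right_comm _ (A : ℂ) 1]
  ring

theorem gammaFactor_succ :
    gammaFactor A z z' N (x + 1) = gammaFactor A z z' (N + 1) x *
      ((z - x + N) * (z - x + N - 1) * ((z' - x + N) * (z' - x + N - 1))) := by
  simp only [gammaFactor]
  have h : ∀ w : ℂ, (Complex.Gamma (w - (x + 1 : ℕ) + N))⁻¹ =
      (w - x + N - 1) * ((w - x + N) * (Complex.Gamma (w - x + (N + 1 : ℕ)))⁻¹) := fun w => by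
    rw [inv_Gamma_eq, inv_Gamma_eq (_ + 1)]
    push_cast
    ring_nf
  have h2 : ∀ w : ℂ, w + (x + 1 : ℕ) + N + A = w + x + (N + 1 : ℕ) + A := fun w => by
    push_cast; ring
  rw [h, h, h2, h2]
  ring

theorem gammaFactor_pred :
    gammaFactor A z z' N x = gammaFactor A z z' (N + 1) (x + 1) *
      ((z + x + N + A) * (z + x + N + A + 1) * ((z' + x + N + A) * (z' + x + N + A + 1))) := by
  simp only [gammaFactor]
  have h : ∀ w : ℂ, (Complex.Gamma (w + x + N + A))⁻¹ = (w + x + N + A) *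
      ((w + x + N + A + 1) * (Complex.Gamma (w + (x + 1 : ℕ) + (N + 1 : ℕ) + A))⁻¹) := fun w => by
    rw [inv_Gamma_eq, inv_Gamma_eq (_ + 1)]
    push_cast
    ring_nf
  have h2 : ∀ w : ℂ, w - (x + 1 : ℕ) + (N + 1 : ℕ) = w - x + N := fun w => by
    push_cast; ring
  rw [h, h, h2, h2]
  ring

/-- Lowering `z` multiplies the factor by a linear polynomial in `(x + ε) ^ 2`. -/
theorem gammaFactor_sub_one :
    gammaFactor A (z - 1) z' N x =
      gammaFactor A z z' N x * ((z + N - 1 - x) * (z + N - 1 + A + x)) := by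
  simp only [gammaFactor]
  rw [inv_Gamma_eq (z - 1 - x + N), inv_Gamma_eq (z - 1 + x + N + A)]
  have h1 : z - 1 - x + N + 1 = z - x + N := by ring
  have h2 : z - 1 + x + N + A + 1 = z + x + N + A := by ring
  rw [h1, h2]
  ring

theorem gammaFactor_shift (k : ℕ) :
    gammaFactor A z z' (N + k) x = gammaFactor A (z + k) (z' + k) N x := by
  simp only [gammaFactor]
  push_cast
  ring_nf

theorem gammaFactor_isBigO :
    (fun x : ℕ => gammaFactor A z z' N x) =O[atTop]
      fun x : ℕ => (x : ℝ) ^ (2 - 2 * (z + z').re - 4 * N - 2 * A) := by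
  have key : ∀ w : ℂ, (fun x : ℕ => (Complex.Gamma (w - x + N))⁻¹ *
      (Complex.Gamma (w + x + N + A))⁻¹) =O[atTop]
        fun x : ℕ => (x : ℝ) ^ (1 - 2 * w.re - 2 * N - A) := fun w => by
    have h1 := isBigO_inv_Gamma_sub (w + N)
    have h2 := (isTheta_Gamma (w + N + A)).inv.1
    refine ((h1.mul h2).congr' ?_ ?_)
    · filter_upwards with x
      congr 3 <;> ring
    · filter_upwards [eventually_gt_atTop 0] with x hx
      have hx' : (0 : ℝ) < x := by exact_mod_cast hx
      have hf : (x ! : ℝ) ≠ 0 := by exact_mod_cast x.factorial_ne_zero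
      rw [mul_inv, ← Real.rpow_neg hx'.le]
      have : ((x ! : ℝ) * (x : ℝ) ^ (-(w + N).re)) *
          ((x ! : ℝ)⁻¹ * (x : ℝ) ^ (-((w + N + A).re - 1)))
          = (x : ℝ) ^ (-(w + N).re) * (x : ℝ) ^ (-((w + N + A).re - 1)) := by
        field_simp
      rw [this, ← Real.rpow_add hx']
      congr 1
      simp
      ring
  refine ((key z).mul (key z')).congr' ?_ ?_
  · filter_upwards with x
    simp only [gammaFactor]
    ring
  · filter_upwards [eventually_gt_atTop 0] with x hx
    have hx' : (0 : ℝ) < x := by exact_mod_cast hx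
    rw [← Real.rpow_add hx']
    congr 1
    simp
    ring

end gammaFactor

section plancherel

variable {a b : ℝ}

theorem eps_nonneg (hb : -1 / 2 ≤ b) (hab : b ≤ a) : 0 ≤ eps a b := by
  unfold eps; linarith

theorem leadingFactor_zero (a b : ℝ) :
    leadingFactor a b 0 = Real.Gamma (2 * eps a b + 1) / 2 := by
  by_cases h : eps a b = 0
  · simp [leadingFactor, h]
  · rw [Real.Gamma_add_one (by simpa using h)]
    simp [leadingFactor, h]
    ring

theorem leadingFactor_succ (a b : ℝ) (x : ℕ) :
    leadingFactor a b (x + 1) = (x + 1 + eps a b) * Real.Gamma (x + 1 + 2 * eps a b) := by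
  simp [leadingFactor]

theorem leadingFactor_pos (hb : -1 / 2 ≤ b) (hab : b ≤ a) (x : ℕ) : 0 < leadingFactor a b x := by
  have he := eps_nonneg hb hab
  cases x with
  | zero =>
    rw [leadingFactor_zero]
    have := Real.Gamma_pos_of_pos (s := 2 * eps a b + 1) (by linarith)
    positivity
  | succ x =>
    rw [leadingFactor_succ]
    have := Real.Gamma_pos_of_pos (s := x + 1 + 2 * eps a b) (by positivity)
    positivity

theorem plancherel_pos (hb : -1 / 2 ≤ b) (hab : b ≤ a) (x : ℕ) : 0 < plancherel a b x := by
  have hx := Nat.cast_nonneg (α := ℝ) x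
  have h1 := leadingFactor_pos hb hab x
  have h2 := Real.Gamma_pos_of_pos (s := x + a + 1) (by linarith)
  have h3 := Real.Gamma_pos_of_pos (s := x + b + 1) (by linarith)
  have h4 := Real.Gamma_pos_of_pos (s := x + 1) (by linarith)
  unfold plancherel
  positivity

/-- The coefficient `A_n` of the three-term recurrence of the Jacobi polynomials normalized at `1`.
The case `n = 0` is separated because the general formula is `0 / 0` there if `ε = 0`. -/
def recA (a b : ℝ) (n : ℕ) : ℝ :=
  if n = 0 then (a + 1) / (a + b + 2)
  else (n + a + b + 1) * (n + a + 1) / ((2 * n + a + b + 1) * (2 * n + a + b + 2))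

/-- The coefficient `C_n` of the three-term recurrence of the Jacobi polynomials normalized
at `1`. -/
def recC (a b : ℝ) (n : ℕ) : ℝ := n * (n + b) / ((2 * n + a + b) * (2 * n + a + b + 1))

theorem recA_pos (hb : -1 / 2 ≤ b) (hab : b ≤ a) (n : ℕ) : 0 < recA a b n := by
  unfold recA
  split_ifs with h
  · apply div_pos <;> linarith
  · have : (1 : ℝ) ≤ n := by exact_mod_cast Nat.one_le_iff_ne_zero.2 h
    apply div_pos <;> apply mul_pos <;> linarith

theorem plancherel_mul_recA (hb : -1 / 2 ≤ b) (hab : b ≤ a) (x : ℕ) :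
    plancherel a b x * recA a b x = Real.Gamma (x + 1 + 2 * eps a b) * Real.Gamma (x + a + 2) /
      (2 * (2 * x + 2 * eps a b + 1) * (Real.Gamma (x + b + 1) * Real.Gamma (x + 1))) := by
  have hx := Nat.cast_nonneg (α := ℝ) x
  have h2 := Real.Gamma_pos_of_pos (s := x + a + 1) (by linarith)
  have h3 := Real.Gamma_pos_of_pos (s := x + b + 1) (by linarith)
  have h4 := Real.Gamma_pos_of_pos (s := x + 1) (by linarith)
  have h5 : Real.Gamma (x + a + 2) = (x + a + 1) * Real.Gamma (x + a + 1) := by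
    rw [← Real.Gamma_add_one (by linarith)]; ring_nf
  have he := eps_nonneg hb hab
  rw [h5]
  cases x with
  | zero =>
    simp only [plancherel, leadingFactor_zero, recA, if_true, Nat.cast_zero, zero_add,
      mul_zero] at *
    rw [add_comm 1 (2 * eps a b)]
    have e1 : 2 * eps a b + 1 = a + b + 2 := by unfold eps; ring
    have e2 : a + b + 2 ≠ 0 := by linarith
    rw [e1]
    field_simp
  | succ x =>
    have h6 : Real.Gamma ((x + 1 : ℕ) + 1 + 2 * eps a b) =
        (x + 1 + 2 * eps a b) * Real.Gamma (x + 1 + 2 * eps a b) := by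
      rw [← Real.Gamma_add_one (by positivity)]; push_cast; ring_nf
    simp only [plancherel, leadingFactor_succ, recA, Nat.succ_ne_zero, if_false]
    rw [h6]
    have e1 : 2 * eps a b = a + b + 1 := by unfold eps; ring
    have e0 : eps a b = (a + b + 1) / 2 := rfl
    have hx0 := Nat.cast_nonneg (α := ℝ) x
    have e2 : 2 * ((x + 1 : ℕ) : ℝ) + a + b + 1 ≠ 0 := by push_cast; linarith
    have e3 : 2 * ((x + 1 : ℕ) : ℝ) + a + b + 2 ≠ 0 := by push_cast; linarith
    have e4 : 2 * ((x + 1 : ℕ) : ℝ) + (a + b + 1) + 1 ≠ 0 := by push_cast; linarith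
    rw [e1, e0, div_mul_div_comm, div_eq_div_iff
      (mul_ne_zero (mul_ne_zero h3.ne' h4.ne') (mul_ne_zero e2 e3))
      (mul_ne_zero (mul_ne_zero two_ne_zero e4) (mul_ne_zero h3.ne' h4.ne'))]
    push_cast
    ring

/-- Detailed balance: the tridiagonal operator of the recurrence is symmetric with respect to the
Plancherel density. -/
theorem plancherel_succ_mul_recC (hb : -1 / 2 ≤ b) (hab : b ≤ a) (x : ℕ) :
    plancherel a b (x + 1) * recC a b (x + 1) = plancherel a b x * recA a b x := by
  rw [plancherel_mul_recA hb hab]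
  have hx := Nat.cast_nonneg (α := ℝ) x
  have h3 := Real.Gamma_pos_of_pos (s := x + b + 1) (by linarith)
  have h4 := Real.Gamma_pos_of_pos (s := x + 1) (by linarith)
  have e1 : 2 * eps a b = a + b + 1 := by unfold eps; ring
  have e0 : eps a b = (a + b + 1) / 2 := rfl
  have h5 : Real.Gamma (x + 1 + 1) = (x + 1) * Real.Gamma (x + 1) := by
    rw [← Real.Gamma_add_one (by linarith)]
  have h6 : Real.Gamma (x + 1 + b + 1) = (x + b + 1) * Real.Gamma (x + b + 1) := by
    rw [← Real.Gamma_add_one (by linarith)]; ring_nf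
  have h7 : Real.Gamma (x + 1 + a + 1) = Real.Gamma (x + a + 2) := by ring_nf
  simp only [plancherel, leadingFactor_succ, recC]
  push_cast
  rw [h5, h6, h7, e1, e0]
  have e2 : 2 * ((x : ℝ) + 1) + a + b ≠ 0 := by linarith
  have e3 : 2 * ((x : ℝ) + 1) + a + b + 1 ≠ 0 := by linarith
  have e4 : 2 * (x : ℝ) + (a + b + 1) + 1 ≠ 0 := by linarith
  have e5 : (x : ℝ) + b + 1 ≠ 0 := by linarith
  have e6 : (x : ℝ) + 1 ≠ 0 := by linarith
  rw [div_mul_div_comm, div_eq_div_iff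
      (mul_ne_zero (mul_ne_zero (mul_ne_zero e5 h3.ne') (mul_ne_zero e6 h4.ne'))
        (mul_ne_zero e2 e3))
      (mul_ne_zero (mul_ne_zero two_ne_zero e4) (mul_ne_zero h3.ne' h4.ne'))]
  ring

theorem plancherel_isBigO (a b : ℝ) :
    (fun x : ℕ => plancherel a b x) =O[atTop] fun x : ℕ => (x : ℝ) ^ (2 * a + 1) := by
  have hre : ∀ s : ℝ, (fun n : ℕ => Real.Gamma (n + s)) =Θ[atTop]
      fun n : ℕ => (n ! : ℝ) * (n : ℝ) ^ (s - 1) := fun s => by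
    have := isTheta_Gamma s
    rw [Complex.ofReal_re] at this
    refine IsTheta.trans (IsTheta.of_norm_eventuallyEq_norm ?_) this
    filter_upwards with n
    have : (n + s : ℂ) = ((n + s : ℝ) : ℂ) := by push_cast; rfl
    rw [this, Complex.Gamma_ofReal, Complex.norm_real]
  have hlin : (fun x : ℕ => (x : ℝ) + eps a b) =O[atTop] fun x : ℕ => (x : ℝ) := by
    refine (isBigO_refl _ _).add (IsBigO.of_bound |eps a b| ?_)
    filter_upwards [eventually_ge_atTop 1] with x hx
    have : (1 : ℝ) ≤ x := by exact_mod_cast hx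
    rw [Real.norm_eq_abs, Real.norm_of_nonneg (by positivity)]
    exact le_mul_of_one_le_right (abs_nonneg _) this
  have h := ((hlin.mul (hre (2 * eps a b)).1).mul (hre (a + 1)).1).mul
    ((hre (b + 1)).inv.1.mul (hre 1).inv.1)
  refine h.congr' ?_ ?_
  · filter_upwards [eventually_ne_atTop 0] with x hx
    simp only [plancherel, leadingFactor, hx, false_and, if_false, ← add_assoc]
    rw [div_eq_mul_inv, mul_inv]
  · filter_upwards [eventually_gt_atTop 0] with x hx
    have hx' : (0 : ℝ) < x := by exact_mod_cast hx
    have hf : (x ! : ℝ) ≠ 0 := by exact_mod_cast x.factorial_ne_zero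
    simp only [sub_self, Real.rpow_zero, mul_one, add_sub_cancel_right, mul_inv]
    have : (x : ℝ) ^ (2 * a + 1) =
        x * (x : ℝ) ^ (2 * eps a b - 1) * (x : ℝ) ^ a * ((x : ℝ) ^ b)⁻¹ := by
      rw [← Real.rpow_neg hx'.le]
      nth_rewrite 2 [← Real.rpow_one (x : ℝ)]
      rw [← Real.rpow_add hx', ← Real.rpow_add hx', ← Real.rpow_add hx']
      congr 1
      unfold eps
      ring
    rw [this]
    field_simp

end plancherel

/-- The decay of the weight; the parameter range makes all moments used below converge. -/
theorem weight_isBigO (a b : ℝ) (z z' : ℂ) (N : ℕ) :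
    (fun x : ℕ => weight a b z z' N x) =O[atTop]
      fun x : ℕ => (x : ℝ) ^ (1 - 2 * (z + z' + b).re - 4 * N) := by
  have h1 : (fun x : ℕ => (plancherel a b x : ℂ)) =O[atTop] fun x : ℕ => (x : ℝ) ^ (2 * a + 1) :=
    ((plancherel_isBigO a b).norm_left.congr_left fun x => (Complex.norm_real _).symm).of_norm_left
  refine (h1.mul (gammaFactor_isBigO (2 * eps a b) z z' N)).congr' ?_ ?_
  · filter_upwards with x
    rw [weight_eq]
  · filter_upwards [eventually_gt_atTop 0] with x hx
    have hx' : (0 : ℝ) < x := by exact_mod_cast hx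
    rw [← Real.rpow_add hx']
    congr 1
    simp [eps]
    ring

end BCZMeasure

namespace BCZMeasure

open Filter Topology Asymptotics
open scoped Nat

/-! ### Dougall's summation of the weight -/

theorem isBigO_rpow_summable {f : ℕ → ℂ} {p : ℝ} (hf : f =O[atTop] fun x : ℕ => (x : ℝ) ^ p)
    (hp : p < -1) : Summable f :=
  summable_of_isBigO_nat (Real.summable_nat_rpow.2 hp) hf

theorem isBigO_rpow_tendsto_zero {f : ℕ → ℂ} {p : ℝ} (hf : f =O[atTop] fun x : ℕ => (x : ℝ) ^ p)
    (hp : p < 0) : Tendsto f atTop (𝓝 0) := by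
  refine hf.trans_tendsto ?_
  have := (tendsto_rpow_neg_atTop (y := -p) (by linarith)).comp tendsto_natCast_atTop_atTop
  simpa [Function.comp_def] using this

section Dougall

variable {a b : ℝ} {z z' : ℂ}

/-- The factor common to the terms with parameters `b` and `b + 1`. -/
def dougallCore (a b : ℝ) (z z' : ℂ) (x : ℕ) : ℂ :=
  Real.Gamma (x + a + b + 2) * Real.Gamma (x + a + 1) /
      (Real.Gamma (x + b + 2) * Real.Gamma (x + 1)) *
    ((Complex.Gamma (z - x + 1))⁻¹ * (Complex.Gamma (z' - x + 1))⁻¹ *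
      ((Complex.Gamma (z + x + a + b + 3))⁻¹ * (Complex.Gamma (z' + x + a + b + 3))⁻¹))

theorem weight_one_b_add_one (hb : -1 / 2 ≤ b) (ha : -1 / 2 ≤ a) (x : ℕ) :
    weight a (b + 1) z z' 1 x = (2 * x + a + b + 2) / 2 * dougallCore a b z z' x := by
  have hx := Nat.cast_nonneg (α := ℝ) x
  have e1 : 2 * eps a (b + 1) = a + b + 2 := by unfold eps; ring
  have h1 : leadingFactor a (b + 1) x = (2 * x + a + b + 2) / 2 * Real.Gamma (x + a + b + 2) := by
    have : ¬ (x = 0 ∧ eps a (b + 1) = 0) := fun h => by rw [h.2] at e1; linarith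
    rw [leadingFactor, if_neg this, e1]
    unfold eps
    ring_nf
  rw [weight_eq, plancherel, gammaFactor, h1, e1, dougallCore]
  have h2 : (x : ℝ) + (b + 1) + 1 = x + b + 2 := by ring
  have h3 : ∀ w : ℂ, w + x + (1 : ℕ) + ((a + b + 2 : ℝ) : ℂ) = w + x + a + b + 3 := fun w => by
    push_cast; ring
  rw [h2, h3, h3]
  push_cast
  ring

theorem weight_one_eq (hb : -1 / 2 ≤ b) (ha : -1 / 2 ≤ a) {x : ℕ} (hx : x ≠ 0) :
    weight a b z z' 1 x = (2 * x + a + b + 1) / 2 * ((x + b + 1) * (z + x + a + b + 2) *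
      (z' + x + a + b + 2) / (x + a + b + 1)) * dougallCore a b z z' x := by
  have hx : (1 : ℝ) ≤ x := by exact_mod_cast Nat.one_le_iff_ne_zero.2 hx
  have e1 : 2 * eps a b = a + b + 1 := by unfold eps; ring
  have h1 : leadingFactor a b x = (2 * x + a + b + 1) / 2 * Real.Gamma (x + a + b + 1) := by
    have : ¬ (x = 0 ∧ eps a b = 0) := fun h => by simp [h.1] at hx; linarith
    rw [leadingFactor, if_neg this, e1]
    unfold eps
    ring_nf
  have h2 : Real.Gamma (x + a + b + 2) = (x + a + b + 1) * Real.Gamma (x + a + b + 1) := by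
    rw [← Real.Gamma_add_one (by linarith)]; ring_nf
  have h3 : Real.Gamma (x + b + 2) = (x + b + 1) * Real.Gamma (x + b + 1) := by
    rw [← Real.Gamma_add_one (by linarith)]; ring_nf
  have h4 : ∀ w : ℂ, (Complex.Gamma (w + x + (1 : ℕ) + ((a + b + 1 : ℝ) : ℂ)))⁻¹ =
      (w + x + a + b + 2) * (Complex.Gamma (w + x + a + b + 3))⁻¹ := fun w => by
    rw [inv_Gamma_eq]
    push_cast
    ring_nf
  have h5 : (x : ℂ) + a + b + 1 ≠ 0 := by
    have : (x : ℝ) + a + b + 1 ≠ 0 := by linarith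
    exact_mod_cast this
  have h6 : (x : ℂ) + b + 1 ≠ 0 := by
    have : (x : ℝ) + b + 1 ≠ 0 := by linarith
    exact_mod_cast this
  rw [weight_eq, plancherel, gammaFactor, h1, e1, dougallCore, h2, h3, h4, h4]
  generalize Real.Gamma (x + a + b + 1) = g1
  generalize Real.Gamma (x + a + 1) = g2
  generalize Real.Gamma (x + b + 1) = g3
  generalize Real.Gamma (x + 1) = g4
  generalize (Complex.Gamma (z + x + a + b + 3))⁻¹ = g5
  generalize (Complex.Gamma (z' + x + a + b + 3))⁻¹ = g6
  push_cast
  generalize (Complex.Gamma (z - x + 1))⁻¹ = g7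
  generalize (Complex.Gamma (z' - x + 1))⁻¹ = g8
  have h7 := mul_inv_cancel₀ h5
  have h8 := mul_inv_cancel₀ h6
  simp only [div_eq_mul_inv, mul_inv]
  generalize ((x : ℂ) + b + 1)⁻¹ = i at *
  generalize ((x : ℂ) + a + b + 1)⁻¹ = i' at *
  generalize (g3 : ℂ)⁻¹ = j3
  generalize (g4 : ℂ)⁻¹ = j4
  linear_combination (exp := 1) -((2 * (x : ℂ) + a + b + 1) * 2⁻¹ * g1 * g2 * (j3 * j4) *
      (g7 * g8 * ((z + x + a + b + 2) * g5 * ((z' + x + a + b + 2) * g6)))) *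
      ((x + a + b + 1) * i' * h8 + h7)

theorem weight_one_zero (hb : -1 / 2 ≤ b) :
    weight a b z z' 1 0 = 1 / 2 * ((b + 1) * (z + a + b + 2) * (z' + a + b + 2)) *
      dougallCore a b z z' 0 := by
  have e1 : 2 * eps a b = a + b + 1 := by unfold eps; ring
  have h3 : Real.Gamma (b + 2) = (b + 1) * Real.Gamma (b + 1) := by
    rw [← Real.Gamma_add_one (by linarith)]; ring_nf
  have h4 : ∀ w : ℂ, (Complex.Gamma (w + (1 : ℕ) + ((a + b + 1 : ℝ) : ℂ)))⁻¹ =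
      (w + a + b + 2) * (Complex.Gamma (w + a + b + 3))⁻¹ := fun w => by
    rw [inv_Gamma_eq]
    push_cast
    ring_nf
  have h6 : (b : ℂ) + 1 ≠ 0 := by
    have : b + 1 ≠ 0 := by linarith
    exact_mod_cast this
  have h7 : a + b + 1 + 1 = a + b + 2 := by ring
  rw [weight_eq, plancherel, gammaFactor, leadingFactor_zero, e1, dougallCore]
  simp only [Nat.cast_zero, zero_add, add_zero, sub_zero, h3, h4, h7]
  push_cast
  field_simp

theorem weight_one_succ (hb : -1 / 2 ≤ b) (ha : -1 / 2 ≤ a) (x : ℕ) :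
    weight a b z z' 1 (x + 1) * (x + 1) / (2 * x + a + b + 3) =
      1 / 2 * ((x + a + 1) * (z - x) * (z' - x)) * dougallCore a b z z' x := by
  have hx := Nat.cast_nonneg (α := ℝ) x
  have e1 : 2 * eps a b = a + b + 1 := by unfold eps; ring
  have h1 : leadingFactor a b (x + 1) = (2 * x + a + b + 3) / 2 * Real.Gamma (x + a + b + 2) := by
    rw [leadingFactor_succ, e1]
    unfold eps
    ring_nf
  have h2 : Real.Gamma ((x + 1 : ℕ) + a + 1) = (x + a + 1) * Real.Gamma (x + a + 1) := by
    rw [← Real.Gamma_add_one (by linarith)]; push_cast; ring_nf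
  have h3 : Real.Gamma ((x + 1 : ℕ) + 1) = (x + 1) * Real.Gamma (x + 1) := by
    rw [← Real.Gamma_add_one (by linarith)]; push_cast; ring_nf
  have h4 : ∀ w : ℂ, (Complex.Gamma (w - (x + 1 : ℕ) + (1 : ℕ)))⁻¹ =
      (w - x) * (Complex.Gamma (w - x + 1))⁻¹ := fun w => by
    rw [inv_Gamma_eq]
    push_cast
    ring_nf
  have h5 : ∀ w : ℂ, w + (x + 1 : ℕ) + (1 : ℕ) + ((a + b + 1 : ℝ) : ℂ) = w + x + a + b + 3 :=
    fun w => by push_cast; ring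
  have h6 : (x : ℂ) + 1 ≠ 0 := by exact_mod_cast x.succ_ne_zero
  have h7 : 2 * (x : ℂ) + a + b + 3 ≠ 0 := by
    have : 2 * (x : ℝ) + a + b + 3 ≠ 0 := by linarith
    exact_mod_cast this
  have h8 : ((x + 1 : ℕ) : ℝ) + b + 1 = x + b + 2 := by push_cast; ring
  rw [weight_eq, plancherel, gammaFactor, h1, e1, dougallCore, h2, h3, h4, h4, h5, h5, h8]
  generalize Real.Gamma (x + a + b + 2) = g1
  generalize Real.Gamma (x + a + 1) = g2
  generalize Real.Gamma (x + b + 2) = g3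
  generalize Real.Gamma (x + 1) = g4
  generalize (Complex.Gamma (z + x + a + b + 3))⁻¹ = g5
  generalize (Complex.Gamma (z' + x + a + b + 3))⁻¹ = g6
  generalize (Complex.Gamma (z - x + 1))⁻¹ = g7
  generalize (Complex.Gamma (z' - x + 1))⁻¹ = g8
  push_cast
  have h9 := mul_inv_cancel₀ h7
  have h10 := mul_inv_cancel₀ h6
  simp only [div_eq_mul_inv, mul_inv]
  generalize (2 * (x : ℂ) + a + b + 3)⁻¹ = i at *
  generalize ((x : ℂ) + 1)⁻¹ = i' at *
  generalize (g3 : ℂ)⁻¹ = j3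
  generalize (g4 : ℂ)⁻¹ = j4
  linear_combination (1 * 2⁻¹ * ((x + a + 1) * (z - x) * (z' - x)) * g1 * g2 * (j3 * j4) *
      (g7 * g8 * (g5 * g6))) * ((x + 1) * i' * h9 + h10)

/-- The Wilf-Zeilberger certificate for the shift `b → b + 1`. -/
theorem sum_range_weight_one (hb : -1 / 2 ≤ b) (ha : -1 / 2 ≤ a) (n : ℕ) :
    ∑ x ∈ Finset.range n,
      ((z + b + 1) * (z' + b + 1) * (z + z' + a + b + 2) * weight a (b + 1) z z' 1 x -
        (z + z' + b + 1) * weight a b z z' 1 x) =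
      weight a b z z' 1 n * n / (2 * n + a + b + 1) * (n + z + z' + a + 2 * b + 2) := by
  induction n with
  | zero => simp
  | succ n ih =>
    have e : 2 * ((n + 1 : ℕ) : ℂ) + a + b + 1 = 2 * n + a + b + 3 := by push_cast; ring
    have hs := weight_one_succ (z := z) (z' := z') hb ha n
    rw [Finset.sum_range_succ, ih, e]
    push_cast at hs ⊢
    rw [hs, weight_one_b_add_one hb ha]
    rcases eq_or_ne n 0 with rfl | hn
    · rw [weight_one_zero hb]
      push_cast
      ring
    · have hx : (1 : ℝ) ≤ n := by exact_mod_cast Nat.one_le_iff_ne_zero.2 hn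
      have h5 : (n : ℂ) + a + b + 1 ≠ 0 := by
        have : (n : ℝ) + a + b + 1 ≠ 0 := by linarith
        exact_mod_cast this
      have h7 : 2 * (n : ℂ) + a + b + 1 ≠ 0 := by
        have : 2 * (n : ℝ) + a + b + 1 ≠ 0 := by linarith
        exact_mod_cast this
      rw [weight_one_eq hb ha hn]
      generalize dougallCore a b z z' n = K
      generalize h8 : 2 * (n : ℂ) + a + b + 1 = d at h7
      generalize h9 : (n : ℂ) + a + b + 1 = f at h5
      field_simp
      subst h8 h9
      ring

theorem summable_weight_one (hσ : -1 < (z + z' + b).re) : Summable (weight a b z z' 1) :=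
  isBigO_rpow_summable (weight_isBigO a b z z' 1) (by push_cast; linarith)

theorem tsum_weight_one_b_add_one (hb : -1 / 2 ≤ b) (ha : -1 / 2 ≤ a)
    (hσ : -1 < (z + z' + b).re) :
    (z + b + 1) * (z' + b + 1) * (z + z' + a + b + 2) * ∑' x, weight a (b + 1) z z' 1 x =
      (z + z' + b + 1) * ∑' x, weight a b z z' 1 x := by
  have hσ' : -1 < (z + z' + (b + 1 : ℝ)).re := by
    simp at hσ ⊢; linarith
  have h1 := (summable_weight_one (a := a) hσ').hasSum.mul_left
    ((z + b + 1) * (z' + b + 1) * (z + z' + a + b + 2))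
  have h2 := (summable_weight_one (a := a) hσ).hasSum.mul_left (z + z' + b + 1)
  have h3 := (h1.sub h2).tendsto_sum_nat
  simp_rw [sum_range_weight_one hb ha] at h3
  rw [← sub_eq_zero]
  refine tendsto_nhds_unique h3 ?_
  have h4 : (fun n : ℕ => weight a b z z' 1 n * n / (2 * n + a + b + 1) *
      (n + z + z' + a + 2 * b + 2)) =O[atTop]
      fun n : ℕ => (n : ℝ) ^ (1 - 2 * (z + z' + b).re - 4 * (1 : ℕ) + 1) := by
    have h5 : (fun n : ℕ => (n : ℂ) / (2 * n + a + b + 1) * (n + z + z' + a + 2 * b + 2)) =O[atTop]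
        fun n : ℕ => (n : ℝ) := by
      refine IsBigO.of_bound (1 + ‖z + z' + a + 2 * b + 2‖) ?_
      filter_upwards [eventually_ge_atTop 1] with n hn
      have hn : (1 : ℝ) ≤ n := by exact_mod_cast hn
      have h6 : ‖(n : ℂ) / (2 * n + a + b + 1)‖ ≤ 1 := by
        have : (2 * n + a + b + 1 : ℂ) = ((2 * n + a + b + 1 : ℝ) : ℂ) := by push_cast; rfl
        rw [this, norm_div, Complex.norm_natCast, Complex.norm_real,
          Real.norm_of_nonneg (by linarith)]
        exact div_le_one_of_le₀ (by linarith) (by linarith)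
      have h7 : ‖(n : ℂ) + z + z' + a + 2 * b + 2‖ ≤ (1 + ‖z + z' + a + 2 * b + 2‖) * n := by
        have : (n : ℂ) + z + z' + a + 2 * b + 2 = n + (z + z' + a + 2 * b + 2) := by ring
        rw [this]
        refine (norm_add_le _ _).trans ?_
        rw [Complex.norm_natCast]
        nlinarith [norm_nonneg (z + z' + a + 2 * b + 2)]
      rw [norm_mul, Real.norm_of_nonneg (by linarith)]
      exact (mul_le_mul h6 h7 (norm_nonneg _) zero_le_one).trans_eq (one_mul _)
    refine ((weight_isBigO a b z z' 1).mul h5).congr' ?_ ?_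
    · filter_upwards with n
      ring
    · filter_upwards [eventually_gt_atTop 0] with n hn
      rw [Real.rpow_add (by exact_mod_cast hn), Real.rpow_one]
  exact isBigO_rpow_tendsto_zero h4 (by push_cast; linarith)

/-- The ratio of consecutive terms of the series; `B` stands for `a + b + 1`. -/
def dougallRatio (a : ℝ) (z z' : ℂ) (B : ℝ) (x : ℕ) : ℂ :=
  (B + x) / (B - a + x) * ((B + 2 * x + 2) / (B + 2 * x)) * ((a + 1 + x) / (x + 1)) *
    ((x - z) / (x + 1)) * ((x - z') / (x + 1)) *
    ((x + 1) / (z + 1 + B + x)) * ((x + 1) / (z' + 1 + B + x))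

theorem mul_le_one_add {X Y α β u : ℝ} (hY : 0 ≤ Y) (hα : 0 ≤ α) (hβ : 0 ≤ β)
    (hu : 0 ≤ u) (hu1 : u ≤ 1) (h1 : X ≤ 1 + α * u) (h2 : Y ≤ 1 + β * u) :
    X * Y ≤ 1 + (α + β + α * β) * u := by
  have h3 : X * Y ≤ (1 + α * u) * (1 + β * u) := by
    apply mul_le_mul h1 h2 hY; positivity
  nlinarith [mul_nonneg (mul_nonneg hα hβ) (mul_nonneg hu (sub_nonneg.2 hu1))]

theorem exists_norm_dougallRatio_le (a : ℝ) (z z' : ℂ) :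
    ∃ c C : ℝ, 0 ≤ C ∧ ∀ B : ℝ, c + 1 ≤ B → ∀ x : ℕ,
      ‖dougallRatio a z z' B x‖ ≤ (x + 1) * (x + 1 + C) / (B + x - c) ^ 2 := by
  set c : ℝ := ‖z‖ + ‖z'‖ + |a| + 1 with hc
  have hz := norm_nonneg z
  have hz' := norm_nonneg z'
  have ha1 := neg_abs_le a
  have ha2 := le_abs_self a
  have ha3 := abs_nonneg a
  have hc0 : 0 ≤ c := by positivity
  let f : ℝ → ℝ → ℝ := fun α β => α + β + α * β
  have hf : ∀ α β, 0 ≤ α → 0 ≤ β → 0 ≤ f α β := fun α β h1 h2 => by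
    simp only [f]; positivity
  have hC0 : 0 ≤ f (f (f (f c 2) c) c) c :=
    hf _ _ (hf _ _ (hf _ _ (hf _ _ hc0 zero_le_two) hc0) hc0) hc0
  refine ⟨c, f (f (f (f c 2) c) c) c, hC0, fun B hB x => ?_⟩
  have hx := Nat.cast_nonneg (α := ℝ) x
  have hL : (x : ℝ) + 1 ≤ B + x - c := by linarith
  have hL0 : 0 < B + x - c := by linarith
  set y : ℝ := x + 1 with hy
  have hy0 : 0 < y := by positivity
  set u : ℝ := 1 / y with hu
  have hu0 : 0 ≤ u := by positivity
  have hu1 : u ≤ 1 := by rw [hu]; apply div_le_one_of_le₀ <;> linarith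
  have hyu : y * u = 1 := by rw [hu]; field_simp
  have h1 : ‖((B : ℂ) + x) / (B - a + x)‖ ≤ 1 + c * u := by
    have e : ((B : ℂ) + x) / (B - a + x) = (((B + x) / (B - a + x) : ℝ) : ℂ) := by push_cast; rfl
    rw [e, Complex.norm_real, Real.norm_of_nonneg (by apply div_nonneg <;> linarith),
      div_le_iff₀ (by linarith)]
    have : 1 ≤ u * (B - a + x) := by
      rw [← hyu, mul_comm]; exact mul_le_mul_of_nonneg_left (by linarith) hu0
    nlinarith
  have h2 : ‖((B : ℂ) + 2 * x + 2) / (B + 2 * x)‖ ≤ 1 + 2 * u := by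
    have e : ((B : ℂ) + 2 * x + 2) / (B + 2 * x) = (((B + 2 * x + 2) / (B + 2 * x) : ℝ) : ℂ) := by
      push_cast; rfl
    rw [e, Complex.norm_real, Real.norm_of_nonneg (by apply div_nonneg <;> linarith),
      div_le_iff₀ (by linarith)]
    have : 1 ≤ u * (B + 2 * x) := by
      rw [← hyu, mul_comm]; exact mul_le_mul_of_nonneg_left (by linarith) hu0
    nlinarith
  have ey : ‖(x : ℂ) + 1‖ = y := by
    have : (x : ℂ) + 1 = ((x + 1 : ℝ) : ℂ) := by push_cast; rfl
    rw [this, Complex.norm_real, Real.norm_of_nonneg (by positivity)]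
  have hdiv : ∀ w : ℂ, ‖w‖ ≤ x + c → ‖w / (x + 1)‖ ≤ 1 + c * u := fun w hw => by
    rw [norm_div, ey, div_le_iff₀ hy0]
    nlinarith
  have h3 : ‖((a : ℂ) + 1 + x) / (x + 1)‖ ≤ 1 + c * u := by
    refine hdiv _ ?_
    have : (a : ℂ) + 1 + x = ((a + 1 + x : ℝ) : ℂ) := by push_cast; rfl
    rw [this, Complex.norm_real, Real.norm_eq_abs, abs_le]
    constructor <;> linarith
  have h4 : ‖((x : ℂ) - z) / (x + 1)‖ ≤ 1 + c * u := by
    refine hdiv _ ((norm_sub_le _ _).trans ?_)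
    rw [Complex.norm_natCast]; linarith
  have h5 : ‖((x : ℂ) - z') / (x + 1)‖ ≤ 1 + c * u := by
    refine hdiv _ ((norm_sub_le _ _).trans ?_)
    rw [Complex.norm_natCast]; linarith
  have hden : ∀ w : ℂ, ‖w‖ ≤ c →
      ‖((x : ℂ) + 1) / (w + 1 + B + x)‖ ≤ y / (B + x - c) := fun w hw => by
    rw [norm_div, ey]
    refine div_le_div_of_nonneg_left hy0.le hL0 ?_
    have e : w + 1 + B + x = ((1 + B + x : ℝ) : ℂ) - (-w) := by push_cast; ring
    rw [e]
    refine le_trans ?_ (norm_sub_norm_le _ _)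
    rw [Complex.norm_real, Real.norm_of_nonneg (by linarith), norm_neg]
    linarith
  have h6 := hden z (by linarith)
  have h7 := hden z' (by linarith)
  have m1 := mul_le_one_add (norm_nonneg _) hc0 zero_le_two hu0 hu1 h1 h2
  have m2 := mul_le_one_add (norm_nonneg _) (hf _ _ hc0 zero_le_two) hc0 hu0 hu1 m1 h3
  have m3 := mul_le_one_add (norm_nonneg _) (hf _ _ (hf _ _ hc0 zero_le_two) hc0) hc0 hu0 hu1 m2 h4
  have m4 := mul_le_one_add (norm_nonneg _)
    (hf _ _ (hf _ _ (hf _ _ hc0 zero_le_two) hc0) hc0) hc0 hu0 hu1 m3 h5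
  simp only [dougallRatio, norm_mul]
  have m5 := mul_le_mul m4 h6 (norm_nonneg _) (by positivity)
  have m6 := mul_le_mul m5 h7 (norm_nonneg _) (by positivity)
  refine m6.trans_eq ?_
  change (1 + f (f (f (f c 2) c) c) c * u) * _ * _ = _
  rw [hu]
  field_simp

theorem weight_one_ratio (hb : -1 / 2 ≤ b) (ha : -1 / 2 ≤ a) (hB : 0 < a + b + 1)
    (hz : ∀ n : ℕ, z + a + b + 2 + n ≠ 0) (hz' : ∀ n : ℕ, z' + a + b + 2 + n ≠ 0) (x : ℕ) :
    weight a b z z' 1 (x + 1) = dougallRatio a z z' (a + b + 1) x * weight a b z z' 1 x := by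
  have hx := Nat.cast_nonneg (α := ℝ) x
  have h0 := weight_one_succ (z := z) (z' := z') hb ha x
  have h7 : 2 * (x : ℂ) + a + b + 3 ≠ 0 := by
    have : 2 * (x : ℝ) + a + b + 3 ≠ 0 := by linarith
    exact_mod_cast this
  have h1 : (x : ℂ) + 1 ≠ 0 := by exact_mod_cast x.succ_ne_zero
  have h2 : (a : ℂ) + b + 1 + x ≠ 0 := by
    have : a + b + 1 + x ≠ 0 := by linarith
    exact_mod_cast this
  have h3 : (a : ℂ) + b + 1 + 2 * x ≠ 0 := by
    have : a + b + 1 + 2 * x ≠ 0 := by linarith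
    exact_mod_cast this
  have h4 : (a : ℂ) + b + 1 - a + x ≠ 0 := by
    have : a + b + 1 - a + x ≠ 0 := by linarith
    exact_mod_cast this
  have h5 := hz x
  have h6 := hz' x
  rw [div_eq_iff h7] at h0
  have h8 : weight a b z z' 1 x = (2 * x + a + b + 1) / 2 * ((x + b + 1) * (z + x + a + b + 2) *
      (z' + x + a + b + 2) / (x + a + b + 1)) * dougallCore a b z z' x := by
    rcases eq_or_ne x 0 with rfl | hx0
    · rw [weight_one_zero hb]
      have : (a : ℂ) + b + 1 ≠ 0 := by simpa using h2
      push_cast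
      simp only [mul_zero, zero_add, add_zero]
      field_simp
    · exact weight_one_eq hb ha hx0
  refine mul_right_cancel₀ h1 ?_
  rw [h0, h8, dougallRatio]
  generalize dougallCore a b z z' x = K
  push_cast
  have e5 : z + 1 + (a + b + 1) + x = z + a + b + 2 + x := by ring
  have e6 : z' + 1 + (a + b + 1) + x = z' + a + b + 2 + x := by ring
  have e7 : z + x + a + b + 2 = z + a + b + 2 + x := by ring
  have e8 : z' + x + a + b + 2 = z' + a + b + 2 + x := by ring
  have e9 : (x : ℂ) + a + b + 1 = a + b + 1 + x := by ring
  have e10 : 2 * (x : ℂ) + a + b + 1 = a + b + 1 + 2 * x := by ring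
  have e11 : (x : ℂ) + b + 1 = a + b + 1 - a + x := by ring
  have e12 : (a : ℂ) + b + 1 + 2 * x + 2 = 2 * x + a + b + 3 := by ring
  rw [e5, e6, e7, e8, e9, e10, e11, e12]
  generalize z + a + b + 2 + x = d1 at *
  generalize z' + a + b + 2 + x = d2 at *
  generalize (a : ℂ) + b + 1 - a + x = d3 at *
  generalize (a : ℂ) + b + 1 + 2 * x = d4 at *
  generalize (a : ℂ) + b + 1 + x = d5 at *
  field_simp
  ring

theorem weight_one_eq_prod (hb : -1 / 2 ≤ b) (ha : -1 / 2 ≤ a) (hB : 0 < a + b + 1)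
    (hz : ∀ n : ℕ, z + a + b + 2 + n ≠ 0) (hz' : ∀ n : ℕ, z' + a + b + 2 + n ≠ 0) (x : ℕ) :
    weight a b z z' 1 x =
      weight a b z z' 1 0 * ∏ j ∈ Finset.range x, dougallRatio a z z' (a + b + 1) j := by
  induction x with
  | zero => simp
  | succ x ih => rw [weight_one_ratio hb ha hB hz hz', ih, Finset.prod_range_succ]; ring

theorem prod_range_div_add_two (x : ℕ) :
    ∏ j ∈ Finset.range x, (((j : ℝ) + 1) / (j + 3)) = 2 / ((x + 1) * (x + 2)) := by
  induction x with
  | zero => norm_num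
  | succ x ih =>
    rw [Finset.prod_range_succ, ih]
    push_cast
    field_simp
    ring

/-- As `B → ∞` only the first term of the series normalized by its first term survives. -/
theorem tendsto_tsum_prod_dougallRatio (a : ℝ) (z z' : ℂ) :
    Tendsto (fun B : ℝ => ∑' x : ℕ, ∏ j ∈ Finset.range x, dougallRatio a z z' B j) atTop (𝓝 1) := by
  obtain ⟨c, C, hC, h⟩ := exists_norm_dougallRatio_le a z z'
  have hsum : Summable fun x : ℕ => 2 / (((x : ℝ) + 1) * (x + 2)) := by
    refine Summable.of_nonneg_of_le (fun x => by positivity) (fun x => ?_)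
      (((summable_nat_add_iff 1).2 (Real.summable_one_div_nat_pow.2 one_lt_two)).mul_left 2)
    rw [mul_one_div]
    push_cast
    gcongr
    nlinarith [Nat.cast_nonneg (α := ℝ) x]
  have hlim : ∀ j : ℕ, Tendsto (fun B : ℝ => dougallRatio a z z' B j) atTop (𝓝 0) := fun j => by
    refine squeeze_zero_norm'
      (a := fun B : ℝ => ((j : ℝ) + 1) * (j + 1 + C) / (B + j - c) ^ 2) ?_ ?_
    · filter_upwards [eventually_ge_atTop (c + 1)] with B hB using h B hB j
    · refine Tendsto.const_div_atTop ?_ _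
      have : Tendsto (fun B : ℝ => B + (j - c)) atTop atTop :=
        tendsto_atTop_add_const_right _ _ tendsto_id
      refine (tendsto_pow_atTop two_ne_zero).comp (this.congr fun B => ?_)
      ring
  have hbound : ∀ᶠ B : ℝ in atTop, ∀ x : ℕ,
      ‖∏ j ∈ Finset.range x, dougallRatio a z z' B j‖ ≤ 2 / (((x : ℝ) + 1) * (x + 2)) := by
    filter_upwards [eventually_ge_atTop (c + 3 + C)] with B hB x
    rw [norm_prod, ← prod_range_div_add_two]
    refine Finset.prod_le_prod (fun _ _ => norm_nonneg _) fun j _ => (h B (by linarith) j).trans ?_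
    have hj := Nat.cast_nonneg (α := ℝ) j
    rw [div_le_div_iff₀ (by nlinarith) (by positivity)]
    have h1 : ((j : ℝ) + 1 + C) * (j + 3) ≤ (B + j - c) ^ 2 := by
      rw [sq]
      exact mul_le_mul (by linarith) (by linarith) (by positivity) (by linarith)
    nlinarith
  have := tendsto_tsum_of_dominated_convergence (𝓕 := atTop)
    (f := fun (B : ℝ) (x : ℕ) => ∏ j ∈ Finset.range x, dougallRatio a z z' B j)
    (g := fun x : ℕ => ∏ j ∈ Finset.range x, (0 : ℂ)) hsum
    (fun x => tendsto_finsetProd _ fun j _ => hlim j) hbound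
  rwa [tsum_eq_single 0 (fun x hx => by simp [hx]), Finset.prod_range_zero] at this

/-- A quotient of four values of `Γ` by four others tends to `1` along integer shifts if the sums
of the arguments agree. -/
theorem tendsto_Gamma_quotient {p q r s p' q' r' s' : ℂ}
    (h : p + q + r + s = p' + q' + r' + s') :
    Tendsto (fun n : ℕ => Complex.Gamma (n + p) * Complex.Gamma (n + q) * Complex.Gamma (n + r) *
      Complex.Gamma (n + s) / (Complex.Gamma (n + p') * Complex.Gamma (n + q') *
      Complex.Gamma (n + r') * Complex.Gamma (n + s'))) atTop (𝓝 1) := by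
  have h1 := (((tendsto_Gamma_div_factorial p).mul (tendsto_Gamma_div_factorial q)).mul
    (tendsto_Gamma_div_factorial r)).mul (tendsto_Gamma_div_factorial s)
  have h2 := (((tendsto_Gamma_div_factorial p').mul (tendsto_Gamma_div_factorial q')).mul
    (tendsto_Gamma_div_factorial r')).mul (tendsto_Gamma_div_factorial s')
  have h3 := h1.div h2 (by simp)
  have h0 : (1 : ℂ) * 1 * 1 * 1 / (1 * 1 * 1 * 1) = 1 := by norm_num
  rw [h0] at h3
  refine h3.congr' ?_
  filter_upwards [eventually_ne_atTop 0] with n hn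
  have hn : (n : ℂ) ≠ 0 := by exact_mod_cast hn
  have hf : (n ! : ℂ) ≠ 0 := by exact_mod_cast n.factorial_ne_zero
  have hp : ∀ w : ℂ, (n : ℂ) ^ w ≠ 0 := fun w => by simp [Complex.cpow_eq_zero_iff, hn]
  have e : (n : ℂ) ^ (p - 1) * (n : ℂ) ^ (q - 1) * (n : ℂ) ^ (r - 1) * (n : ℂ) ^ (s - 1) =
      (n : ℂ) ^ (p' - 1) * (n : ℂ) ^ (q' - 1) * (n : ℂ) ^ (r' - 1) * (n : ℂ) ^ (s' - 1) := by
    simp only [← Complex.cpow_add _ _ hn]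
    congr 1
    linear_combination h
  rw [Pi.div_apply, div_mul_div_comm, div_mul_div_comm, div_mul_div_comm, div_mul_div_comm,
    div_mul_div_comm, div_mul_div_comm, div_div_div_eq]
  have e1 : (n ! : ℂ) * (n : ℂ) ^ (p - 1) * (n ! * (n : ℂ) ^ (q - 1)) * (n ! * (n : ℂ) ^ (r - 1)) *
      (n ! * (n : ℂ) ^ (s - 1)) = (n ! : ℂ) * (n : ℂ) ^ (p' - 1) * (n ! * (n : ℂ) ^ (q' - 1)) *
      (n ! * (n : ℂ) ^ (r' - 1)) * (n ! * (n : ℂ) ^ (s' - 1)) := by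
    linear_combination (n ! : ℂ) ^ 4 * e
  rw [e1, mul_comm, mul_div_mul_left]
  have := hp (p' - 1); have := hp (q' - 1); have := hp (r' - 1); have := hp (s' - 1)
  positivity

/-- The sum multiplied by the Gamma factors that make it invariant under `b → b + 1`. -/
def dougallInvariant (a b : ℝ) (z z' : ℂ) : ℂ :=
  (∑' x, weight a b z z' 1 x) * (Complex.Gamma (z + b + 1) * Complex.Gamma (z' + b + 1) *
    Complex.Gamma (z + z' + a + b + 2)) / Complex.Gamma (z + z' + b + 1)

theorem dougallInvariant_add_one (hb : -1 / 2 ≤ b) (ha : -1 / 2 ≤ a)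
    (hσ : -1 < (z + z' + b).re) (hz : z + b + 1 ≠ 0) (hz' : z' + b + 1 ≠ 0) :
    dougallInvariant a (b + 1) z z' = dougallInvariant a b z z' := by
  have h := tsum_weight_one_b_add_one (z := z) (z' := z') hb ha hσ
  have h1 : z + z' + b + 1 ≠ 0 := fun h0 => by
    have := congrArg Complex.re h0
    simp at this hσ; linarith
  have h2 : z + z' + a + b + 2 ≠ 0 := fun h0 => by
    have := congrArg Complex.re h0
    simp at this hσ; linarith
  have h3 : Complex.Gamma (z + z' + b + 1) ≠ 0 := by
    refine Complex.Gamma_ne_zero_of_re_pos ?_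
    simp at hσ ⊢; linarith
  have e1 : z + (b + 1 : ℝ) + 1 = z + b + 1 + 1 := by push_cast; ring
  have e2 : z' + (b + 1 : ℝ) + 1 = z' + b + 1 + 1 := by push_cast; ring
  have e3 : z + z' + a + (b + 1 : ℝ) + 2 = z + z' + a + b + 2 + 1 := by push_cast; ring
  have e4 : z + z' + (b + 1 : ℝ) + 1 = z + z' + b + 1 + 1 := by push_cast; ring
  unfold dougallInvariant
  rw [e1, e2, e3, e4, Complex.Gamma_add_one _ hz, Complex.Gamma_add_one _ hz',
    Complex.Gamma_add_one _ h2, Complex.Gamma_add_one _ h1,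
    div_eq_div_iff (mul_ne_zero h1 h3) h3]
  linear_combination Complex.Gamma (z + b + 1) * Complex.Gamma (z' + b + 1) *
    Complex.Gamma (z + z' + a + b + 2) * Complex.Gamma (z + z' + b + 1) * h

theorem dougallInvariant_add_nat (hb : -1 / 2 ≤ b) (ha : -1 / 2 ≤ a)
    (hσ : -1 < (z + z' + b).re) (hz : ∀ n : ℕ, z + b + 1 + n ≠ 0)
    (hz' : ∀ n : ℕ, z' + b + 1 + n ≠ 0) (n : ℕ) :
    dougallInvariant a (b + n) z z' = dougallInvariant a b z z' := by
  induction n with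
  | zero => simp
  | succ n ih =>
    have hn := Nat.cast_nonneg (α := ℝ) n
    rw [← ih, Nat.cast_succ, ← add_assoc]
    refine dougallInvariant_add_one (by linarith) ha ?_ ?_ ?_
    · simp at hσ ⊢; linarith
    · have := hz n; push_cast; convert this using 1; ring
    · have := hz' n; push_cast; convert this using 1; ring

theorem tendsto_dougallInvariant (hb : -1 / 2 ≤ b) (ha : -1 / 2 ≤ a) :
    Tendsto (fun n : ℕ => dougallInvariant a (b + n) z z') atTop
      (𝓝 (Complex.Gamma (a + 1) / (2 * (Complex.Gamma (z + 1) * Complex.Gamma (z' + 1))))) := by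
  have h1 : Tendsto (fun n : ℕ => a + (b + n) + 1) atTop atTop := by
    have := tendsto_atTop_add_const_left atTop (a + b + 1) (tendsto_natCast_atTop_atTop (R := ℝ))
    refine this.congr fun n => ?_
    ring
  have h2 := (tendsto_tsum_prod_dougallRatio a z z').comp h1
  have h3 := tendsto_Gamma_quotient (p := a + b + 2) (q := z + b + 1) (r := z' + b + 1)
    (s := z + z' + a + b + 2) (p' := b + 1) (q' := z + a + b + 2) (r' := z' + a + b + 2)
    (s' := z + z' + b + 1) (by ring)
  have h4 := (h3.mul h2).const_mul
    (Complex.Gamma (a + 1) / (2 * (Complex.Gamma (z + 1) * Complex.Gamma (z' + 1))))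
  rw [one_mul, mul_one] at h4
  refine h4.congr' ?_
  obtain ⟨k, hk⟩ := exists_nat_gt (‖z‖ + ‖z'‖ + 1)
  filter_upwards [eventually_ge_atTop (k + 1)] with n hn
  have hn : (k : ℝ) + 1 ≤ n := by exact_mod_cast hn
  have hre := (abs_le.1 (Complex.abs_re_le_norm z)).1
  have hre' := (abs_le.1 (Complex.abs_re_le_norm z')).1
  have hnz := norm_nonneg z
  have hnz' := norm_nonneg z'
  have ne : ∀ w : ℂ, -‖z‖ ≤ w.re ∨ -‖z'‖ ≤ w.re → ∀ j : ℕ, w + a + (b + n : ℝ) + 2 + j ≠ 0 :=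
    fun w hw j h => by
      have h0 := congrArg Complex.re h
      have hj := Nat.cast_nonneg (α := ℝ) j
      simp at h0
      rcases hw with hw | hw <;> linarith
  have h5 : ∀ x, weight a (b + n) z z' 1 x = weight a (b + n) z z' 1 0 *
      ∏ j ∈ Finset.range x, dougallRatio a z z' (a + (b + n) + 1) j :=
    weight_one_eq_prod (by linarith) ha (by linarith) (ne z (Or.inl hre)) (ne z' (Or.inr hre'))
  have e1 : 2 * eps a (b + n) = a + b + n + 1 := by unfold eps; ring
  have e2 : Real.Gamma (a + b + n + 1 + 1) = Complex.Gamma (n + (a + b + 2)) := by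
    rw [← Complex.Gamma_ofReal]; push_cast; ring_nf
  have e3 : Real.Gamma (b + n + 1) = Complex.Gamma (n + (b + 1)) := by
    rw [← Complex.Gamma_ofReal]; push_cast; ring_nf
  have e4 : Real.Gamma (a + 1) = Complex.Gamma (a + 1) := by
    rw [← Complex.Gamma_ofReal]; push_cast; ring_nf
  have h6 : weight a (b + n) z z' 1 0 =
      Complex.Gamma (n + (a + b + 2)) / 2 * Complex.Gamma (a + 1) /
      Complex.Gamma (n + (b + 1)) * ((Complex.Gamma (z + 1))⁻¹ * (Complex.Gamma (z' + 1))⁻¹ *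
        ((Complex.Gamma (n + (z + a + b + 2)))⁻¹ * (Complex.Gamma (n + (z' + a + b + 2)))⁻¹)) := by
    rw [weight_eq, plancherel, gammaFactor, leadingFactor_zero, e1]
    simp only [Nat.cast_zero, zero_add, add_zero, sub_zero, Real.Gamma_one, mul_one]
    push_cast
    rw [e2, e3, e4]
    ring_nf
  simp only [Function.comp_apply]
  rw [dougallInvariant, tsum_congr h5, tsum_mul_left, h6]
  push_cast
  have e5 : ∀ w : ℂ, w + (b + n) + 1 = n + (w + b + 1) := fun w => by ring
  have e6 : z + z' + a + (b + n) + 2 = n + (z + z' + a + b + 2) := by ring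
  rw [e5, e5, e5, e6]
  simp only [div_eq_mul_inv, mul_inv]
  ring

/-- Dougall's summation formula: the total mass of the weight at level one. -/
theorem hasSum_weight_one (hb : -1 / 2 ≤ b) (ha : -1 / 2 ≤ a)
    (hσ : -1 < (z + z' + b).re) (hz : ∀ n : ℕ, z + b + 1 + n ≠ 0)
    (hz' : ∀ n : ℕ, z' + b + 1 + n ≠ 0) :
    HasSum (weight a b z z' 1) (Complex.Gamma (a + 1) * Complex.Gamma (z + z' + b + 1) /
      (2 * (Complex.Gamma (z + 1) * Complex.Gamma (z' + 1) * Complex.Gamma (z + b + 1) *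
        Complex.Gamma (z' + b + 1) * Complex.Gamma (z + z' + a + b + 2)))) := by
  have h1 : dougallInvariant a b z z' =
      Complex.Gamma (a + 1) / (2 * (Complex.Gamma (z + 1) * Complex.Gamma (z' + 1))) :=
    tendsto_nhds_unique (tendsto_const_nhds.congr fun n =>
      (dougallInvariant_add_nat hb ha hσ hz hz' n).symm) (tendsto_dougallInvariant hb ha)
  have hne : ∀ w : ℂ, (∀ n : ℕ, w + n ≠ 0) → Complex.Gamma w ≠ 0 := fun w hw =>
    Complex.Gamma_ne_zero fun m h => hw m (by rw [h]; ring)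
  have g1 := hne _ hz
  have g2 := hne _ hz'
  have g3 : Complex.Gamma (z + z' + a + b + 2) ≠ 0 := by
    refine Complex.Gamma_ne_zero_of_re_pos ?_
    simp at hσ ⊢; linarith
  have g4 : Complex.Gamma (z + z' + b + 1) ≠ 0 := by
    refine Complex.Gamma_ne_zero_of_re_pos ?_
    simp at hσ ⊢; linarith
  convert (summable_weight_one hσ).hasSum using 1
  rw [dougallInvariant, div_eq_iff g4] at h1
  rw [← eq_div_iff (mul_ne_zero (mul_ne_zero g1 g2) g3)] at h1
  rw [h1]
  simp only [div_eq_mul_inv, mul_inv]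
  ring

end Dougall

end BCZMeasure

namespace BCZMeasure

open MeasureTheory

/-! ### Jacobi polynomials normalized at `1` -/

/-- The product `∏_{r < k} (y - r) (y + A + r)`. With `A = 2ε` it is a monic polynomial of degree
`k` in `(y + ε) ^ 2`. -/
def hypProd (A : ℝ) (k : ℕ) (y : ℝ) : ℝ := ∏ r ∈ Finset.range k, ((y - r) * (y + A + r))

theorem hypProd_zero (A y : ℝ) : hypProd A 0 y = 1 := by simp [hypProd]

theorem hypProd_succ (A : ℝ) (k : ℕ) (y : ℝ) :
    hypProd A (k + 1) y = hypProd A k y * ((y - k) * (y + A + k)) := by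
  simp [hypProd, Finset.prod_range_succ]

theorem hypProd_eq_zero (A : ℝ) {n k : ℕ} (h : n < k) : hypProd A k n = 0 :=
  Finset.prod_eq_zero (Finset.mem_range.2 h) (by simp)

theorem hypProd_add_one (A : ℝ) (k : ℕ) (y : ℝ) :
    (y + A) * hypProd A (k + 1) (y + 1) =
      (y + 1) * ((y + A + k) * (y + A + k + 1)) * hypProd A k y := by
  induction k with
  | zero => simp [hypProd]; ring
  | succ k ih =>
    rw [hypProd_succ, ← mul_assoc, ih, hypProd_succ A k y]
    push_cast
    ring

theorem hypProd_sub_one (A : ℝ) (k : ℕ) (y : ℝ) :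
    y * hypProd A (k + 1) (y - 1) =
      (y - k) * (y - k - 1) * (y + A - 1) * hypProd A k y := by
  induction k with
  | zero => simp [hypProd]; ring
  | succ k ih =>
    rw [hypProd_succ, ← mul_assoc, ih, hypProd_succ A k y]
    push_cast
    ring

/-- The constant `1 / (2 ^ k k! (a + 1)_k)`. -/
def hypConst (a : ℝ) (k : ℕ) : ℝ := ∏ r ∈ Finset.range k, (2 * ((r : ℝ) + 1) * (r + 1 + a))⁻¹

theorem hypConst_zero (a : ℝ) : hypConst a 0 = 1 := by simp [hypConst]

theorem hypConst_succ (a : ℝ) (k : ℕ) :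
    hypConst a (k + 1) = hypConst a k * (2 * ((k : ℝ) + 1) * (k + 1 + a))⁻¹ := by
  simp [hypConst, Finset.prod_range_succ]

theorem hypConst_pos {a : ℝ} (ha : -1 / 2 ≤ a) (k : ℕ) : 0 < hypConst a k :=
  Finset.prod_pos fun r _ => by
    have := Nat.cast_nonneg (α := ℝ) r
    have : 0 < (r : ℝ) + 1 + a := by linarith
    positivity

theorem hypConst_eq {a : ℝ} (ha : -1 / 2 ≤ a) (k : ℕ) :
    hypConst a k = 2 * ((k : ℝ) + 1) * (k + 1 + a) * hypConst a (k + 1) := by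
  have := Nat.cast_nonneg (α := ℝ) k
  have h1 : (k : ℝ) + 1 + a ≠ 0 := by linarith
  have h2 : (k : ℝ) + 1 ≠ 0 := by linarith
  rw [hypConst_succ]
  field_simp

/-- The coefficient of `(x - 1) ^ k` in the Jacobi polynomial of degree `n` normalized at `1`. -/
def hypCoeff (a b : ℝ) (n k : ℕ) : ℝ := hypConst a k * hypProd (a + b + 1) k n

theorem hypCoeff_eq_zero (a b : ℝ) {n k : ℕ} (h : n < k) : hypCoeff a b n k = 0 := by
  rw [hypCoeff, hypProd_eq_zero _ h, mul_zero]

/-- The Jacobi polynomial of degree `n` normalized by the value `1` at `1`, in the variable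
`u = x - 1`; this is the hypergeometric polynomial `₂F₁(-n, n + a + b + 1; a + 1; -u / 2)`. -/
def hypPoly (a b : ℝ) (n : ℕ) : Polynomial ℝ :=
  ∑ k ∈ Finset.range (n + 1), Polynomial.C (hypCoeff a b n k) * Polynomial.X ^ k

theorem coeff_hypPoly (a b : ℝ) (n k : ℕ) : (hypPoly a b n).coeff k = hypCoeff a b n k := by
  simp only [hypPoly, Polynomial.finsetSum_coeff, Polynomial.coeff_C_mul_X_pow]
  rw [Finset.sum_ite_eq]
  split_ifs with h
  · rfl
  · rw [hypCoeff_eq_zero]; simpa using h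

/-- The Jacobi polynomial of degree `n` normalized by the value `1` at `1`. -/
def jacobiOne (a b : ℝ) (n : ℕ) : Polynomial ℝ :=
  (hypPoly a b n).comp (Polynomial.X - Polynomial.C 1)

theorem jacobiOne_eval_one (a b : ℝ) (n : ℕ) : (jacobiOne a b n).eval 1 = 1 := by
  simp only [jacobiOne, Polynomial.eval_comp, Polynomial.eval_sub, Polynomial.eval_X,
    Polynomial.eval_C, sub_self]
  rw [← Polynomial.coeff_zero_eq_eval_zero, coeff_hypPoly]
  simp [hypCoeff, hypProd, hypConst]

theorem jacobiOne_eval (a b : ℝ) (n : ℕ) (x : ℝ) :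
    (jacobiOne a b n).eval x = ∑ k ∈ Finset.range (n + 1), hypCoeff a b n k * (x - 1) ^ k := by
  simp [jacobiOne, hypPoly, Polynomial.eval_finsetSum]

section

variable {a b : ℝ}

theorem hypCoeff_self_pos (hb : -1 / 2 ≤ b) (hab : b ≤ a) (n : ℕ) : 0 < hypCoeff a b n n := by
  refine mul_pos (hypConst_pos (hb.trans hab) n) (Finset.prod_pos fun r hr => ?_)
  have : (r : ℝ) + 1 ≤ n := by exact_mod_cast Finset.mem_range.1 hr
  have := Nat.cast_nonneg (α := ℝ) r
  apply mul_pos <;> linarith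

theorem natDegree_hypPoly (hb : -1 / 2 ≤ b) (hab : b ≤ a) (n : ℕ) :
    (hypPoly a b n).natDegree = n := by
  refine Polynomial.natDegree_eq_of_le_of_coeff_ne_zero ?_ ?_
  · rw [Polynomial.natDegree_le_iff_coeff_eq_zero]
    intro k hk
    rw [coeff_hypPoly, hypCoeff_eq_zero _ _ hk]
  · rw [coeff_hypPoly]; exact (hypCoeff_self_pos hb hab n).ne'

theorem natDegree_jacobiOne (hb : -1 / 2 ≤ b) (hab : b ≤ a) (n : ℕ) :
    (jacobiOne a b n).natDegree = n := by
  rw [jacobiOne, Polynomial.natDegree_comp, natDegree_hypPoly hb hab, Polynomial.natDegree_X_sub_C,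
    mul_one]

theorem leadingCoeff_jacobiOne (hb : -1 / 2 ≤ b) (hab : b ≤ a) (n : ℕ) :
    (jacobiOne a b n).leadingCoeff = hypCoeff a b n n := by
  rw [jacobiOne, Polynomial.leadingCoeff_comp (by
    rw [Polynomial.natDegree_X_sub_C]; exact one_ne_zero),
    Polynomial.leadingCoeff_X_sub_C, one_pow, mul_one, Polynomial.leadingCoeff,
    natDegree_hypPoly hb hab, coeff_hypPoly]

/-- The three-term recurrence on the level of coefficients. -/
theorem hypCoeff_recurrence (hb : -1 / 2 ≤ b) (hab : b ≤ a) (n k : ℕ) :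
    hypCoeff a b (n + 1) k / 2 = recA a b (n + 1) * (hypCoeff a b (n + 2) (k + 1) -
      hypCoeff a b (n + 1) (k + 1)) -
      recC a b (n + 1) * (hypCoeff a b (n + 1) (k + 1) - hypCoeff a b n (k + 1)) := by
  have hn := Nat.cast_nonneg (α := ℝ) n
  have h1 := hypProd_add_one (a + b + 1) k ((n : ℝ) + 1)
  have h2 := hypProd_sub_one (a + b + 1) k ((n : ℝ) + 1)
  have h3 := hypProd_succ (a + b + 1) k ((n : ℝ) + 1)
  have h4 := hypConst_eq (hb.trans hab) k
  rw [add_sub_cancel_right] at h2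
  have e : (n : ℝ) + 1 + 1 = (n + 2 : ℕ) := by push_cast; ring
  rw [e] at h1
  have e' : (n : ℝ) + 1 = (n + 1 : ℕ) := by push_cast; ring
  rw [e'] at h1 h2 h3
  simp only [hypCoeff, recA, recC, Nat.succ_ne_zero, if_false]
  rw [h4, h3]
  have d1 : ((n + 1 : ℕ) : ℝ) + (a + b + 1) ≠ 0 := by push_cast; linarith
  have d2 : ((n + 1 : ℕ) : ℝ) ≠ 0 := by push_cast; linarith
  have d3 : 2 * ((n + 1 : ℕ) : ℝ) + a + b + 1 ≠ 0 := by push_cast; linarith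
  have d4 : 2 * ((n + 1 : ℕ) : ℝ) + a + b + 2 ≠ 0 := by push_cast; linarith
  have d5 : 2 * ((n + 1 : ℕ) : ℝ) + a + b ≠ 0 := by push_cast; linarith
  rw [mul_comm, ← eq_div_iff d1] at h1
  rw [mul_comm, ← eq_div_iff d2] at h2
  have e2 : ((n + 2 : ℕ) : ℝ) = (n + 1 : ℕ) + 1 := by push_cast; ring
  rw [h1, h2, e2]
  have d1' : ((n + 1 : ℕ) : ℝ) + a + b + 1 ≠ 0 := by push_cast; linarith
  generalize hypProd (a + b + 1) k (n + 1 : ℕ) = E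
  generalize hypConst a (k + 1) = F
  generalize ((n + 1 : ℕ) : ℝ) = y at *
  have key1 : (y + a + b + 1) * (y + a + 1) / ((2 * y + a + b + 1) * (2 * y + a + b + 2)) *
      (F * ((y + 1) * ((y + (a + b + 1) + k) * (y + (a + b + 1) + k + 1)) * E / (y + (a + b + 1))) -
        F * (E * ((y - k) * (y + (a + b + 1) + k)))) =
      F * E * (k + 1) * (y + (a + b + 1) + k) * (y + a + 1) / (2 * y + a + b + 1) := by
    have : (y + 1) * ((y + (a + b + 1) + k) * (y + (a + b + 1) + k + 1)) * E / (y + (a + b + 1)) -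
        E * ((y - k) * (y + (a + b + 1) + k)) =
        E * (k + 1) * (y + (a + b + 1) + k) * (2 * y + a + b + 2) / (y + a + b + 1) := by
      rw [← add_assoc, ← add_assoc, eq_div_iff d1', sub_mul, div_mul_cancel₀ _ d1']
      ring
    rw [← mul_sub, this]
    generalize 2 * y + a + b + 2 = d at *
    generalize 2 * y + a + b + 1 = d' at *
    generalize y + a + b + 1 = d'' at *
    field_simp
  have key2 : y * (y + b) / ((2 * y + a + b) * (2 * y + a + b + 1)) *
      (F * (E * ((y - k) * (y + (a + b + 1) + k))) -
        F * ((y - k) * (y - k - 1) * (y + (a + b + 1) - 1) * E / y)) =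
      F * E * (k + 1) * (y - k) * (y + b) / (2 * y + a + b + 1) := by
    have : E * ((y - k) * (y + (a + b + 1) + k)) -
        (y - k) * (y - k - 1) * (y + (a + b + 1) - 1) * E / y =
        E * (k + 1) * (y - k) * (2 * y + a + b) / y := by
      rw [eq_div_iff d2, sub_mul, div_mul_cancel₀ _ d2]
      ring
    rw [← mul_sub, this]
    generalize 2 * y + a + b + 1 = d at *
    generalize 2 * y + a + b = d' at *
    field_simp
  rw [key1, key2, ← sub_div, eq_div_iff d3]
  ring

theorem hypPoly_recurrence (hb : -1 / 2 ≤ b) (hab : b ≤ a) (n : ℕ) :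
    Polynomial.C (1 / 2) * (Polynomial.X * hypPoly a b (n + 1)) =
      Polynomial.C (recA a b (n + 1)) * (hypPoly a b (n + 2) - hypPoly a b (n + 1)) -
        Polynomial.C (recC a b (n + 1)) * (hypPoly a b (n + 1) - hypPoly a b n) := by
  ext k
  cases k with
  | zero => simp [coeff_hypPoly, hypCoeff, hypProd_zero]
  | succ k =>
    simp only [Polynomial.coeff_C_mul, Polynomial.coeff_X_mul, Polynomial.coeff_sub, coeff_hypPoly]
    rw [← hypCoeff_recurrence hb hab]
    ring

theorem hypPoly_recurrence_zero (hb : -1 / 2 ≤ b) (hab : b ≤ a) :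
    Polynomial.C (1 / 2) * (Polynomial.X * hypPoly a b 0) =
      Polynomial.C (recA a b 0) * (hypPoly a b 1 - hypPoly a b 0) := by
  have h1 : a + 1 ≠ 0 := by linarith
  have h2 : a + b + 2 ≠ 0 := by linarith
  ext k
  cases k with
  | zero => simp [coeff_hypPoly, hypCoeff, hypProd_zero]
  | succ k =>
    simp only [Polynomial.coeff_C_mul, Polynomial.coeff_X_mul, Polynomial.coeff_sub, coeff_hypPoly]
    cases k with
    | zero =>
      simp [hypCoeff, hypProd, hypConst, recA]
      have e : 1 + (a + b + 1) = a + b + 2 := by ring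
      have e' : 1 + a = a + 1 := by ring
      rw [e, e']
      field_simp
    | succ k =>
      rw [hypCoeff_eq_zero a b (n := 1) (by lia), hypCoeff_eq_zero a b (n := 0) (by lia),
        hypCoeff_eq_zero a b (n := 0) (by lia)]
      ring

/-- The three-term recurrence in the form of a telescoping identity: `D n = U(n) A_n` satisfies
`(x - 1) / 2 * U(n) p_n = D n (p_{n+1} - p_n) - D (n-1) (p_n - p_{n-1})`. Summation over `n`. -/
theorem sum_plancherel_mul_jacobiOne (hb : -1 / 2 ≤ b) (hab : b ≤ a) (x : ℝ) (k : ℕ) :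
    (x - 1) / 2 * ∑ m ∈ Finset.range (k + 1), plancherel a b m * (jacobiOne a b m).eval x =
      plancherel a b k * recA a b k *
        ((jacobiOne a b (k + 1)).eval x - (jacobiOne a b k).eval x) := by
  induction k with
  | zero =>
    have h := congrArg (Polynomial.eval (x - 1)) (hypPoly_recurrence_zero hb hab)
    simp only [Polynomial.eval_mul, Polynomial.eval_C, Polynomial.eval_X, Polynomial.eval_sub] at h
    simp only [zero_add, Finset.sum_range_one, jacobiOne, Polynomial.eval_comp,
      Polynomial.eval_sub, Polynomial.eval_X, Polynomial.eval_C]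
    linear_combination plancherel a b 0 * h
  | succ k ih =>
    have h := congrArg (Polynomial.eval (x - 1)) (hypPoly_recurrence hb hab k)
    have h2 := plancherel_succ_mul_recC hb hab k
    simp only [Polynomial.eval_mul, Polynomial.eval_C, Polynomial.eval_X, Polynomial.eval_sub] at h
    rw [Finset.sum_range_succ, mul_add, ih, ← h2]
    simp only [jacobiOne, Polynomial.eval_comp,
      Polynomial.eval_sub, Polynomial.eval_X, Polynomial.eval_C]
    linear_combination plancherel a b (k + 1) * h

/-! ### Orthogonality -/

/-- The Jacobi operator `(1 - x²) p'' + (b - a - (a + b + 2) x) p'`. -/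
def jacobiOp (a b : ℝ) (p : Polynomial ℝ) : Polynomial ℝ :=
  (1 - Polynomial.X ^ 2) * Polynomial.derivative (Polynomial.derivative p) +
    (Polynomial.C (b - a) - Polynomial.C (a + b + 2) * Polynomial.X) * Polynomial.derivative p

theorem hypPoly_eigen (ha : -1 / 2 ≤ a) (n : ℕ) :
    -(Polynomial.X *
        (Polynomial.X * Polynomial.derivative (Polynomial.derivative (hypPoly a b n)))) -
      Polynomial.C 2 *
        (Polynomial.X * Polynomial.derivative (Polynomial.derivative (hypPoly a b n))) -
      Polynomial.C (2 * (a + 1)) * Polynomial.derivative (hypPoly a b n) -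
      Polynomial.C (a + b + 2) * (Polynomial.X * Polynomial.derivative (hypPoly a b n)) =
      Polynomial.C (-(n * (n + a + b + 1))) * hypPoly a b n := by
  have key : ∀ k : ℕ, 2 * ((k : ℝ) + 1) * (k + 1 + a) * hypCoeff a b n (k + 1) =
      (n - k) * (n + (a + b + 1) + k) * hypCoeff a b n k := fun k => by
    simp only [hypCoeff]
    rw [hypProd_succ, hypConst_eq ha k]
    ring
  ext k
  rcases k with _ | _ | k
  · have := key 0
    simp only [Polynomial.coeff_sub, Polynomial.coeff_neg, Polynomial.coeff_C_mul,
      Polynomial.coeff_X_mul_zero, Polynomial.coeff_derivative, coeff_hypPoly]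
    push_cast at *
    linear_combination -this
  · have := key 1
    simp only [Polynomial.coeff_sub, Polynomial.coeff_neg, Polynomial.coeff_C_mul,
      Polynomial.coeff_X_mul_zero, Polynomial.coeff_X_mul, Polynomial.coeff_derivative,
      coeff_hypPoly]
    push_cast at *
    simp only [zero_add] at *
    linear_combination -this
  · have := key (k + 2)
    simp only [Polynomial.coeff_sub, Polynomial.coeff_neg, Polynomial.coeff_C_mul,
      Polynomial.coeff_X_mul, Polynomial.coeff_derivative, coeff_hypPoly]
    push_cast at *
    linear_combination -this

theorem jacobiOp_jacobiOne (ha : -1 / 2 ≤ a) (n : ℕ) :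
    jacobiOp a b (jacobiOne a b n) = Polynomial.C (-(n * (n + a + b + 1))) * jacobiOne a b n := by
  have h := congrArg (fun p => Polynomial.comp p (Polynomial.X - Polynomial.C 1))
    (hypPoly_eigen (b := b) ha n)
  simp only [Polynomial.sub_comp, Polynomial.neg_comp, Polynomial.mul_comp, Polynomial.X_comp,
    Polynomial.C_comp] at h
  have hd : ∀ p : Polynomial ℝ, Polynomial.derivative (p.comp (Polynomial.X - Polynomial.C 1)) =
      (Polynomial.derivative p).comp (Polynomial.X - Polynomial.C 1) := fun p => by
    rw [Polynomial.derivative_comp]; simp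
  rw [jacobiOp, jacobiOne, hd, hd, ← h]
  simp only [map_sub, map_add, map_mul, Polynomial.C_1, Polynomial.C_ofNat]
  ring

theorem intervalIntegrable_jacobiWeight (hb : -1 / 2 ≤ b) (ha : -1 / 2 ≤ a) (p : Polynomial ℝ) :
    IntervalIntegrable (fun x => p.eval x * ((1 - x) ^ a * (1 + x) ^ b)) volume (-1) 1 := by
  refine IntervalIntegrable.continuousOn_mul ?_ p.continuous.continuousOn
  refine IntervalIntegrable.trans (b := 0) ?_ ?_
  · have h : IntervalIntegrable (fun x : ℝ => x ^ b) volume 0 1 :=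
      intervalIntegral.intervalIntegrable_rpow' (by linarith)
    have h2 := h.comp_add_left 1
    simp only [zero_sub, sub_self] at h2
    refine h2.continuousOn_mul ?_
    refine ContinuousOn.rpow_const (by fun_prop) fun x hx => Or.inl ?_
    rw [Set.uIcc_of_le (by norm_num)] at hx
    linarith [hx.2]
  · have h : IntervalIntegrable (fun x : ℝ => x ^ a) volume 1 0 :=
      intervalIntegral.intervalIntegrable_rpow' (by linarith)
    have h2 := h.comp_sub_left 1
    simp only [sub_zero, sub_self] at h2
    refine h2.mul_continuousOn ?_
    refine ContinuousOn.rpow_const (by fun_prop) fun x hx => Or.inl ?_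
    rw [Set.uIcc_of_le (by norm_num)] at hx
    linarith [hx.1]

/-- The linear functional `p ↦ ∫ p(x) (1 - x)^a (1 + x)^b dx` on `[-1, 1]`. -/
def jacobiInt (a b : ℝ) (p : Polynomial ℝ) : ℝ :=
  ∫ x in (-1 : ℝ)..1, p.eval x * ((1 - x) ^ a * (1 + x) ^ b)

theorem jacobiInner_eq (a b : ℝ) (p q : Polynomial ℝ) :
    jacobiInner a b p q = jacobiInt a b (p * q) := by
  simp [jacobiInner, jacobiInt]

theorem jacobiInt_add (hb : -1 / 2 ≤ b) (ha : -1 / 2 ≤ a) (p q : Polynomial ℝ) :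
    jacobiInt a b (p + q) = jacobiInt a b p + jacobiInt a b q := by
  simp only [jacobiInt, Polynomial.eval_add, add_mul]
  exact intervalIntegral.integral_add (intervalIntegrable_jacobiWeight hb ha p)
    (intervalIntegrable_jacobiWeight hb ha q)

theorem jacobiInt_C_mul (a b c : ℝ) (p : Polynomial ℝ) :
    jacobiInt a b (Polynomial.C c * p) = c * jacobiInt a b p := by
  simp only [jacobiInt, Polynomial.eval_mul, Polynomial.eval_C, mul_assoc]
  exact intervalIntegral.integral_const_mul _ _

theorem jacobiInt_sub (hb : -1 / 2 ≤ b) (ha : -1 / 2 ≤ a) (p q : Polynomial ℝ) :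
    jacobiInt a b (p - q) = jacobiInt a b p - jacobiInt a b q := by
  simp only [jacobiInt, Polynomial.eval_sub, sub_mul]
  exact intervalIntegral.integral_sub (intervalIntegrable_jacobiWeight hb ha p)
    (intervalIntegrable_jacobiWeight hb ha q)

/-- Integration by parts against the Jacobi weight; the boundary terms vanish. -/
theorem jacobiInt_derivative (hb : -1 / 2 ≤ b) (ha : -1 / 2 ≤ a) (p : Polynomial ℝ) :
    jacobiInt a b ((1 - Polynomial.X ^ 2) * Polynomial.derivative p +
      (Polynomial.C (b - a) - Polynomial.C (a + b + 2) * Polynomial.X) * p) = 0 := by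
  have h := intervalIntegral.integral_eq_sub_of_hasDerivAt_of_le (a := -1) (b := 1)
    (f := fun x => p.eval x * ((1 - x) ^ (a + 1) * (1 + x) ^ (b + 1)))
    (f' := fun x => ((1 - Polynomial.X ^ 2) * Polynomial.derivative p +
      (Polynomial.C (b - a) - Polynomial.C (a + b + 2) * Polynomial.X) * p).eval x *
        ((1 - x) ^ a * (1 + x) ^ b)) (by norm_num) ?_ ?_
    (intervalIntegrable_jacobiWeight hb ha _)
  · rw [jacobiInt, h]
    have h1 : a + 1 ≠ 0 := by linarith
    have h2 : b + 1 ≠ 0 := by linarith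
    simp [Real.zero_rpow h1, Real.zero_rpow h2]
  · refine p.continuous.continuousOn.mul (ContinuousOn.mul ?_ ?_)
    · exact ContinuousOn.rpow_const (by fun_prop) fun x _ => Or.inr (by linarith)
    · exact ContinuousOn.rpow_const (by fun_prop) fun x _ => Or.inr (by linarith)
  · intro x hx
    have hx1 : 0 < 1 - x := by linarith [hx.2]
    have hx2 : 0 < 1 + x := by linarith [hx.1]
    have d1 : HasDerivAt (fun x : ℝ => (1 - x) ^ (a + 1))
        (-1 * (a + 1) * (1 - x) ^ (a + 1 - 1)) x :=
      ((hasDerivAt_id x).const_sub 1).rpow_const (Or.inl hx1.ne')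
    have d2 : HasDerivAt (fun x : ℝ => (1 + x) ^ (b + 1)) (1 * (b + 1) * (1 + x) ^ (b + 1 - 1)) x :=
      ((hasDerivAt_id x).const_add 1).rpow_const (Or.inl hx2.ne')
    refine ((p.hasDerivAt x).mul (d1.mul d2)).congr_deriv ?_
    simp only [add_sub_cancel_right, Polynomial.eval_add, Polynomial.eval_mul, Polynomial.eval_sub,
      Polynomial.eval_one, Polynomial.eval_pow, Polynomial.eval_X, Polynomial.eval_C, Pi.mul_apply]
    rw [Real.rpow_add hx1, Real.rpow_add hx2, Real.rpow_one, Real.rpow_one]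
    ring

theorem jacobiInt_jacobiOp_mul (hb : -1 / 2 ≤ b) (ha : -1 / 2 ≤ a) (p q : Polynomial ℝ) :
    jacobiInt a b (jacobiOp a b p * q) = jacobiInt a b (p * jacobiOp a b q) := by
  have h1 := jacobiInt_derivative hb ha (Polynomial.derivative p * q)
  have h2 := jacobiInt_derivative hb ha (p * Polynomial.derivative q)
  rw [← sub_eq_zero, ← jacobiInt_sub hb ha]
  have h3 := jacobiInt_sub hb ha
    ((1 - Polynomial.X ^ 2) * Polynomial.derivative (Polynomial.derivative p * q) +
      (Polynomial.C (b - a) - Polynomial.C (a + b + 2) * Polynomial.X) *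
        (Polynomial.derivative p * q))
    ((1 - Polynomial.X ^ 2) * Polynomial.derivative (p * Polynomial.derivative q) +
      (Polynomial.C (b - a) - Polynomial.C (a + b + 2) * Polynomial.X) *
        (p * Polynomial.derivative q))
  rw [h1, h2, sub_zero] at h3
  rw [← h3]
  congr 1
  simp only [jacobiOp, Polynomial.derivative_mul]
  ring

theorem jacobiInt_jacobiOne_mul (hb : -1 / 2 ≤ b) (hab : b ≤ a) {m n : ℕ} (h : m < n) :
    jacobiInt a b (jacobiOne a b m * jacobiOne a b n) = 0 := by
  have ha := hb.trans hab
  have h1 := jacobiInt_jacobiOp_mul hb ha (jacobiOne a b m) (jacobiOne a b n)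
  rw [jacobiOp_jacobiOne ha, jacobiOp_jacobiOne ha, mul_assoc,
    mul_left_comm (jacobiOne a b m) (Polynomial.C _), jacobiInt_C_mul, jacobiInt_C_mul] at h1
  have hm := Nat.cast_nonneg (α := ℝ) m
  have hmn : (m : ℝ) + 1 ≤ n := by exact_mod_cast h
  have h2 : (m : ℝ) * (m + a + b + 1) < n * (n + a + b + 1) := by
    apply mul_lt_mul'' <;> nlinarith
  by_contra h3
  exact (neg_lt_neg h2).ne' (mul_right_cancel₀ h3 h1)

theorem jacobiInt_mul_self_pos (hb : -1 / 2 ≤ b) (ha : -1 / 2 ≤ a) {p : Polynomial ℝ} (hp : p ≠ 0) :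
    0 < jacobiInt a b (p * p) := by
  rw [jacobiInt, intervalIntegral.integral_pos_iff_support_of_nonneg_ae' ?_
    (intervalIntegrable_jacobiWeight hb ha _)]
  · refine ⟨by norm_num, ?_⟩
    have hsub : Set.Ioo (-1 : ℝ) 1 \ (p.roots.toFinset : Set ℝ) ⊆ Function.support (fun x =>
        (p * p).eval x * ((1 - x) ^ a * (1 + x) ^ b)) ∩ Set.Ioc (-1) 1 := by
      rintro x ⟨hx, hxr⟩
      refine ⟨?_, hx.1, hx.2.le⟩
      have h1 : p.eval x ≠ 0 := by simpa [hp] using hxr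
      have h2 := Real.rpow_pos_of_pos (x := 1 - x) (by linarith [hx.2]) a
      have h3 := Real.rpow_pos_of_pos (x := 1 + x) (by linarith [hx.1]) b
      simp only [Function.mem_support, Polynomial.eval_mul]
      positivity
    refine lt_of_lt_of_le ?_ (measure_mono hsub)
    rw [measure_sdiff_null (Finset.measure_zero _ _)]
    simp
  · rw [Set.uIoc_of_le (by norm_num)]
    refine (ae_restrict_iff' measurableSet_Ioc).2 (ae_of_all _ fun x hx => ?_)
    have h2 := Real.rpow_nonneg (x := 1 - x) (by linarith [hx.2]) a
    have h3 := Real.rpow_nonneg (x := 1 + x) (by linarith [hx.1]) b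
    simp only [Polynomial.eval_mul, Pi.zero_apply]
    exact mul_nonneg (mul_self_nonneg _) (mul_nonneg h2 h3)

/-- A polynomial of degree less than `n` orthogonal to all `p_m`, `m < n`, has zero pairing with
every polynomial of degree less than `n`. -/
theorem jacobiInt_mul_eq_zero (hb : -1 / 2 ≤ b) (hab : b ≤ a) {R : Polynomial ℝ} (n : ℕ)
    (hR : ∀ m < n, jacobiInt a b (jacobiOne a b m * R) = 0) (S : Polynomial ℝ) (hS : S.degree < n) :
    jacobiInt a b (S * R) = 0 := by
  induction n generalizing S with
  | zero =>
    have : S = 0 := by simpa using hS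
    simp [this, jacobiInt]
  | succ n ih =>
    have hc := (hypCoeff_self_pos hb hab n).ne'
    set T := S - Polynomial.C (S.coeff n / hypCoeff a b n n) * jacobiOne a b n with hT
    have hdeg : T.degree < n := by
      rw [Polynomial.degree_lt_iff_coeff_zero]
      intro k hk
      rcases hk.eq_or_lt with rfl | hk
      · have := leadingCoeff_jacobiOne hb hab n
        rw [Polynomial.leadingCoeff, natDegree_jacobiOne hb hab] at this
        rw [hT, Polynomial.coeff_sub, Polynomial.coeff_C_mul, this, div_mul_cancel₀ _ hc, sub_self]
      · rw [hT, Polynomial.coeff_sub, Polynomial.coeff_C_mul,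
          Polynomial.coeff_eq_zero_of_natDegree_lt (p := jacobiOne a b n)
            (by rwa [natDegree_jacobiOne hb hab]),
            (Polynomial.degree_lt_iff_coeff_zero _ _).1 hS k hk]
        simp
    have h1 := ih (fun m hm => hR m (by lia)) T hdeg
    have : S = T + Polynomial.C (S.coeff n / hypCoeff a b n n) * jacobiOne a b n := by
      rw [hT]; ring
    rw [this, add_mul, jacobiInt_add hb (hb.trans hab), h1, mul_assoc, jacobiInt_C_mul,
      hR n (by lia)]
    simp

theorem jacobi_eq (hb : -1 / 2 ≤ b) (hab : b ≤ a) (n : ℕ) :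
    jacobi a b n = Polynomial.C (hypCoeff a b n n)⁻¹ * jacobiOne a b n := by
  have ha := hb.trans hab
  induction n using Nat.strong_induction_on with
  | _ n ih =>
    have hcp := fun m => (hypCoeff_self_pos (a := a) (b := b) hb hab m)
    have hdegI : ∀ m, (jacobiOne a b m).degree = m := fun m => by
      rw [Polynomial.degree_eq_natDegree, natDegree_jacobiOne hb hab]
      intro h0
      have := leadingCoeff_jacobiOne (a := a) (b := b) hb hab m
      rw [h0, Polynomial.leadingCoeff_zero] at this
      exact (hcp m).ne this
    have hlc : (jacobiOne a b n).coeff n = hypCoeff a b n n := by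
      have := leadingCoeff_jacobiOne (a := a) (b := b) hb hab n
      rwa [Polynomial.leadingCoeff, natDegree_jacobiOne hb hab] at this
    have hexp : jacobi a b n = Polynomial.X ^ n - ∑ j : Fin n,
        Polynomial.C (jacobiInt a b (jacobiOne a b j * Polynomial.X ^ n) /
          jacobiInt a b (jacobiOne a b j * jacobiOne a b j)) * jacobiOne a b j := by
      rw [jacobi]
      congr 1
      refine Finset.sum_congr rfl fun j _ => ?_
      have hj := (hcp j).ne'
      rw [ih j j.2, jacobiInner_eq, jacobiInner_eq, mul_left_comm (Polynomial.X ^ n),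
        jacobiInt_C_mul,
        ← mul_assoc, ← Polynomial.C_mul, mul_mul_mul_comm, ← Polynomial.C_mul, jacobiInt_C_mul,
        mul_comm (Polynomial.X ^ n)]
      congr 2
      field_simp
    set R := jacobi a b n - Polynomial.C (hypCoeff a b n n)⁻¹ * jacobiOne a b n with hRdef
    have horth : ∀ m < n, jacobiInt a b (jacobiOne a b m * R) = 0 := fun m hm => by
      have hpos := jacobiInt_mul_self_pos (p := jacobiOne a b m) hb ha (fun h0 => by
        have := hdegI m; rw [h0] at this; simp at this)
      have hs : jacobiInt a b (jacobiOne a b m * ∑ j : Fin n,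
          Polynomial.C (jacobiInt a b (jacobiOne a b j * Polynomial.X ^ n) /
          jacobiInt a b (jacobiOne a b j * jacobiOne a b j)) * jacobiOne a b j) =
          jacobiInt a b (jacobiOne a b m * Polynomial.X ^ n) := by
        have hadd : ∀ (s : Finset (Fin n)) (f : Fin n → Polynomial ℝ),
            jacobiInt a b (∑ j ∈ s, f j) = ∑ j ∈ s, jacobiInt a b (f j) := fun s f => by
          classical
          induction s using Finset.induction_on with
          | empty => simp [jacobiInt]
          | insert i s hi ih =>
            rw [Finset.sum_insert hi, jacobiInt_add hb ha, ih, Finset.sum_insert hi]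
        rw [Finset.mul_sum, hadd, Finset.sum_eq_single (⟨m, hm⟩ : Fin n)]
        · rw [mul_left_comm, jacobiInt_C_mul, div_mul_cancel₀ _ hpos.ne']
        · intro j _ hj
          rw [mul_left_comm, jacobiInt_C_mul]
          rcases lt_trichotomy (j : ℕ) m with h | h | h
          · rw [mul_comm (jacobiOne a b m), jacobiInt_jacobiOne_mul hb hab h, mul_zero]
          · exact absurd (Fin.ext h) hj
          · rw [jacobiInt_jacobiOne_mul hb hab h, mul_zero]
        · simp
      rw [hRdef, hexp, mul_sub, mul_sub, jacobiInt_sub hb ha, jacobiInt_sub hb ha, hs,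
        mul_left_comm,
        jacobiInt_C_mul, jacobiInt_jacobiOne_mul hb hab hm]
      ring
    have hRdeg : R.degree < n := by
      have h1 : R = (Polynomial.X ^ n - Polynomial.C (hypCoeff a b n n)⁻¹ * jacobiOne a b n) -
          ∑ j : Fin n, Polynomial.C (jacobiInt a b (jacobiOne a b j * Polynomial.X ^ n) /
          jacobiInt a b (jacobiOne a b j * jacobiOne a b j)) * jacobiOne a b j := by
        rw [hRdef, hexp]; ring
      rw [h1, Polynomial.degree_lt_iff_coeff_zero]
      intro k hk
      rw [Polynomial.coeff_sub, Polynomial.finsetSum_coeff, Finset.sum_eq_zero, sub_zero]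
      · rcases hk.eq_or_lt with rfl | hk
        · rw [Polynomial.coeff_sub, Polynomial.coeff_X_pow_self, Polynomial.coeff_C_mul, hlc,
            inv_mul_cancel₀ (hcp n).ne', sub_self]
        · rw [Polynomial.coeff_sub, Polynomial.coeff_X_pow, if_neg hk.ne', Polynomial.coeff_C_mul,
            Polynomial.coeff_eq_zero_of_natDegree_lt (by rwa [natDegree_jacobiOne hb hab])]
          simp
      · intro j _
        rw [Polynomial.coeff_C_mul, Polynomial.coeff_eq_zero_of_natDegree_lt, mul_zero]
        rw [natDegree_jacobiOne hb hab]
        lia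
    have h0 := jacobiInt_mul_eq_zero hb hab n horth R hRdeg
    by_contra hne
    exact (jacobiInt_mul_self_pos hb ha (sub_ne_zero.2 hne)).ne' h0

end

end BCZMeasure

namespace BCZMeasure

/-! ### Signatures as strictly decreasing tuples -/

theorem shifted_strictAnti {N : ℕ} (lam : GT N) : StrictAnti (shifted lam) := fun _ _ hij =>
  add_lt_add_of_le_of_lt (lam.2 hij.le) (Fin.rev_lt_rev.2 hij)

theorem shifted_injective {N : ℕ} (lam : GT N) : Function.Injective (shifted lam) :=
  (shifted_strictAnti lam).injective

theorem shifted_ne {N : ℕ} {lam mu : GT N} (h : lam ≠ mu) : shifted lam ≠ shifted mu := fun h' =>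
  h (Subtype.ext (funext fun i => Nat.add_right_cancel (congrFun h' i)))

theorem exists_shifted_eq {N : ℕ} {g : Fin N → ℕ} (hg : StrictAnti g) :
    ∃ lam : GT N, shifted lam = g := by
  have key : ∀ i j : Fin N, i ≤ j → g j + (j - i : ℕ) ≤ g i := fun i j hij => by
    have h1 : ((Finset.Ioc i j).image g).card ≤ (Finset.Ico (g j) (g i)).card := by
      refine Finset.card_le_card fun x hx => ?_
      obtain ⟨k, hk, rfl⟩ := Finset.mem_image.1 hx
      rw [Finset.mem_Ioc] at hk
      exact Finset.mem_Ico.2 ⟨hg.antitone hk.2, hg hk.1⟩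
    rw [Finset.card_image_of_injective _ hg.injective, Fin.card_Ioc, Nat.card_Ico] at h1
    have := hg.antitone hij
    lia
  have hrev : ∀ i : Fin N, (i.rev : ℕ) ≤ g i := fun i => by
    have h0 : 0 < N := i.pos
    have := key i ⟨N - 1, by lia⟩ (Fin.le_def.2 (by have := i.2; simp; lia))
    rw [Fin.val_rev]
    simp at this
    lia
  refine ⟨⟨fun i => g i - i.rev, fun i j hij => ?_⟩, funext fun i => ?_⟩
  · have h1 := key i j hij
    have h2 := hrev j
    have h3 : (i : ℕ) ≤ j := hij
    have h4 := j.2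
    simp only [Fin.val_rev] at h2 ⊢
    lia
  · have := hrev i
    simp only [shifted]
    lia

theorem shifted_comp_perm_injective (N : ℕ) :
    Function.Injective fun p : GT N × Equiv.Perm (Fin N) => shifted p.1 ∘ p.2 := by
  rintro ⟨lam, σ⟩ ⟨mu, τ⟩ h
  have h1 : shifted lam = shifted mu ∘ (τ * σ⁻¹) := by
    funext i
    have := congrFun h (σ⁻¹ i)
    simpa using this
  have h2 : StrictMono (τ * σ⁻¹) := fun i j hij => by
    have h3 := shifted_strictAnti lam hij
    rw [h1] at h3
    exact (shifted_strictAnti mu).lt_iff_gt.1 h3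
  have h3 : ⇑(τ * σ⁻¹) = id := (h2.range_inj strictMono_id).1 (by
    rw [(τ * σ⁻¹).surjective.range_eq, Set.range_id])
  have h4 : τ * σ⁻¹ = 1 := Equiv.ext fun i => congrFun h3 i
  have h5 : τ = σ := by simpa [mul_inv_eq_one] using h4
  subst h5
  have h6 : lam = mu := by
    by_contra hne
    exact shifted_ne hne (by rw [h1, h3]; rfl)
  rw [h6]

theorem range_shifted_comp_perm {N : ℕ} {f : Fin N → ℕ} (hf : Function.Injective f) :
    f ∈ Set.range fun p : GT N × Equiv.Perm (Fin N) => shifted p.1 ∘ p.2 := by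
  have h1 : StrictMono (f ∘ Tuple.sort f) :=
    (Tuple.monotone_sort f).strictMono_of_injective (hf.comp (Tuple.sort f).injective)
  have h2 : StrictAnti ((f ∘ Tuple.sort f) ∘ Fin.rev) := h1.comp_strictAnti Fin.rev_strictAnti
  obtain ⟨lam, hlam⟩ := exists_shifted_eq h2
  refine ⟨(lam, (Fin.revPerm.trans (Tuple.sort f)).symm), funext fun i => ?_⟩
  simp [hlam]

/-! ### The Andréief identity -/

section Andreief

variable {𝕜 : Type*} [NormedField 𝕜] [CompleteSpace 𝕜]

theorem hasSum_prod_pi {n : ℕ} (f : Fin n → ℕ → 𝕜) (hf : ∀ j, Summable fun l => ‖f j l‖) :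
    (Summable fun l : Fin n → ℕ => ‖∏ j, f j (l j)‖) ∧
      HasSum (fun l : Fin n → ℕ => ∏ j, f j (l j)) (∏ j, ∑' l, f j l) := by
  induction n with
  | zero =>
    refine ⟨(hasSum_unique _).summable, ?_⟩
    convert hasSum_unique (fun l : Fin 0 → ℕ => ∏ j, f j (l j)) using 1
    simp
  | succ n ih =>
    obtain ⟨h1, h2⟩ := ih (fun j => f j.succ) (fun j => hf j.succ)
    have e : ∀ p : ℕ × (Fin n → ℕ), ∏ j, f j (Fin.consEquiv (fun _ => ℕ) p j) =
        f 0 p.1 * ∏ j, f (Fin.succ j) (p.2 j) := fun p => by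
      rw [Fin.prod_univ_succ]
      simp
    have h3 := (hf 0).mul_norm h1
    refine ⟨?_, ?_⟩
    · rw [← (Fin.consEquiv fun _ => ℕ).summable_iff]
      refine h3.congr fun p => ?_
      simp only [Function.comp_apply]
      rw [e]
    · rw [← (Fin.consEquiv fun _ => ℕ).hasSum_iff, Fin.prod_univ_succ, ← h2.tsum_eq,
        tsum_mul_tsum_of_summable_norm (hf 0) h1]
      rw [show ((fun l : Fin (n + 1) → ℕ => ∏ j, f j (l j)) ∘ Fin.consEquiv fun _ => ℕ) =
        fun p => f 0 p.1 * ∏ j, f (Fin.succ j) (p.2 j) from funext e]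
      exact h3.of_norm.hasSum

/-- The Andréief identity for sums: a sum over signatures of products of two determinants is the
determinant of the pairwise sums. For finitely supported functions it is the Cauchy-Binet
formula. -/
theorem hasSum_det_mul_det {n : ℕ} (φ ψ : Fin n → ℕ → 𝕜)
    (h : ∀ i j, Summable fun l => ‖φ i l * ψ j l‖) :
    HasSum (fun lam : GT n => (Matrix.of fun i j => φ i (shifted lam j)).det *
        (Matrix.of fun i j => ψ i (shifted lam j)).det)
      (Matrix.of fun i j => ∑' l, φ i l * ψ j l).det := by
  classical
  have h1 : HasSum (fun l : Fin n → ℕ => (Matrix.of fun i j => φ i (l j)).det * ∏ j, ψ j (l j))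
      (Matrix.of fun i j => ∑' l, φ i l * ψ j l).det := by
    have h2 : ∀ σ : Equiv.Perm (Fin n), HasSum (fun l : Fin n → ℕ =>
        (Equiv.Perm.sign σ : ℤ) • ∏ j, (φ (σ j) (l j) * ψ j (l j)))
        ((Equiv.Perm.sign σ : ℤ) • ∏ j, ∑' l, φ (σ j) l * ψ j l) := fun σ =>
      (hasSum_prod_pi (fun j l => φ (σ j) l * ψ j l) (fun j => h (σ j) j)).2.const_smul _
    have h3 := hasSum_sum (s := Finset.univ) fun σ _ => h2 σ
    rw [Matrix.det_apply]
    convert h3 using 1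
    · funext l
      rw [Matrix.det_apply, Finset.sum_mul]
      refine Finset.sum_congr rfl fun σ _ => ?_
      rw [Finset.prod_mul_distrib, ← smul_mul_assoc]
      rfl
    · rfl
  rw [← (shifted_comp_perm_injective n).hasSum_iff] at h1
  · refine h1.prod_fiberwise fun lam => ?_
    convert hasSum_fintype _ using 1
    simp only [Function.comp_apply]
    have h4 : ∀ σ : Equiv.Perm (Fin n), (Matrix.of fun i j => φ i (shifted lam (σ j))).det =
        (Equiv.Perm.sign σ : 𝕜) * (Matrix.of fun i j => φ i (shifted lam j)).det := fun σ => by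
      rw [← Matrix.det_permute']
      rfl
    simp only [h4]
    rw [← Matrix.det_transpose (Matrix.of fun i j => ψ i (shifted lam j)),
      Matrix.det_apply' (Matrix.transpose _), Finset.mul_sum]
    refine Finset.sum_congr rfl fun σ _ => ?_
    simp only [Matrix.transpose_apply, Matrix.of_apply]
    ring
  · intro l hl
    have : ¬ Function.Injective l := fun hi => hl (range_shifted_comp_perm hi)
    simp only [Function.Injective, not_forall] at this
    obtain ⟨i, j, hij, hne⟩ := this
    rw [Matrix.det_zero_of_column_eq hne (fun k => by simp [hij]), zero_mul]

end Andreief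

/-! ### Vandermonde determinants -/

theorem det_eval_rev_eq_prod {R : Type*} [CommRing R] [Nontrivial R] {n : ℕ} (q : ℕ → Polynomial R)
    (hdeg : ∀ k, (q k).natDegree = k) (hmonic : ∀ k, (q k).Monic) (y : Fin n → R) :
    (Matrix.of fun i j : Fin n => (q (j.rev : ℕ)).eval (y i)).det =
      ∏ p ∈ ltPairs n, (y p.1 - y p.2) := by
  have h1 := Matrix.det_eval_matrixOfPolynomials_eq_det_vandermonde (y ∘ Fin.rev)
    (fun j => q j) (fun j => hdeg j) (fun j => hmonic j)
  have h2 : (Matrix.of fun i j : Fin n => (q (j.rev : ℕ)).eval (y i)).det =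
      ((Matrix.of fun i j : Fin n => (q (j.rev : ℕ)).eval (y i)).submatrix Fin.revPerm
        Fin.revPerm).det := (Matrix.det_submatrix_equiv_self _ _).symm
  rw [h2]
  have h3 : (Matrix.of fun i j : Fin n => (q (j.rev : ℕ)).eval (y i)).submatrix Fin.revPerm
      Fin.revPerm = Matrix.of fun i j : Fin n => (q j).eval ((y ∘ Fin.rev) i) := by
    ext i j
    simp only [Matrix.submatrix_apply, Matrix.of_apply, Fin.revPerm_apply, Fin.rev_rev,
      Function.comp_apply]
  rw [h3, ← h1, Matrix.det_vandermonde, ltPairs, Finset.prod_sigma']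
  refine Finset.prod_bij' (fun p _ => (p.2.rev, p.1.rev)) (fun p _ => ⟨p.2.rev, p.1.rev⟩)
    ?_ ?_ ?_ ?_ ?_
  · rintro ⟨i, j⟩ h; simpa using h
  · rintro ⟨i, j⟩ h; simpa using h
  · rintro ⟨i, j⟩ h; simp
  · rintro ⟨i, j⟩ h; simp
  · rintro ⟨i, j⟩ h; simp

theorem prod_ltPairs_ne_zero {R : Type*} [CommRing R] [IsDomain R] {n : ℕ} {y : Fin n → R}
    (hy : Function.Injective y) : ∏ p ∈ ltPairs n, (y p.1 - y p.2) ≠ 0 :=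
  Finset.prod_ne_zero_iff.2 fun _ hp => sub_ne_zero.2 fun h =>
    (Finset.mem_filter.1 hp).2.ne (hy h)

end BCZMeasure

namespace BCZMeasure

/-! ### Multivariate Jacobi polynomials -/

theorem finite_shifted_lt (N L : ℕ) : {mu : GT N | ∀ j, shifted mu j < L}.Finite := by
  refine Set.Finite.of_finite_image (f := fun mu => shifted mu)
    ((Set.Finite.pi' (t := fun _ : Fin N => Set.Iio L) fun _ => Set.finite_Iio L).subset ?_) ?_
  · rintro _ ⟨mu, hmu, rfl⟩
    exact fun j => hmu j
  · intro mu _ nu _ h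
    by_contra hne
    exact shifted_ne hne h

/-- The squared shifted coordinate `(l + ε)²`. -/
def sqShift (a b : ℝ) (l : ℕ) : ℝ := (l + eps a b) ^ 2

/-- The product `∏_{i < j} ((l_i + ε)² - (l_j + ε)²)`. -/
def sqVandermonde (a b : ℝ) {N : ℕ} (lam : GT N) : ℝ :=
  ∏ p ∈ ltPairs N, (sqShift a b (shifted lam p.1) - sqShift a b (shifted lam p.2))

theorem eval_vandermondePoly {N : ℕ} (x : Fin N → ℝ) :
    MvPolynomial.eval x (vandermondePoly N) = ∏ p ∈ ltPairs N, (x p.1 - x p.2) := by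
  simp [vandermondePoly]

theorem eval_jacobiAlternant (a b : ℝ) {N : ℕ} (lam : GT N) (x : Fin N → ℝ) :
    MvPolynomial.eval x (jacobiAlternant a b lam) =
      (Matrix.of fun i j => (jacobi a b (shifted lam i)).eval (x j)).det := by
  rw [jacobiAlternant, RingHom.map_det]
  congr 1
  ext i j
  simp only [RingHom.mapMatrix_apply, Matrix.map_apply, Matrix.of_apply]
  rw [← MvPolynomial.coe_aeval_eq_eval, RingHom.coe_coe, ← Polynomial.aeval_algHom_apply]
  simp [Polynomial.aeval_def, Polynomial.eval₂_eq_eval_map]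

theorem prod_mul_eval_jacobiMv (a b : ℝ) {N : ℕ} (lam : GT N) (x : Fin N → ℝ) :
    (∏ p ∈ ltPairs N, (x p.1 - x p.2)) * MvPolynomial.eval x (jacobiMv a b lam) =
      (Matrix.of fun i j => (jacobi a b (shifted lam i)).eval (x j)).det := by
  rw [← eval_vandermondePoly, ← map_mul, vandermondePoly_mul_jacobiMv, eval_jacobiAlternant]

/-- The alternant of the Jacobi polynomials normalized at `1`. -/
def altOne (a b : ℝ) {N : ℕ} (lam : GT N) (x : Fin N → ℝ) : ℝ :=
  (Matrix.of fun i j => (jacobiOne a b (shifted lam i)).eval (x j)).det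

section

variable {a b : ℝ}

theorem sqVandermonde_pos (hb : -1 / 2 ≤ b) (hab : b ≤ a) {N : ℕ} (lam : GT N) :
    0 < sqVandermonde a b lam := by
  refine Finset.prod_pos fun p hp => sub_pos.2 ?_
  have h1 : shifted lam p.2 < shifted lam p.1 := shifted_strictAnti lam (Finset.mem_filter.1 hp).2
  have h2 : (shifted lam p.2 : ℝ) < shifted lam p.1 := by exact_mod_cast h1
  have h3 := eps_nonneg hb hab
  unfold sqShift
  gcongr

theorem prod_mul_eval_jacobiMv' (hb : -1 / 2 ≤ b) (hab : b ≤ a) {N : ℕ} (lam : GT N)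
    (x : Fin N → ℝ) :
    (∏ p ∈ ltPairs N, (x p.1 - x p.2)) * MvPolynomial.eval x (jacobiMv a b lam) =
      (∏ i, (hypCoeff a b (shifted lam i) (shifted lam i))⁻¹) * altOne a b lam x := by
  rw [prod_mul_eval_jacobiMv, altOne, ← Matrix.det_mul_column]
  congr 1
  ext i j
  simp [jacobi_eq hb hab]

theorem hypProd_eq_eval (k n : ℕ) : hypProd (a + b + 1) k n =
    (∏ r ∈ Finset.range k, (Polynomial.X - Polynomial.C ((eps a b + r) ^ 2))).eval
      (sqShift a b n) := by
  rw [Polynomial.eval_prod, hypProd]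
  refine Finset.prod_congr rfl fun r _ => ?_
  simp only [Polynomial.eval_sub, Polynomial.eval_X, Polynomial.eval_C, sqShift, eps]
  ring

theorem det_hypCoeff_rev {N : ℕ} (lam : GT N) :
    (Matrix.of fun i j : Fin N => hypCoeff a b (shifted lam i) (j.rev : ℕ)).det =
      (∏ k ∈ Finset.range N, hypConst a k) * sqVandermonde a b lam := by
  have h := det_eval_rev_eq_prod
    (fun k => ∏ r ∈ Finset.range k, (Polynomial.X - Polynomial.C ((eps a b + r) ^ 2)))
    (fun k => by rw [Polynomial.natDegree_finsetProd_X_sub_C_eq_card]; simp)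
    (fun k => Polynomial.monic_prod_of_monic _ _ fun _ _ => Polynomial.monic_X_sub_C _)
    (fun i : Fin N => sqShift a b (shifted lam i))
  rw [sqVandermonde, ← h, Finset.prod_range, ← Equiv.prod_comp Fin.revPerm, ← Matrix.det_mul_row]
  congr 1
  ext i j
  simp [hypCoeff, hypProd_eq_eval]

/-- The expansion of the alternant around `x = (1, …, 1)`: with `x = 1 + s y` the alternant is a
finite sum over signatures `κ` of terms homogeneous in `s`. -/
theorem exists_altOne_expansion {N : ℕ} (lam : GT N) (y : Fin N → ℝ) :
    ∃ S : Finset (GT N), (∀ κ : GT N, κ ∉ S →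
        (Matrix.of fun i j => hypCoeff a b (shifted lam i) (shifted κ j)).det = 0) ∧
      ∀ s : ℝ, altOne a b lam (fun j => 1 + s * y j) = ∑ κ ∈ S,
        (Matrix.of fun i j => hypCoeff a b (shifted lam i) (shifted κ j)).det *
          (s ^ (∑ j, shifted κ j) * (Matrix.of fun i j => y i ^ shifted κ j).det) := by
  obtain ⟨L, hL⟩ : ∃ L, ∀ i, shifted lam i < L :=
    ⟨∑ i, shifted lam i + 1, fun i => Nat.lt_succ_of_le
      (Finset.single_le_sum (f := shifted lam) (fun _ _ => Nat.zero_le _) (Finset.mem_univ i))⟩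
  refine ⟨(finite_shifted_lt N L).toFinset, ?_, fun s => ?_⟩
  · intro κ hκ
    simp only [Set.Finite.mem_toFinset, Set.mem_ofPred_eq, not_forall, not_lt] at hκ
    obtain ⟨j, hj⟩ := hκ
    exact Matrix.det_eq_zero_of_column_eq_zero j fun i =>
      hypCoeff_eq_zero _ _ ((hL i).trans_le hj)
  · have hzero : ∀ i l, l ∉ Finset.range L → hypCoeff a b (shifted lam i) l = 0 := fun i l hl =>
      hypCoeff_eq_zero _ _ ((hL i).trans_le (by simpa using hl))
    have h := hasSum_det_mul_det (fun (i : Fin N) k => hypCoeff a b (shifted lam i) k)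
      (fun (j : Fin N) k => (s * y j) ^ k) (fun i j => summable_of_ne_finset_zero
        (s := Finset.range L) fun l hl => by rw [hzero i l hl]; simp)
    have h2 : (Matrix.of fun i j : Fin N =>
        ∑' l, hypCoeff a b (shifted lam i) l * (s * y j) ^ l).det =
        altOne a b lam (fun j => 1 + s * y j) := by
      rw [altOne]
      congr 1
      ext i j
      simp only [Matrix.of_apply]
      rw [jacobiOne_eval, add_sub_cancel_left]
      refine tsum_eq_sum fun l hl => ?_
      rw [hypCoeff_eq_zero _ _ (by simpa using hl), zero_mul]
    rw [h2] at h
    refine h.unique (hasSum_sum_of_ne_finset_zero fun κ hκ => ?_) |>.trans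
      (Finset.sum_congr rfl fun κ _ => ?_)
    · simp only [Set.Finite.mem_toFinset, Set.mem_ofPred_eq, not_forall, not_lt] at hκ
      obtain ⟨j, hj⟩ := hκ
      rw [Matrix.det_eq_zero_of_column_eq_zero j fun i =>
        hypCoeff_eq_zero _ _ ((hL i).trans_le hj), zero_mul]
    · congr 1
      rw [← Finset.prod_pow_eq_pow_sum, ← Matrix.det_mul_row]
      congr 1
      ext i j
      simp [mul_pow]

theorem shifted_zero {N : ℕ} (j : Fin N) :
    shifted (⟨fun _ => 0, antitone_const⟩ : GT N) j = j.rev := by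
  simp [shifted]

/-- The value at `(1, …, 1)`: the lowest order term of the expansion around this point. -/
theorem eval_one_jacobiMv (hb : -1 / 2 ≤ b) (hab : b ≤ a) {N : ℕ} (lam : GT N) :
    MvPolynomial.eval (fun _ => 1) (jacobiMv a b lam) =
      (∏ i, (hypCoeff a b (shifted lam i) (shifted lam i))⁻¹) *
        ((∏ k ∈ Finset.range N, hypConst a k) * sqVandermonde a b lam) := by
  classical
  set y : Fin N → ℝ := fun j => (j : ℕ) with hy
  have hyinj : Function.Injective y := fun i j h => by
    have h' : ((i : ℕ) : ℝ) = (j : ℕ) := h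
    exact Fin.ext (by exact_mod_cast h')
  set o : GT N := ⟨fun _ => 0, antitone_const⟩ with ho
  set V := ∏ p ∈ ltPairs N, (y p.1 - y p.2) with hV
  have hV0 : V ≠ 0 := prod_ltPairs_ne_zero hyinj
  set K := ∏ i, (hypCoeff a b (shifted lam i) (shifted lam i))⁻¹
  have hvan : ∀ w : Fin N → ℝ, ∏ p ∈ ltPairs N, (w p.1 - w p.2) =
      (Matrix.of fun i j : Fin N => w i ^ shifted o j).det := fun w => by
    rw [← det_eval_rev_eq_prod (fun k => Polynomial.X ^ k) (fun k => Polynomial.natDegree_X_pow k)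
      (fun k => Polynomial.monic_X_pow k)]
    simp only [Polynomial.eval_pow, Polynomial.eval_X, ho, shifted_zero]
  obtain ⟨S, hS, hsum⟩ := exists_altOne_expansion (a := a) (b := b) lam y
  set D : GT N → ℝ := fun κ =>
    (Matrix.of fun i j => hypCoeff a b (shifted lam i) (shifted κ j)).det *
    (Matrix.of fun i j => y i ^ shifted κ j).det with hD
  have hdeg : ∀ κ : GT N, ∑ j, shifted κ j = ∑ j, κ.1 j + ∑ j, shifted o j := fun κ => by
    rw [← Finset.sum_add_distrib]
    exact Finset.sum_congr rfl fun j _ => by simp [shifted, ho]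
  have hne : ∀ s : ℝ, s ≠ 0 → V * MvPolynomial.eval (fun j => 1 + s * y j) (jacobiMv a b lam) =
      K * ∑ κ ∈ S, D κ * s ^ (∑ j, κ.1 j) := fun s hs => by
    have h1 := prod_mul_eval_jacobiMv' hb hab lam (fun j => 1 + s * y j)
    have h2 : ∏ p ∈ ltPairs N, ((1 + s * y p.1) - (1 + s * y p.2)) =
        s ^ (∑ j, shifted o j) * V := by
      have e : ∏ p ∈ ltPairs N, ((1 + s * y p.1) - (1 + s * y p.2)) =
          ∏ p ∈ ltPairs N, ((fun j => s * y j) p.1 - (fun j => s * y j) p.2) :=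
        Finset.prod_congr rfl fun p _ => by ring
      rw [e, hvan (fun j => s * y j), hV, hvan y, ← Finset.prod_pow_eq_pow_sum,
        ← Matrix.det_mul_row]
      congr 1
      ext i j
      simp [mul_pow]
    rw [h2, hsum] at h1
    have h3 := pow_ne_zero (∑ j, shifted o j) hs
    refine mul_left_cancel₀ h3 ?_
    rw [← mul_assoc, h1, mul_left_comm]
    congr 1
    rw [Finset.mul_sum]
    refine Finset.sum_congr rfl fun κ _ => ?_
    rw [hdeg κ, pow_add, hD]
    ring
  have hcont1 : Continuous fun s : ℝ =>
      V * MvPolynomial.eval (fun j => 1 + s * y j) (jacobiMv a b lam) :=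
    continuous_const.mul ((MvPolynomial.continuous_eval _).comp (by fun_prop))
  have hcont2 : Continuous fun s : ℝ => K * ∑ κ ∈ S, D κ * s ^ (∑ j, κ.1 j) := by fun_prop
  have heq := hcont1.ext_on (dense_compl_singleton (0 : ℝ)) hcont2 (fun s hs => hne s hs)
  have h0 := congrFun heq 0
  simp only [zero_mul, add_zero] at h0
  have hsum0 : ∑ κ ∈ S, D κ * (0 : ℝ) ^ (∑ j, κ.1 j) = D o := by
    rw [Finset.sum_eq_single o]
    · simp [ho]
    · intro κ _ hκ
      have : ∑ j, κ.1 j ≠ 0 := fun h => hκ (Subtype.ext (funext fun j => by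
        simpa using (Finset.sum_eq_zero_iff.1 h) j (Finset.mem_univ j)))
      rw [zero_pow this, mul_zero]
    · intro ho'
      simp only [hD]
      rw [hS o ho']
      simp
  rw [hsum0, hD] at h0
  simp only [← hvan] at h0
  rw [← hV] at h0
  have h4 := det_hypCoeff_rev (a := a) (b := b) lam
  simp only [ho, shifted_zero] at h0
  rw [h4] at h0
  refine mul_left_cancel₀ hV0 ?_
  rw [h0]
  ring

theorem prod_hypConst_pos (ha : -1 / 2 ≤ a) (N : ℕ) : 0 < ∏ k ∈ Finset.range N, hypConst a k :=
  Finset.prod_pos fun k _ => hypConst_pos ha k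

theorem prod_mul_normJacobi (hb : -1 / 2 ≤ b) (hab : b ≤ a) {N : ℕ} (lam : GT N) (x : Fin N → ℝ) :
    (∏ p ∈ ltPairs N, (x p.1 - x p.2)) * normJacobi a b lam x =
      altOne a b lam x / ((∏ k ∈ Finset.range N, hypConst a k) * sqVandermonde a b lam) := by
  have h1 := sqVandermonde_pos hb hab lam
  have h2 := prod_hypConst_pos (hb.trans hab) N
  have h3 : ∏ i, (hypCoeff a b (shifted lam i) (shifted lam i))⁻¹ ≠ 0 :=
    Finset.prod_ne_zero_iff.2 fun i _ => inv_ne_zero (hypCoeff_self_pos hb hab _).ne'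
  rw [normJacobi, ← mul_div_assoc, prod_mul_eval_jacobiMv' hb hab, eval_one_jacobiMv hb hab,
    mul_div_mul_left _ _ h3]

theorem eval_one_jacobiMv_ne_zero (hb : -1 / 2 ≤ b) (hab : b ≤ a) {N : ℕ} (lam : GT N) :
    MvPolynomial.eval (fun _ => 1) (jacobiMv a b lam) ≠ 0 := by
  rw [eval_one_jacobiMv hb hab]
  have h1 := sqVandermonde_pos hb hab lam
  have h2 := prod_hypConst_pos (hb.trans hab) N
  have h3 : ∏ i, (hypCoeff a b (shifted lam i) (shifted lam i))⁻¹ ≠ 0 :=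
    Finset.prod_ne_zero_iff.2 fun i _ => inv_ne_zero (hypCoeff_self_pos hb hab _).ne'
  positivity

theorem normJacobi_one (hb : -1 / 2 ≤ b) (hab : b ≤ a) {N : ℕ} (lam : GT N) :
    normJacobi a b lam (fun _ => 1) = 1 :=
  div_self (eval_one_jacobiMv_ne_zero hb hab lam)

/-! ### Linear independence -/

theorem det_sum_mul {R : Type*} [CommRing R] {n : ℕ} {ι : Type*} [Fintype ι]
    (w g : Fin n → ι → R) :
    (Matrix.of fun i j => ∑ s, w j s * g i s).det =
      ∑ f : Fin n → ι, (∏ j, w j (f j)) * (Matrix.of fun i j => g i (f j)).det := by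
  classical
  simp only [Matrix.det_apply', Matrix.of_apply, Finset.prod_univ_sum, Fintype.piFinset_univ,
    Finset.mul_sum]
  rw [Finset.sum_comm]
  refine Finset.sum_congr rfl fun f _ => Finset.sum_congr rfl fun σ _ => ?_
  rw [Finset.prod_mul_distrib]
  ring

theorem det_indicator_shifted {N : ℕ} (mu nu : GT N) :
    (Matrix.of fun i j : Fin N => if shifted mu i = shifted nu j then (1 : ℝ) else 0).det =
      if mu = nu then 1 else 0 := by
  classical
  split_ifs with h
  · subst h
    rw [← Matrix.det_one (n := Fin N)]
    congr 1
    ext i j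
    simp [Matrix.one_apply, (shifted_injective mu).eq_iff]
  · have : ∃ j, ∀ i, shifted mu i ≠ shifted nu j := by
      by_contra hcon
      push Not at hcon
      choose τ hτ using hcon
      have h1 : StrictMono τ := fun i j hij => by
        have := shifted_strictAnti nu hij
        rw [← hτ i, ← hτ j] at this
        exact (shifted_strictAnti mu).lt_iff_gt.1 this
      have h2 : Function.Surjective τ := Finite.surjective_of_injective h1.injective
      have h3 : τ = id := (h1.range_inj strictMono_id).1 (by rw [h2.range_eq, Set.range_id])
      refine shifted_ne h (funext fun j => ?_)
      rw [← hτ j, h3]; rfl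
    obtain ⟨j, hj⟩ := this
    exact Matrix.det_eq_zero_of_column_eq_zero j fun i => by simp [hj i]

theorem monic_jacobi (hb : -1 / 2 ≤ b) (hab : b ≤ a) (n : ℕ) : (jacobi a b n).Monic := by
  rw [jacobi_eq hb hab, Polynomial.Monic, Polynomial.leadingCoeff_mul, Polynomial.leadingCoeff_C,
    leadingCoeff_jacobiOne hb hab, inv_mul_cancel₀ (hypCoeff_self_pos hb hab n).ne']

theorem natDegree_jacobi (hb : -1 / 2 ≤ b) (hab : b ≤ a) (n : ℕ) :
    (jacobi a b n).natDegree = n := by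
  rw [jacobi_eq hb hab, Polynomial.natDegree_C_mul (inv_ne_zero (hypCoeff_self_pos hb hab n).ne'),
    natDegree_jacobiOne hb hab]

/-- The functionals dual to the Jacobi polynomials of degree less than `D` are combinations of
evaluations. -/
theorem exists_dual_jacobi (hb : -1 / 2 ≤ b) (hab : b ≤ a) (D : ℕ) :
    ∃ w : Fin D → Fin D → ℝ, ∀ m n : Fin D,
      ∑ s : Fin D, w n s * (jacobi a b m).eval ((s : ℕ) : ℝ) = if m = n then 1 else 0 := by
  classical
  set P : Matrix (Fin D) (Fin D) ℝ := Matrix.of fun s m => (jacobi a b m).eval ((s : ℕ) : ℝ) with hP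
  have hdet : IsUnit P.det := by
    rw [hP, ← Matrix.det_eval_matrixOfPolynomials_eq_det_vandermonde
      (fun s : Fin D => ((s : ℕ) : ℝ))
      (fun m => jacobi a b m) (fun m => natDegree_jacobi hb hab m) (fun m => monic_jacobi hb hab m)]
    exact (Matrix.det_vandermonde_ne_zero_iff.2 fun i j h => Fin.ext (by exact_mod_cast h)).isUnit
  refine ⟨fun n s => P⁻¹ n s, fun m n => ?_⟩
  have h := congrFun (congrFun (Matrix.nonsing_inv_mul P hdet) n) m
  rw [Matrix.mul_apply, Matrix.one_apply] at h
  simpa [hP, eq_comm] using h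

/-- The normalized Jacobi polynomials are linearly independent as functions. -/
theorem finsupp_eq_zero_of_sum_normJacobi (hb : -1 / 2 ≤ b) (hab : b ≤ a) {N : ℕ} (c : GT N →₀ ℝ)
    (h : ∀ x : Fin N → ℝ, (c.sum fun mu r => r * normJacobi a b mu x) = 0) : c = 0 := by
  classical
  ext nu
  rw [Finsupp.coe_zero, Pi.zero_apply]
  by_contra hnu
  obtain ⟨D, hD⟩ : ∃ D, ∀ mu ∈ c.support, ∀ i, shifted mu i < D := by
    refine ⟨∑ mu ∈ c.support, ∑ i, shifted mu i + 1, fun mu hmu i => ?_⟩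
    refine Nat.lt_succ_of_le ?_
    exact (Finset.single_le_sum (f := shifted mu) (fun _ _ => Nat.zero_le _)
      (Finset.mem_univ i)).trans
        (Finset.single_le_sum (f := fun mu : GT N => ∑ i, shifted mu i)
          (fun _ _ => Nat.zero_le _) hmu)
  obtain ⟨w, hw⟩ := exists_dual_jacobi hb hab D
  have hnus : nu ∈ c.support := Finsupp.mem_support_iff.2 hnu
  let n : Fin N → Fin D := fun j => ⟨shifted nu j, hD nu hnus j⟩
  -- apply the product of the dual functionals belonging to the entries of `nu`
  have h1 : ∑ f : Fin N → Fin D, (∏ j, w (n j) (f j)) *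
      ((∏ p ∈ ltPairs N, (((f p.1 : ℕ) : ℝ) - (f p.2 : ℕ))) *
        c.sum fun mu r => r * normJacobi a b mu (fun j => ((f j : ℕ) : ℝ))) = 0 :=
    Finset.sum_eq_zero fun f _ => by rw [h]; simp
  have h2 : ∀ mu ∈ c.support, ∑ f : Fin N → Fin D, (∏ j, w (n j) (f j)) *
      ((∏ p ∈ ltPairs N, (((f p.1 : ℕ) : ℝ) - (f p.2 : ℕ))) *
        (c mu * normJacobi a b mu (fun j => ((f j : ℕ) : ℝ)))) =
      c mu / MvPolynomial.eval (fun _ => 1) (jacobiMv a b mu) * if mu = nu then 1 else 0 := by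
    intro mu hmu
    rw [← det_indicator_shifted]
    have h3 := det_sum_mul (fun j => w (n j))
      (fun (i : Fin N) (s : Fin D) => (jacobi a b (shifted mu i)).eval ((s : ℕ) : ℝ))
    have h4 : (Matrix.of fun i j : Fin N => ∑ s, w (n j) s *
        (jacobi a b (shifted mu i)).eval ((s : ℕ) : ℝ)) =
        Matrix.of fun i j : Fin N => if shifted mu i = shifted nu j then (1 : ℝ) else 0 := by
      ext i j
      have := hw ⟨shifted mu i, hD mu hmu i⟩ (n j)
      simpa [n, Fin.ext_iff] using this
    rw [← h4, h3, Finset.mul_sum]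
    refine Finset.sum_congr rfl fun f _ => ?_
    rw [← prod_mul_eval_jacobiMv a b mu (fun j => ((f j : ℕ) : ℝ)), normJacobi]
    ring
  have h5 : ∑ mu ∈ c.support, (c mu / MvPolynomial.eval (fun _ => 1) (jacobiMv a b mu) *
      if mu = nu then 1 else 0) = 0 := by
    rw [← Finset.sum_congr rfl h2, Finset.sum_comm, ← h1]
    refine Finset.sum_congr rfl fun f _ => ?_
    rw [Finsupp.sum, Finset.mul_sum, Finset.mul_sum]
  rw [Finset.sum_eq_single nu (fun mu _ hne => by simp [hne]) (fun hn => absurd hnus hn)] at h5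
  simp [hnu, eval_one_jacobiMv_ne_zero hb hab nu] at h5

end

end BCZMeasure

namespace BCZMeasure

/-! ### The branching rule -/

/-- The kernel `B(l, m)` of the expansion `p_l(x) - 1 = (x - 1) / 2 * ∑_m B(l, m) p_m(x)`. -/
def branchKernel (a b : ℝ) (l m : ℕ) : ℝ :=
  plancherel a b m * ∑ k ∈ Finset.Ico m l, (plancherel a b k * recA a b k)⁻¹

theorem branchKernel_eq_zero (a b : ℝ) {l m : ℕ} (h : l ≤ m) : branchKernel a b l m = 0 := by
  simp [branchKernel, Finset.Ico_eq_empty_of_le h]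

theorem branchKernel_succ (a b : ℝ) (l m : ℕ) : branchKernel a b (l + 1) m = branchKernel a b l m +
    if m < l + 1 then plancherel a b m * (plancherel a b l * recA a b l)⁻¹ else 0 := by
  split_ifs with h
  · rw [branchKernel, Finset.sum_Ico_succ_top (by lia), mul_add, branchKernel]
  · rw [branchKernel_eq_zero _ _ (by lia), branchKernel_eq_zero _ _ (by lia), add_zero]

/-- Expansion of a determinant bordered by a column of ones. -/
theorem det_snoc_one {R : Type*} [CommRing R] {n : ℕ} (M : Fin (n + 1) → Fin n → R) :
    (Matrix.of fun i => (Fin.snoc (M i) 1 : Fin (n + 1) → R)).det =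
      (Matrix.of fun i j : Fin n => M i.castSucc j - M i.succ j).det := by
  have h1 : (Matrix.of fun i => (Fin.snoc (M i) 1 : Fin (n + 1) → R)).det =
      (Matrix.of (Fin.cons (Fin.snoc (M 0) 1 : Fin (n + 1) → R)
        fun i : Fin n => (Fin.snoc (fun j => M i.succ j - M i.castSucc j) 0 :
          Fin (n + 1) → R)) : Matrix (Fin (n + 1)) (Fin (n + 1)) R).det := by
    refine Matrix.det_eq_of_forall_row_eq_smul_add_pred (fun _ => 1) (fun j => ?_) fun i j => ?_
    · simp
    · refine Fin.lastCases ?_ (fun j => ?_) j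
      · simp
      · simp
  rw [h1, Matrix.det_succ_column _ (Fin.last n), Fin.sum_univ_succ]
  simp only [Matrix.of_apply, Fin.cons_zero, Fin.cons_succ, Fin.snoc_last, mul_zero, zero_mul,
    Finset.sum_const_zero, add_zero, mul_one]
  have h2 : (Matrix.of (Fin.cons (Fin.snoc (M 0) 1 : Fin (n + 1) → R)
        fun i : Fin n => (Fin.snoc (fun j => M i.succ j - M i.castSucc j) 0 :
          Fin (n + 1) → R)) : Matrix (Fin (n + 1)) (Fin (n + 1)) R).submatrix
        (Fin.succAbove 0) (Fin.last n).succAbove =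
      -(Matrix.of fun i j : Fin n => M i.castSucc j - M i.succ j) := by
    ext i j
    simp
  rw [h2, Matrix.det_neg]
  simp [← mul_assoc, ← mul_pow]

/-- The determinant through which the link is expressed. -/
def linkDet (a b : ℝ) {N : ℕ} (lam : GT (N + 1)) (mu : GT N) : ℝ :=
  (Matrix.of fun i => (Fin.snoc (fun j => branchKernel a b (shifted lam i) (shifted mu j)) 1 :
    Fin (N + 1) → ℝ)).det

theorem linkDet_eq_zero (a b : ℝ) {N : ℕ} {lam : GT (N + 1)} {mu : GT N} {j : Fin N}
    (h : shifted lam 0 ≤ shifted mu j) : linkDet a b lam mu = 0 := by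
  rw [linkDet, det_snoc_one]
  have h1 : ∀ i, branchKernel a b (shifted lam i) (shifted mu j) = 0 := fun i =>
    branchKernel_eq_zero _ _ (((shifted_strictAnti lam).antitone (Fin.zero_le i)).trans h)
  exact Matrix.det_eq_zero_of_column_eq_zero j fun i => by simp [h1]

theorem prod_ltPairs_snoc {R : Type*} [CommRing R] {n : ℕ} (x : Fin n → R) (c : R) :
    ∏ p ∈ ltPairs (n + 1),
        ((Fin.snoc x c : Fin (n + 1) → R) p.1 - (Fin.snoc x c : Fin (n + 1) → R) p.2) =
      (∏ p ∈ ltPairs n, (x p.1 - x p.2)) * ∏ j, (x j - c) := by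
  simp only [ltPairs, Finset.prod_filter, ← Finset.univ_product_univ, Finset.prod_product]
  rw [Fin.prod_univ_castSucc, ← Finset.prod_mul_distrib]
  simp only [Fin.prod_univ_castSucc, Fin.snoc_castSucc, Fin.snoc_last, Fin.castSucc_lt_castSucc_iff,
    Fin.castSucc_lt_last, if_true]
  have : ∀ j : Fin n, ¬ Fin.last n < j.castSucc := fun j => not_lt.2 (Fin.le_last _)
  simp [this]

section

variable {a b : ℝ}

/-- The branching rule for one variable, from the telescoped three-term recurrence. -/
theorem jacobiOne_sub_one (hb : -1 / 2 ≤ b) (hab : b ≤ a) (x : ℝ) {l L : ℕ} (h : l ≤ L) :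
    (jacobiOne a b l).eval x - 1 =
      (x - 1) / 2 * ∑ m ∈ Finset.range L, branchKernel a b l m * (jacobiOne a b m).eval x := by
  induction l with
  | zero => simp [branchKernel_eq_zero, jacobiOne_eval, hypCoeff, hypConst, hypProd]
  | succ l ih =>
    have h1 := ih (by lia)
    have h2 := sum_plancherel_mul_jacobiOne hb hab x l
    have h3 : plancherel a b l * recA a b l ≠ 0 :=
      (mul_pos (plancherel_pos hb hab l) (recA_pos hb hab l)).ne'
    have h4 : ∑ m ∈ Finset.range L, (if m < l + 1 then
        plancherel a b m * (plancherel a b l * recA a b l)⁻¹ else 0) * (jacobiOne a b m).eval x =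
        (plancherel a b l * recA a b l)⁻¹ *
          ∑ m ∈ Finset.range (l + 1), plancherel a b m * (jacobiOne a b m).eval x := by
      rw [Finset.mul_sum, ← Finset.sum_subset (Finset.range_subset_range.2 h)]
      · refine Finset.sum_congr rfl fun m hm => ?_
        rw [if_pos (Finset.mem_range.1 hm)]
        ring
      · intro m _ hm
        rw [if_neg (by simpa using hm), zero_mul]
    simp only [branchKernel_succ, add_mul, Finset.sum_add_distrib]
    rw [h4, mul_add, ← h1, mul_left_comm, h2, inv_mul_cancel_left₀ h3]
    ring

/-- The bordered form of the alternant at `(x, 1)`, expanded by the Cauchy-Binet formula. -/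
theorem altOne_snoc (hb : -1 / 2 ≤ b) (hab : b ≤ a) {N : ℕ} (lam : GT (N + 1)) (x : Fin N → ℝ) :
    altOne a b lam (Fin.snoc x 1 : Fin (N + 1) → ℝ) = (∏ j, (x j - 1) / 2) *
      ∑ mu ∈ (finite_shifted_lt N (shifted lam 0)).toFinset,
        linkDet a b lam mu * altOne a b mu x := by
  set L := shifted lam 0 with hL
  have hle : ∀ i, shifted lam i ≤ L := fun i => (shifted_strictAnti lam).antitone (Fin.zero_le i)
  have h1 : altOne a b lam (Fin.snoc x 1 : Fin (N + 1) → ℝ) = (Matrix.of fun i =>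
      (Fin.snoc (fun j => (jacobiOne a b (shifted lam i)).eval (x j)) 1 :
        Fin (N + 1) → ℝ)).det := by
    rw [altOne]
    congr 1
    ext i j
    refine Fin.lastCases ?_ (fun j => ?_) j
    · simp [jacobiOne_eval_one]
    · simp
  have hcol : ∀ (i : Fin N) (j : Fin N), (jacobiOne a b (shifted lam i.castSucc)).eval (x j) -
      (jacobiOne a b (shifted lam i.succ)).eval (x j) = (x j - 1) / 2 * ∑' m,
        (branchKernel a b (shifted lam i.castSucc) m - branchKernel a b (shifted lam i.succ) m) *
          (jacobiOne a b m).eval (x j) := fun i j => by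
    have e1 := jacobiOne_sub_one hb hab (x j) (hle i.castSucc)
    have e2 := jacobiOne_sub_one hb hab (x j) (hle i.succ)
    rw [tsum_eq_sum (s := Finset.range L)]
    · simp only [sub_mul, Finset.sum_sub_distrib]
      rw [mul_sub, ← e1, ← e2]
      ring
    · intro m hm
      have hm : L ≤ m := by simpa using hm
      rw [branchKernel_eq_zero _ _ ((hle _).trans hm), branchKernel_eq_zero _ _ ((hle _).trans hm)]
      simp
  rw [h1, det_snoc_one]
  simp only [hcol]
  have h2 := Matrix.det_mul_row (fun j => (x j - 1) / 2) (Matrix.of fun i j : Fin N => ∑' m,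
        (branchKernel a b (shifted lam i.castSucc) m - branchKernel a b (shifted lam i.succ) m) *
          (jacobiOne a b m).eval (x j))
  simp only [Matrix.of_apply] at h2
  rw [h2]
  congr 1
  have h3 := hasSum_det_mul_det (fun (i : Fin N) m => branchKernel a b (shifted lam i.castSucc) m -
    branchKernel a b (shifted lam i.succ) m) (fun (j : Fin N) m => (jacobiOne a b m).eval (x j))
    (fun i j => summable_of_ne_finset_zero (s := Finset.range L) fun m hm => by
      have hm : L ≤ m := by simpa using hm
      rw [branchKernel_eq_zero _ _ ((hle _).trans hm), branchKernel_eq_zero _ _ ((hle _).trans hm)]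
      simp)
  refine h3.unique ?_
  have h4 : ∀ mu : GT N, (Matrix.of fun i j : Fin N =>
      branchKernel a b (shifted lam i.castSucc) (shifted mu j) -
        branchKernel a b (shifted lam i.succ) (shifted mu j)).det *
      (Matrix.of fun i j : Fin N => (jacobiOne a b (shifted mu j)).eval (x i)).det =
      linkDet a b lam mu * altOne a b mu x := fun mu => by
    rw [linkDet, det_snoc_one, altOne, ← Matrix.det_transpose (Matrix.of fun i j : Fin N =>
      (jacobiOne a b (shifted mu j)).eval (x i))]
    rfl
  simp only [h4]
  refine hasSum_sum_of_ne_finset_zero fun mu hmu => ?_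
  simp only [Set.Finite.mem_toFinset, Set.mem_ofPred_eq, not_forall, not_lt] at hmu
  obtain ⟨j, hj⟩ := hmu
  rw [linkDet_eq_zero a b hj, zero_mul]

/-- The explicit form of the link. -/
def linkFormula (a b : ℝ) {N : ℕ} (lam : GT (N + 1)) (mu : GT N) : ℝ :=
  (2 ^ N * hypConst a N)⁻¹ * (sqVandermonde a b mu / sqVandermonde a b lam) * linkDet a b lam mu

theorem mvPolynomial_eq_of_mul_eval_eq {σ : Type*} {f g h : MvPolynomial σ ℝ} (hh : h ≠ 0)
    (H : ∀ x, MvPolynomial.eval x h * MvPolynomial.eval x f =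
      MvPolynomial.eval x h * MvPolynomial.eval x g) : f = g := by
  refine mul_left_cancel₀ hh (MvPolynomial.funext fun x => ?_)
  rw [map_mul, map_mul, H]

/-- The branching rule for normalized multivariate Jacobi polynomials. The identity is immediate
after multiplication by the denominators, and these cancel between polynomials. -/
theorem normJacobi_snoc (hb : -1 / 2 ≤ b) (hab : b ≤ a) {N : ℕ} (lam : GT (N + 1))
    (x : Fin N → ℝ) : normJacobi a b lam (Fin.snoc x 1 : Fin (N + 1) → ℝ) =
      ∑ mu ∈ (finite_shifted_lt N (shifted lam 0)).toFinset,
        linkFormula a b lam mu * normJacobi a b mu x := by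
  set S := (finite_shifted_lt N (shifted lam 0)).toFinset
  have hmul : ∀ x : Fin N → ℝ, ((∏ p ∈ ltPairs N, (x p.1 - x p.2)) * ∏ j, (x j - 1)) *
      normJacobi a b lam (Fin.snoc x 1 : Fin (N + 1) → ℝ) =
      ((∏ p ∈ ltPairs N, (x p.1 - x p.2)) * ∏ j, (x j - 1)) *
        ∑ mu ∈ S, linkFormula a b lam mu * normJacobi a b mu x := fun x => by
    have h1 := prod_mul_normJacobi hb hab lam (Fin.snoc x 1 : Fin (N + 1) → ℝ)
    rw [prod_ltPairs_snoc, altOne_snoc hb hab] at h1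
    rw [h1, Finset.mul_sum, Finset.prod_div_distrib, Finset.mul_sum, Finset.sum_div]
    refine Finset.sum_congr rfl fun mu _ => ?_
    have h2 := prod_mul_normJacobi hb hab mu x
    have e : (∏ p ∈ ltPairs N, (x p.1 - x p.2)) * (∏ j, (x j - 1)) *
        (linkFormula a b lam mu * normJacobi a b mu x) = (∏ j, (x j - 1)) * linkFormula a b lam mu *
          ((∏ p ∈ ltPairs N, (x p.1 - x p.2)) * normJacobi a b mu x) := by ring
    rw [e, h2, linkFormula, Finset.prod_range_succ, Finset.prod_const, Finset.card_univ,
      Fintype.card_fin]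
    have p1 := (sqVandermonde_pos hb hab mu).ne'
    have p2 := (sqVandermonde_pos hb hab lam).ne'
    have p3 := (hypConst_pos (hb.trans hab) N).ne'
    have p4 := (prod_hypConst_pos (hb.trans hab) N).ne'
    field_simp
  let P : MvPolynomial (Fin N) ℝ := MvPolynomial.aeval
    (Fin.snoc (α := fun _ => MvPolynomial (Fin N) ℝ) MvPolynomial.X 1) (jacobiMv a b lam)
  have hP : ∀ x, MvPolynomial.eval x P =
      MvPolynomial.eval (Fin.snoc x 1 : Fin (N + 1) → ℝ) (jacobiMv a b lam) := fun x => by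
    have : (Fin.snoc x 1 : Fin (N + 1) → ℝ) = fun i => MvPolynomial.aeval x
        ((Fin.snoc (α := fun _ => MvPolynomial (Fin N) ℝ) MvPolynomial.X 1 :
          Fin (N + 1) → MvPolynomial (Fin N) ℝ) i) := by
      funext i
      refine Fin.lastCases ?_ (fun i => ?_) i <;> simp
    simp only [P]
    rw [← MvPolynomial.coe_aeval_eq_eval, ← MvPolynomial.coe_aeval_eq_eval, RingHom.coe_coe,
      RingHom.coe_coe, this]
    exact MvPolynomial.comp_aeval_apply (φ := MvPolynomial.aeval x) _ _
  have hpoly : MvPolynomial.C (MvPolynomial.eval (fun _ => 1) (jacobiMv a b lam))⁻¹ * P =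
      ∑ mu ∈ S, MvPolynomial.C (linkFormula a b lam mu *
        (MvPolynomial.eval (fun _ => 1) (jacobiMv a b mu))⁻¹) * jacobiMv a b mu := by
    refine mvPolynomial_eq_of_mul_eval_eq (h := vandermondePoly N * ∏ j, (MvPolynomial.X j - 1)) ?_
      fun x => ?_
    · refine mul_ne_zero (fun h => ?_) (Finset.prod_ne_zero_iff.2 fun j _ h => ?_)
      · have := congrArg (MvPolynomial.eval fun j : Fin N => ((j : ℕ) : ℝ)) h
        rw [eval_vandermondePoly, map_zero] at this
        exact prod_ltPairs_ne_zero (y := fun j : Fin N => ((j : ℕ) : ℝ))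
          (fun i j h => Fin.ext (by have h' : ((i : ℕ) : ℝ) = (j : ℕ) := h; exact_mod_cast h')) this
      · have := congrArg (MvPolynomial.eval fun _ => (0 : ℝ)) h
        simp at this
    · have := hmul x
      simp only [map_mul, eval_vandermondePoly, map_prod, map_sub, MvPolynomial.eval_X, map_one,
        MvPolynomial.eval_C, map_sum, hP]
      simp only [normJacobi] at this
      convert this using 2
      · rw [div_eq_inv_mul]
      · refine Finset.sum_congr rfl fun mu _ => ?_
        rw [div_eq_inv_mul, mul_assoc]
  have := congrArg (MvPolynomial.eval x) hpoly
  simp only [map_mul, MvPolynomial.eval_C, map_sum, hP] at this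
  simp only [normJacobi]
  rw [div_eq_inv_mul, this]
  refine Finset.sum_congr rfl fun mu _ => ?_
  rw [div_eq_inv_mul, mul_assoc]

theorem linkFormula_eq_zero {N : ℕ} {lam : GT (N + 1)} {mu : GT N}
    (h : mu ∉ (finite_shifted_lt N (shifted lam 0)).toFinset) : linkFormula a b lam mu = 0 := by
  simp only [Set.Finite.mem_toFinset, Set.mem_ofPred_eq, not_forall, not_lt] at h
  obtain ⟨j, hj⟩ := h
  rw [linkFormula, linkDet_eq_zero a b hj, mul_zero]

theorem link_eq (hb : -1 / 2 ≤ b) (hab : b ≤ a) {N : ℕ} (lam : GT (N + 1)) (mu : GT N) :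
    link a b lam mu = linkFormula a b lam mu := by
  classical
  let c : GT N →₀ ℝ := Finsupp.onFinset (finite_shifted_lt N (shifted lam 0)).toFinset
    (linkFormula a b lam) fun mu h => by
      by_contra hmu
      exact h (linkFormula_eq_zero hmu)
  have hc : IsBranching a b lam c := fun x => by
    rw [normJacobi_snoc hb hab, Finsupp.onFinset_sum _ (fun _ => by simp)]
  have huniq : ∃! c : GT N →₀ ℝ, IsBranching a b lam c := by
    refine ⟨c, hc, fun d hd => ?_⟩
    rw [← sub_eq_zero]
    refine finsupp_eq_zero_of_sum_normJacobi hb hab _ fun x => ?_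
    rw [Finsupp.sum_sub_index (fun _ _ _ => sub_mul _ _ _), ← hc x, ← hd x, sub_self]
  rw [link, dif_pos huniq, huniq.unique huniq.choose_spec.1 hc]
  rfl

theorem link_eq_zero (hb : -1 / 2 ≤ b) (hab : b ≤ a) {N : ℕ} {lam : GT (N + 1)} {mu : GT N}
    (h : mu ∉ (finite_shifted_lt N (shifted lam 0)).toFinset) : link a b lam mu = 0 := by
  rw [link_eq hb hab, linkFormula_eq_zero h]

/-- The rows of the links sum to `1`: the branching rule at the point `(1, …, 1)`. -/
theorem hasSum_link (hb : -1 / 2 ≤ b) (hab : b ≤ a) {N : ℕ} (lam : GT (N + 1)) :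
    HasSum (link a b lam) 1 := by
  have h := normJacobi_snoc hb hab lam (fun _ => 1)
  have e : (Fin.snoc (fun _ : Fin N => (1 : ℝ)) 1 : Fin (N + 1) → ℝ) = fun _ => 1 := by
    funext i
    refine Fin.lastCases ?_ (fun i => ?_) i <;> simp
  rw [e, normJacobi_one hb hab] at h
  simp only [normJacobi_one hb hab, mul_one] at h
  rw [h]
  simp only [← link_eq hb hab]
  exact hasSum_sum_of_ne_finset_zero fun mu hmu => link_eq_zero hb hab hmu

/-! ### Positivity of the links -/

/-- A staircase matrix of zeros and ones has determinant `0` or `1`; the induction removes the first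
row and column. -/
theorem det_le_indicator_nonneg {n : ℕ} (m κ : Fin n → ℕ) (hm : Antitone m) (hκ : Antitone κ) :
    0 ≤ (Matrix.of fun i j : Fin n => if m i ≤ κ j then (1 : ℝ) else 0).det := by
  induction n with
  | zero => simp
  | succ n ih =>
    by_cases h0 : m 0 ≤ κ 0
    · by_cases h1 : ∃ j, j ≠ 0 ∧ m 0 ≤ κ j
      · obtain ⟨j, hj0, hj⟩ := h1
        refine (Matrix.det_zero_of_column_eq hj0 fun i => ?_).ge
        have h2 := hm (Fin.zero_le i)
        simp only [Matrix.of_apply]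
        rw [if_pos (h2.trans hj), if_pos (h2.trans h0)]
      · push Not at h1
        rw [Matrix.det_succ_row_zero, Fin.sum_univ_succ, Finset.sum_eq_zero, add_zero]
        · have h2 := ih (fun i => m i.succ) (fun i => κ i.succ)
            (fun i j hij => hm (Fin.succ_le_succ_iff.2 hij))
            (fun i j hij => hκ (Fin.succ_le_succ_iff.2 hij))
          have e : (Matrix.of fun i j : Fin (n + 1) =>
              if m i ≤ κ j then (1 : ℝ) else 0).submatrix Fin.succ (Fin.succAbove 0) =
              Matrix.of fun i j : Fin n => if m i.succ ≤ κ j.succ then (1 : ℝ) else 0 := by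
            ext i j
            simp
          rw [e]
          simpa [h0] using h2
        · intro j _
          have := h1 j.succ (Fin.succ_ne_zero j)
          simp [not_le.2 this]
    · refine (Matrix.det_eq_zero_of_row_eq_zero 0 fun j => ?_).ge
      have := hκ (Fin.zero_le j)
      simp only [Matrix.of_apply]
      rw [if_neg (by lia)]

/-- The rows are the indicators of consecutive disjoint intervals, so the only permutation that can
contribute to the determinant is the identity. -/
theorem det_interval_indicator_nonneg {n : ℕ} (l : Fin (n + 1) → ℕ) (κ : Fin n → ℕ)
    (hl : Antitone l) (hκ : StrictAnti κ) :
    0 ≤ (Matrix.of fun i j : Fin n =>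
      if l i.succ ≤ κ j ∧ κ j < l i.castSucc then (1 : ℝ) else 0).det := by
  classical
  rw [Matrix.det_apply]
  -- only the identity permutation contributes, because the intervals are ordered
  rw [Finset.sum_eq_single 1]
  · simp only [Equiv.Perm.sign_one, one_smul, Equiv.Perm.coe_one, id, Matrix.of_apply]
    exact Finset.prod_nonneg fun i _ => by split_ifs <;> norm_num
  · intro σ _ hσ
    by_contra hne
    have h1 : ∀ j, l (σ j).succ ≤ κ j ∧ κ j < l (σ j).castSucc := fun j => by
      by_contra hj
      refine hne ?_
      rw [Finset.prod_eq_zero (Finset.mem_univ j), smul_zero]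
      simp only [Matrix.of_apply]
      rw [if_neg hj]
    have h2 : StrictMono σ := by
      refine Monotone.strictMono_of_injective (fun i j hij => ?_) σ.injective
      rcases hij.eq_or_lt with rfl | hij
      · exact le_rfl
      · by_contra hlt
        have h3 : (σ j).succ ≤ (σ i).castSucc := Fin.succ_le_castSucc_iff.2 (not_le.1 hlt)
        have h4 := hl h3
        have h5 := (h1 i).2
        have h6 := (h1 j).1
        have h7 := hκ hij
        lia
    have h3 : ⇑σ = id := (h2.range_inj strictMono_id).1 (by
      rw [σ.surjective.range_eq, Set.range_id])
    exact hσ (Equiv.ext fun i => congrFun h3 i)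
  · simp

/-- Subtracting consecutive rows turns `B(l, m)` into a sum of `1 / (U(k) A_k)` over
`k ≥ m` in an interval between neighbouring coordinates of `λ`. The Andréief identity in `k` writes
the determinant as a positive combination of products of two nonnegative determinants. -/
theorem linkDet_nonneg (hb : -1 / 2 ≤ b) (hab : b ≤ a) {N : ℕ} (lam : GT (N + 1)) (mu : GT N) :
    0 ≤ linkDet a b lam mu := by
  rw [linkDet, det_snoc_one]
  set γ : ℕ → ℝ := fun k => (plancherel a b k * recA a b k)⁻¹ with hγ
  have hγ0 : ∀ k, 0 ≤ γ k := fun k =>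
    (inv_pos.2 (mul_pos (plancherel_pos hb hab k) (recA_pos hb hab k))).le
  have hant := (shifted_strictAnti lam).antitone
  have hsupp : ∀ (i : Fin N) (j : Fin N) k, k ∉ Finset.range (shifted lam 0) →
      (γ k * if shifted lam i.succ ≤ k ∧ k < shifted lam i.castSucc then (1 : ℝ) else 0) *
        (if shifted mu j ≤ k then (1 : ℝ) else 0) = 0 := fun i j k hk => by
    have h1 := hant (Fin.zero_le i.castSucc)
    have h2 : shifted lam 0 ≤ k := by simpa using hk
    rw [if_neg (by lia)]
    simp
  have hentry : ∀ i j : Fin N, branchKernel a b (shifted lam i.castSucc) (shifted mu j) -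
      branchKernel a b (shifted lam i.succ) (shifted mu j) = plancherel a b (shifted mu j) * ∑' k,
      (γ k * if shifted lam i.succ ≤ k ∧ k < shifted lam i.castSucc then (1 : ℝ) else 0) *
        (if shifted mu j ≤ k then (1 : ℝ) else 0) := fun i j => by
    rw [tsum_eq_sum (hsupp i j), branchKernel, branchKernel, ← mul_sub]
    congr 1
    have h0 := hant (Fin.zero_le i.castSucc)
    have h1 := hant (Fin.castSucc_lt_succ (i := i)).le
    have e : ∀ l, l ≤ shifted lam 0 → ∑ k ∈ Finset.Ico (shifted mu j) l, γ k =
        ∑ k ∈ Finset.range (shifted lam 0), if shifted mu j ≤ k ∧ k < l then γ k else 0 :=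
      fun l hl => by
        rw [← Finset.sum_filter]
        congr 1
        ext k
        simp only [Finset.mem_Ico, Finset.mem_filter, Finset.mem_range]
        lia
    rw [e _ h0, e _ (h1.trans h0), ← Finset.sum_sub_distrib]
    refine Finset.sum_congr rfl fun k _ => ?_
    by_cases c1 : shifted mu j ≤ k
    · by_cases c2 : k < shifted lam i.succ
      · have c3 : k < shifted lam i.castSucc := by lia
        simp [c1, c2, c3, not_le.2 c2]
      · by_cases c3 : k < shifted lam i.castSucc <;> simp [c1, c2, c3, not_lt.1 c2]
    · simp [c1]
  simp only [hentry]
  have h2 := Matrix.det_mul_row (fun j => plancherel a b (shifted mu j))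
    (Matrix.of fun i j : Fin N => ∑' k,
      (γ k * if shifted lam i.succ ≤ k ∧ k < shifted lam i.castSucc then (1 : ℝ) else 0) *
        (if shifted mu j ≤ k then (1 : ℝ) else 0))
  simp only [Matrix.of_apply] at h2
  rw [h2]
  refine mul_nonneg (Finset.prod_nonneg fun j _ => (plancherel_pos hb hab _).le) ?_
  have h3 := hasSum_det_mul_det
    (fun (i : Fin N) k => γ k *
      if shifted lam i.succ ≤ k ∧ k < shifted lam i.castSucc then (1 : ℝ) else 0)
    (fun (j : Fin N) k => if shifted mu j ≤ k then (1 : ℝ) else 0)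
    (fun i j => summable_of_ne_finset_zero (s := Finset.range (shifted lam 0)) fun k hk => by
      rw [hsupp i j k hk, norm_zero])
  refine h3.nonneg fun κ => mul_nonneg ?_ ?_
  · have h4 := Matrix.det_mul_row (fun j => γ (shifted κ j)) (Matrix.of fun i j : Fin N =>
      if shifted lam i.succ ≤ shifted κ j ∧ shifted κ j < shifted lam i.castSucc
        then (1 : ℝ) else 0)
    simp only [Matrix.of_apply] at h4
    rw [h4]
    exact mul_nonneg (Finset.prod_nonneg fun j _ => hγ0 _)
      (det_interval_indicator_nonneg _ _ hant (shifted_strictAnti κ))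
  · exact det_le_indicator_nonneg _ _ (shifted_strictAnti mu).antitone
      (shifted_strictAnti κ).antitone

theorem link_nonneg (hb : -1 / 2 ≤ b) (hab : b ≤ a) {N : ℕ} (lam : GT (N + 1)) (mu : GT N) :
    0 ≤ link a b lam mu := by
  rw [link_eq hb hab, linkFormula]
  have h1 := sqVandermonde_pos hb hab mu
  have h2 := sqVandermonde_pos hb hab lam
  have h3 := hypConst_pos (hb.trans hab) N
  have h4 := linkDet_nonneg hb hab lam mu
  positivity

end

end BCZMeasure

namespace BCZMeasure

open Filter Topology Asymptotics

/-! ### The tridiagonal operator applied to the Gamma factor -/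

/-- The discrete flux `U(l) A(l) (φ(l + 1) - φ(l))`, listed under the index `l + 1` and equal to `0`
at the index `0`; its increments are the Jacobi operator applied to `φ`, times the Plancherel
density. -/
def flux (a b : ℝ) (φ : ℕ → ℂ) : ℕ → ℂ
  | 0 => 0
  | l + 1 => (plancherel a b l * recA a b l : ℝ) * (φ (l + 1) - φ l)

section

variable {a b : ℝ}

/-- The constant term of the quadratic polynomial by which the Jacobi operator acts on the Gamma
factor. -/
def opConst (a b : ℝ) (z z' : ℂ) (N : ℕ) : ℂ :=
  (1 - (z + z' + 2 * N + 2 * eps a b)) *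
    (-(eps a b * (a + 1 - eps a b)) * (z + z' + 2 * N + 2 * eps a b) +
      (a + 1) * ((z + N + eps a b) * (z' + N + eps a b)))

/-- The leading coefficient of the quadratic polynomial by which the Jacobi operator acts on the
Gamma factor. -/
def opLead (a b : ℝ) (z z' : ℂ) (N : ℕ) : ℂ :=
  (z + z' + 2 * N + a + b) * (z + z' + 2 * N + b)

/-- The Jacobi operator maps the Gamma factor of level `N` to the Gamma factor of level `N + 1`
times a linear polynomial in `(l + ε) ^ 2`. -/
theorem flux_succ_sub (hb : -1 / 2 ≤ b) (hab : b ≤ a) (z z' : ℂ) (N l : ℕ) :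
    flux a b (gammaFactor (2 * eps a b) z z' N) (l + 1) -
      flux a b (gammaFactor (2 * eps a b) z z' N) l =
    plancherel a b l * gammaFactor (2 * eps a b) z z' (N + 1) l *
      (opLead a b z z' N * ((l : ℂ) + eps a b) ^ 2 + opConst a b z z' N) := by
  cases l with
  | zero =>
    simp only [flux, sub_zero, zero_add]
    have h1 := gammaFactor_succ (2 * eps a b) z z' N 0
    have h0 := gammaFactor_level (2 * eps a b) z z' N 0
    rw [zero_add] at h1
    rw [h1, h0]
    have hA : (recA a b 0 : ℂ) * (a + b + 2) = a + 1 := by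
      have : a + b + 2 ≠ 0 := by linarith
      have h : recA a b 0 * (a + b + 2) = a + 1 := by
        simp only [recA, if_true]
        field_simp
      exact_mod_cast congrArg (fun x : ℝ => (x : ℂ)) h
    generalize gammaFactor (2 * eps a b) z z' (N + 1) 0 = G
    simp only [opLead, opConst, eps]
    push_cast
    linear_combination (-(plancherel a b 0 : ℂ) * G * (z + N) * (z' + N) *
      ((z + z' + 2 * N + a + b))) * hA
  | succ l =>
    simp only [flux]
    rw [← plancherel_succ_mul_recC hb hab l]
    have h1 := gammaFactor_succ (2 * eps a b) z z' N (l + 1)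
    have h0 := gammaFactor_level (2 * eps a b) z z' N (l + 1)
    have h2 := gammaFactor_pred (2 * eps a b) z z' N l
    rw [h1, h0, h2]
    generalize gammaFactor (2 * eps a b) z z' (N + 1) (l + 1) = G
    have hl : (0 : ℝ) ≤ l := l.cast_nonneg
    set n : ℝ := l + 1 with hn
    have e : ((l + 1 : ℕ) : ℝ) = n := by push_cast; rfl
    have e' : (l : ℂ) = (n : ℂ) - 1 := by rw [hn]; push_cast; ring
    have d0 : (2 * n + a + b : ℂ) ≠ 0 := by
      have : 2 * n + a + b ≠ 0 := by rw [hn]; linarith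
      exact_mod_cast this
    have d1 : (2 * n + a + b + 1 : ℂ) ≠ 0 := by
      have : 2 * n + a + b + 1 ≠ 0 := by rw [hn]; linarith
      exact_mod_cast this
    have d2 : (2 * n + a + b + 2 : ℂ) ≠ 0 := by
      have : 2 * n + a + b + 2 ≠ 0 := by rw [hn]; linarith
      exact_mod_cast this
    have hA : (recA a b (l + 1) : ℂ) * ((2 * n + a + b + 1) * (2 * n + a + b + 2)) =
        (n + a + b + 1) * (n + a + 1) := by
      simp only [recA, Nat.succ_ne_zero, if_false, e]
      push_cast
      exact div_mul_cancel₀ _ (mul_ne_zero d1 d2)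
    have hC : (recC a b (l + 1) : ℂ) * ((2 * n + a + b) * (2 * n + a + b + 1)) = n * (n + b) := by
      simp only [recC, e]
      push_cast
      exact div_mul_cancel₀ _ (mul_ne_zero d0 d1)
    simp only [opLead, opConst, eps]
    push_cast
    rw [e']
    generalize (recA a b (l + 1) : ℂ) = α at *
    generalize (recC a b (l + 1) : ℂ) = γ at *
    generalize (n : ℂ) = n at *
    generalize (a : ℂ) = a' at *
    generalize (b : ℂ) = b' at *
    generalize (plancherel a b (l + 1) : ℂ) = U
    generalize hz : z + N = w
    generalize hz' : z' + N = w'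
    obtain rfl : z = w - N := by rw [← hz]; ring
    obtain rfl : z' = w' - N := by rw [← hz']; ring
    refine mul_left_cancel₀ (mul_ne_zero (mul_ne_zero d0 d1) d2) ?_
    linear_combination (2 * n + a' + b') * U * G *
      (((w - n) * (w - n - 1) * ((w' - n) * (w' - n - 1))) -
        ((w - n) * (w' - n) * ((w + n + (a' + b' + 1)) * (w' + n + (a' + b' + 1))))) * hA -
      (2 * n + a' + b' + 2) * U * G *
        (((w - n) * (w' - n) * ((w + n + (a' + b' + 1)) * (w' + n + (a' + b' + 1)))) -
        (((w + n - 1 + (a' + b' + 1)) * (w + n + (a' + b' + 1))) *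
          ((w' + n - 1 + (a' + b' + 1)) * (w' + n + (a' + b' + 1))))) * hC

theorem recC_le_recA (hb : -1 / 2 ≤ b) (hab : b ≤ a) (k : ℕ) :
    recC a b (k + 1) ≤ recA a b (k + 1) := by
  have hk : (0 : ℝ) ≤ k := k.cast_nonneg
  simp only [recA, recC, Nat.succ_ne_zero, if_false]
  push_cast
  set n : ℝ := k + 1 with hn
  have hn1 : 1 ≤ n := by linarith
  have d0 : 0 < 2 * n + a + b := by linarith
  rw [div_le_div_iff₀ (by apply mul_pos <;> linarith) (by apply mul_pos <;> linarith)]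
  have h1 : (n + b) * (2 * n + a + b + 2) ≤ (n + a + 1) * (2 * n + a + b) := by nlinarith
  have h2 : n * ((n + b) * (2 * n + a + b + 2)) ≤
      (n + a + b + 1) * ((n + a + 1) * (2 * n + a + b)) :=
    mul_le_mul (by linarith) h1 (mul_nonneg (by linarith) (by linarith)) (by linarith)
  have h3 := mul_le_mul_of_nonneg_right h2 (by linarith : 0 ≤ 2 * n + a + b + 1)
  linarith

theorem plancherel_mul_recA_mono (hb : -1 / 2 ≤ b) (hab : b ≤ a) :
    Monotone fun k => plancherel a b k * recA a b k := by
  refine monotone_nat_of_le_succ fun k => ?_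
  rw [← plancherel_succ_mul_recC hb hab k]
  exact mul_le_mul_of_nonneg_left (recC_le_recA hb hab k) (plancherel_pos hb hab _).le

theorem branchKernel_nonneg (hb : -1 / 2 ≤ b) (hab : b ≤ a) (l m : ℕ) :
    0 ≤ branchKernel a b l m :=
  mul_nonneg (plancherel_pos hb hab m).le (Finset.sum_nonneg fun k _ =>
    (inv_pos.2 (mul_pos (plancherel_pos hb hab k) (recA_pos hb hab k))).le)

theorem branchKernel_isBigO (hb : -1 / 2 ≤ b) (hab : b ≤ a) (m : ℕ) :
    (fun l => (branchKernel a b l m : ℂ)) =O[atTop] fun l : ℕ => (l : ℝ) ^ (1 : ℝ) := by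
  have h0 : 0 < plancherel a b 0 * recA a b 0 :=
    mul_pos (plancherel_pos hb hab 0) (recA_pos hb hab 0)
  refine IsBigO.of_bound (plancherel a b m * (plancherel a b 0 * recA a b 0)⁻¹)
    (Eventually.of_forall fun l => ?_)
  rw [Complex.norm_real, Real.norm_of_nonneg (branchKernel_nonneg hb hab l m), Real.rpow_one,
    Real.norm_of_nonneg (Nat.cast_nonneg l), mul_assoc]
  refine mul_le_mul_of_nonneg_left ?_ (plancherel_pos hb hab m).le
  calc ∑ k ∈ Finset.Ico m l, (plancherel a b k * recA a b k)⁻¹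
      ≤ ∑ k ∈ Finset.Ico m l, (plancherel a b 0 * recA a b 0)⁻¹ :=
        Finset.sum_le_sum fun k _ => inv_anti₀ h0 (plancherel_mul_recA_mono hb hab (Nat.zero_le k))
    _ = ((l - m : ℕ) : ℝ) * (plancherel a b 0 * recA a b 0)⁻¹ := by simp
    _ ≤ _ := by
        rw [mul_comm]
        refine mul_le_mul_of_nonneg_left ?_ (inv_pos.2 h0).le
        exact_mod_cast Nat.sub_le l m

/-- Summation by parts against the branching kernel. -/
theorem sum_flux_mul_branchKernel (hb : -1 / 2 ≤ b) (hab : b ≤ a) (φ : ℕ → ℂ) (m L : ℕ) :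
    ∑ l ∈ Finset.range L, (flux a b φ (l + 1) - flux a b φ l) * branchKernel a b l m =
      flux a b φ L * branchKernel a b L m - plancherel a b m * (φ (max L m) - φ m) := by
  induction L with
  | zero => simp [flux]
  | succ L ih =>
    rw [Finset.sum_range_succ, ih, branchKernel_succ]
    have h : (plancherel a b L * recA a b L : ℝ) ≠ 0 :=
      (mul_pos (plancherel_pos hb hab L) (recA_pos hb hab L)).ne'
    split_ifs with hm
    · rw [max_eq_left (by lia), max_eq_left (by lia)]
      have h' : ((plancherel a b L * recA a b L : ℝ) : ℂ) *
          ((plancherel a b L * recA a b L : ℝ) : ℂ)⁻¹ = 1 :=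
        mul_inv_cancel₀ (by exact_mod_cast h)
      simp only [flux]
      rw [Complex.ofReal_add, Complex.ofReal_mul (plancherel a b m), Complex.ofReal_inv]
      linear_combination (-(plancherel a b m : ℂ) * (φ (L + 1) - φ L)) * h'
    · rw [max_eq_right (by lia), max_eq_right (by lia)]
      rw [branchKernel_eq_zero _ _ (by lia : L ≤ m)]
      simp

theorem hasSum_flux_mul_branchKernel (hb : -1 / 2 ≤ b) (hab : b ≤ a) {φ : ℕ → ℂ} {m : ℕ}
    (hs : Summable fun l => (flux a b φ (l + 1) - flux a b φ l) * branchKernel a b l m)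
    (hφ : Tendsto φ atTop (𝓝 0))
    (hB : Tendsto (fun l => flux a b φ l * branchKernel a b l m) atTop (𝓝 0)) :
    HasSum (fun l => (flux a b φ (l + 1) - flux a b φ l) * branchKernel a b l m)
      (plancherel a b m * φ m) := by
  rw [hs.hasSum_iff_tendsto_nat]
  simp only [sum_flux_mul_branchKernel hb hab]
  have h1 : Tendsto (fun L => φ (max L m)) atTop (𝓝 0) :=
    hφ.comp (tendsto_atTop_mono (fun L => le_max_left L m) tendsto_id)
  simpa using hB.sub ((h1.sub_const (φ m)).const_mul (plancherel a b m : ℂ))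

theorem hasSum_flux {φ : ℕ → ℂ} (hs : Summable fun l => flux a b φ (l + 1) - flux a b φ l)
    (hB : Tendsto (flux a b φ) atTop (𝓝 0)) :
    HasSum (fun l => flux a b φ (l + 1) - flux a b φ l) 0 := by
  rw [hs.hasSum_iff_tendsto_nat]
  simp only [Finset.sum_range_sub]
  simpa only [flux, sub_zero] using hB.sub_const 0

theorem ofReal_isBigO {f : ℕ → ℝ} {g : ℕ → ℝ} (h : f =O[atTop] g) :
    (fun x => (f x : ℂ)) =O[atTop] g :=
  (h.norm_left.congr_left fun _ => (Complex.norm_real _).symm).of_norm_left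

theorem isBigO_rpow_mul {f g : ℕ → ℂ} {p q : ℝ} (hf : f =O[atTop] fun x : ℕ => (x : ℝ) ^ p)
    (hg : g =O[atTop] fun x : ℕ => (x : ℝ) ^ q) :
    (fun x => f x * g x) =O[atTop] fun x : ℕ => (x : ℝ) ^ (p + q) := by
  refine (hf.mul hg).congr' EventuallyEq.rfl ?_
  filter_upwards [eventually_gt_atTop 0] with x hx
  rw [← Real.rpow_add (by exact_mod_cast hx)]

theorem isBigO_rpow_shift {f : ℕ → ℂ} {p : ℝ} (hf : f =O[atTop] fun x : ℕ => (x : ℝ) ^ p) :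
    (fun x => f (x + 1)) =O[atTop] fun x : ℕ => (x : ℝ) ^ p := by
  refine (hf.comp_tendsto (tendsto_add_atTop_nat 1)).trans ?_
  refine IsBigO.of_bound ((2 : ℝ) ^ |p|) ?_
  filter_upwards [eventually_ge_atTop 1] with x hx
  have hx0 : (0 : ℝ) < x := by exact_mod_cast hx
  have hx1 : (1 : ℝ) ≤ x := by exact_mod_cast hx
  simp only [Function.comp_apply, Nat.cast_add, Nat.cast_one]
  rw [Real.norm_of_nonneg (by positivity), Real.norm_of_nonneg (by positivity)]
  have h2 : ((x : ℝ) + 1) ^ p = ((x + 1) / x) ^ p * (x : ℝ) ^ p := by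
    rw [← Real.mul_rpow (by positivity) (by positivity), div_mul_cancel₀ _ hx0.ne']
  rw [h2]
  refine mul_le_mul_of_nonneg_right ?_ (by positivity)
  have h3 : 1 ≤ ((x : ℝ) + 1) / x := by rw [le_div_iff₀ hx0]; linarith
  have h4 : ((x : ℝ) + 1) / x ≤ 2 := by rw [div_le_iff₀ hx0]; linarith
  calc (((x : ℝ) + 1) / x) ^ p ≤ (((x : ℝ) + 1) / x) ^ |p| :=
      Real.rpow_le_rpow_of_exponent_le h3 (le_abs_self p)
    _ ≤ _ := Real.rpow_le_rpow (by positivity) h4 (abs_nonneg p)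

theorem recA_isBigO (hb : -1 / 2 ≤ b) (hab : b ≤ a) :
    (fun n => recA a b n) =O[atTop] fun n : ℕ => (n : ℝ) ^ (0 : ℝ) := by
  refine IsBigO.of_bound (a + 2) ?_
  filter_upwards [eventually_ne_atTop 0] with n hn
  have hn1 : (1 : ℝ) ≤ n := by exact_mod_cast Nat.one_le_iff_ne_zero.2 hn
  rw [Real.norm_of_nonneg (recA_pos hb hab n).le, Real.rpow_zero, norm_one, mul_one, recA,
    if_neg hn]
  rw [div_le_iff₀ (by apply mul_pos <;> linarith)]
  have h1 : (n : ℝ) + a + b + 1 ≤ 2 * n + a + b + 1 := by linarith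
  have h2 : (n : ℝ) + a + 1 ≤ (a + 2) * (2 * n + a + b + 2) := by nlinarith
  calc ((n : ℝ) + a + b + 1) * (n + a + 1)
      ≤ (2 * n + a + b + 1) * ((a + 2) * (2 * n + a + b + 2)) :=
        mul_le_mul h1 h2 (by linarith) (by linarith)
    _ = _ := by ring

theorem flux_isBigO (hb : -1 / 2 ≤ b) (hab : b ≤ a) (z z' : ℂ) (N : ℕ) :
    flux a b (gammaFactor (2 * eps a b) z z' N) =O[atTop]
      fun x : ℕ => (x : ℝ) ^ (1 - 2 * (z + z' + b).re - 4 * N) := by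
  have h1 := gammaFactor_isBigO (2 * eps a b) z z' N
  have h2 := (isBigO_rpow_shift h1).sub h1
  have h3 := isBigO_rpow_mul (isBigO_rpow_mul (ofReal_isBigO (plancherel_isBigO a b))
    (ofReal_isBigO (recA_isBigO hb hab))) h2
  rw [show 2 * a + 1 + 0 + (2 - 2 * (z + z').re - 4 * N - 2 * (2 * eps a b)) =
    1 - 2 * (z + z' + b).re - 4 * N by simp [eps]; ring] at h3
  have h4 : (fun l => flux a b (gammaFactor (2 * eps a b) z z' N) (l + 1)) =O[atTop]
      fun x : ℕ => (x : ℝ) ^ (1 - 2 * (z + z' + b).re - 4 * N) := by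
    refine h3.congr_left fun x => ?_
    simp only [flux]
    push_cast
    ring
  set p := 1 - 2 * (z + z' + b).re - 4 * N
  -- undo the index shift
  have h5 : (fun x : ℕ => (x : ℝ) ^ p) =O[atTop] fun x : ℕ => ((x + 1 : ℕ) : ℝ) ^ p := by
    refine IsBigO.of_bound ((2 : ℝ) ^ |p|) ?_
    filter_upwards [eventually_ge_atTop 1] with x hx
    have hx0 : (0 : ℝ) < x := by exact_mod_cast hx
    have hx1 : (1 : ℝ) ≤ x := by exact_mod_cast hx
    simp only [Nat.cast_add, Nat.cast_one]
    rw [Real.norm_of_nonneg (by positivity), Real.norm_of_nonneg (by positivity)]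
    have h2 : (x : ℝ) ^ p = ((x + 1) / x) ^ (-p) * ((x : ℝ) + 1) ^ p := by
      rw [Real.rpow_neg (by positivity), Real.div_rpow (by positivity) (by positivity)]
      have : (0 : ℝ) < ((x : ℝ) + 1) ^ p := by positivity
      field_simp
    nth_rewrite 1 [h2]
    refine mul_le_mul_of_nonneg_right ?_ (by positivity)
    have h3 : 1 ≤ ((x : ℝ) + 1) / x := by rw [le_div_iff₀ hx0]; linarith
    have h4 : ((x : ℝ) + 1) / x ≤ 2 := by rw [div_le_iff₀ hx0]; linarith
    calc (((x : ℝ) + 1) / x) ^ (-p) ≤ (((x : ℝ) + 1) / x) ^ |p| :=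
        Real.rpow_le_rpow_of_exponent_le h3 (neg_le_abs p)
      _ ≤ _ := Real.rpow_le_rpow (by positivity) h4 (abs_nonneg p)
  have h6 := (h4.trans h5)
  rw [isBigO_iff] at h6 ⊢
  obtain ⟨c, hc⟩ := h6
  obtain ⟨M, hM⟩ := eventually_atTop.1 hc
  refine ⟨c, eventually_atTop.2 ⟨M + 1, fun x hx => ?_⟩⟩
  obtain ⟨y, rfl⟩ : ∃ y, x = y + 1 := ⟨x - 1, by lia⟩
  exact hM y (by lia)

end

end BCZMeasure

namespace BCZMeasure

open Filter Topology Asymptotics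

/-! ### Coherence of the unnormalized z-measures -/

section

variable {a b : ℝ}

/-- The monic polynomial `∏_{i < j} (X - (z + N - 1 - i + ε)²)`; its value at `(x + ε)²` is up to
sign the ratio of the Gamma factors with the parameters `z - j` and `z`. -/
def lowerPoly (a b : ℝ) (z : ℂ) (N j : ℕ) : Polynomial ℂ :=
  ∏ i ∈ Finset.range j, (Polynomial.X - Polynomial.C ((z + N - 1 - i + eps a b) ^ 2))

theorem lowerPoly_monic (a b : ℝ) (z : ℂ) (N j : ℕ) : (lowerPoly a b z N j).Monic :=
  Polynomial.monic_prod_of_monic _ _ fun _ _ => Polynomial.monic_X_sub_C _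

theorem lowerPoly_natDegree (a b : ℝ) (z : ℂ) (N j : ℕ) : (lowerPoly a b z N j).natDegree = j := by
  rw [lowerPoly, Polynomial.natDegree_prod_of_monic _ _ fun _ _ => Polynomial.monic_X_sub_C _]
  simp only [Polynomial.natDegree_X_sub_C]
  simp

theorem gammaFactor_sub_nat (a b : ℝ) (z z' : ℂ) (N j x : ℕ) :
    gammaFactor (2 * eps a b) (z - j) z' N x = (-1) ^ j * (gammaFactor (2 * eps a b) z z' N x *
      (lowerPoly a b z N j).eval (((x : ℂ) + eps a b) ^ 2)) := by
  induction j with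
  | zero => simp [lowerPoly]
  | succ j ih =>
    have h := gammaFactor_sub_one (2 * eps a b) (z - j) z' N x
    have h' : lowerPoly a b z N (j + 1) = lowerPoly a b z N j *
        (Polynomial.X - Polynomial.C ((z + N - 1 - j + eps a b) ^ 2)) := Finset.prod_range_succ _ _
    rw [show z - (j + 1 : ℕ) = z - j - 1 by push_cast; ring, h, ih, h', Polynomial.eval_mul]
    simp only [Polynomial.eval_sub, Polynomial.eval_X, Polynomial.eval_C]
    push_cast
    ring

/-- The polynomials `Q_0 = 1` and `Q_{j + 1}`, the images under the Jacobi operator of the Gamma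
factors with parameters `z - j`, `z'`, in monic normalization. -/
def imagePoly (a b : ℝ) (z z' : ℂ) (N : ℕ) : ℕ → Polynomial ℂ
  | 0 => 1
  | j + 1 => lowerPoly a b z (N + 1) j *
      (Polynomial.X + Polynomial.C (opConst a b (z - j) z' N / opLead a b (z - j) z' N))

theorem imagePoly_monic (a b : ℝ) (z z' : ℂ) (N j : ℕ) : (imagePoly a b z z' N j).Monic := by
  cases j with
  | zero => exact Polynomial.monic_one
  | succ j => exact (lowerPoly_monic _ _ _ _ _).mul (Polynomial.monic_X_add_C _)

theorem imagePoly_natDegree (a b : ℝ) (z z' : ℂ) (N j : ℕ) :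
    (imagePoly a b z z' N j).natDegree = j := by
  cases j with
  | zero => simp [imagePoly]
  | succ j =>
    rw [imagePoly, (lowerPoly_monic _ _ _ _ _).natDegree_mul (Polynomial.monic_X_add_C _),
      lowerPoly_natDegree, Polynomial.natDegree_X_add_C]

theorem opLead_ne_zero (hb : -1 / 2 ≤ b) (hab : b ≤ a) {z z' : ℂ} (hσ : -1 < (z + z' + b).re)
    {N j : ℕ} (hj : j < N) : opLead a b (z - j) z' N ≠ 0 := by
  have h1 : (j : ℝ) + 1 ≤ N := by exact_mod_cast hj
  have h2 : (0 : ℝ) ≤ j := j.cast_nonneg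
  simp only [Complex.add_re, Complex.ofReal_re] at hσ
  refine mul_ne_zero (fun h => ?_) (fun h => ?_)
  · have := congrArg Complex.re h
    simp at this
    linarith
  · have := congrArg Complex.re h
    simp at this
    linarith

/-- The image under the Jacobi operator of the Gamma factor with parameters `z - j`, `z'`, in terms
of the weight of the next level. -/
theorem flux_sub_eq (hb : -1 / 2 ≤ b) (hab : b ≤ a) {z z' : ℂ} (hσ : -1 < (z + z' + b).re)
    {N j : ℕ} (hj : j < N) (l : ℕ) :
    flux a b (gammaFactor (2 * eps a b) (z - j) z' N) (l + 1) -
      flux a b (gammaFactor (2 * eps a b) (z - j) z' N) l =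
    (-1) ^ j * opLead a b (z - j) z' N * (weight a b z z' (N + 1) l *
      (imagePoly a b z z' N (j + 1)).eval (((l : ℂ) + eps a b) ^ 2)) := by
  have h := opLead_ne_zero hb hab hσ hj
  rw [flux_succ_sub hb hab, gammaFactor_sub_nat, weight_eq, imagePoly]
  simp only [Polynomial.eval_mul, Polynomial.eval_add, Polynomial.eval_X, Polynomial.eval_C]
  generalize opLead a b (z - j) z' N = L at *
  generalize opConst a b (z - j) z' N = K
  have : L * (K / L) = K := mul_div_cancel₀ _ h
  linear_combination (-(-1) ^ j * plancherel a b l * gammaFactor (2 * eps a b) z z' (N + 1) l *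
    (lowerPoly a b z (N + 1) j).eval (((l : ℂ) + eps a b) ^ 2)) * this

theorem sq_add_eps_isBigO (a b : ℝ) :
    (fun x : ℕ => ((x : ℂ) + eps a b) ^ 2) =O[atTop] fun x : ℕ => (x : ℝ) ^ (2 : ℝ) := by
  have h : (fun x : ℕ => (x : ℂ) + eps a b) =O[atTop] fun x : ℕ => (x : ℝ) := by
    refine IsBigO.of_bound (1 + |eps a b|) ?_
    filter_upwards [eventually_ge_atTop 1] with x hx
    have h1 : (1 : ℝ) ≤ x := by exact_mod_cast hx
    refine (norm_add_le _ _).trans ?_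
    rw [Complex.norm_natCast, Complex.norm_real, Real.norm_eq_abs,
      Real.norm_of_nonneg (by positivity),
      add_mul, one_mul]
    exact add_le_add_right (le_mul_of_one_le_right (abs_nonneg _) h1) _
  refine (h.pow 2).congr_right fun x => ?_
  rw [Real.rpow_ofNat]

theorem eval_sq_isBigO (a b : ℝ) (p : Polynomial ℂ) :
    (fun x : ℕ => p.eval (((x : ℂ) + eps a b) ^ 2)) =O[atTop]
      fun x : ℕ => (x : ℝ) ^ (2 * p.natDegree : ℝ) := by
  have h : ∀ x : ℕ, p.eval (((x : ℂ) + eps a b) ^ 2) =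
      ∑ i ∈ Finset.range (p.natDegree + 1), p.coeff i * (((x : ℂ) + eps a b) ^ 2) ^ i :=
    fun x => Polynomial.eval_eq_sum_range _
  simp only [h]
  refine IsBigO.fun_sum fun i hi => ?_
  refine (((sq_add_eps_isBigO a b).pow i).const_mul_left (p.coeff i)).trans ?_
  refine IsBigO.of_bound 1 ?_
  filter_upwards [eventually_ge_atTop 1] with x hx
  have h1 : (1 : ℝ) ≤ x := by exact_mod_cast hx
  rw [one_mul, Real.norm_of_nonneg (by positivity), Real.norm_of_nonneg (by positivity),
    ← Real.rpow_natCast, ← Real.rpow_mul (by positivity)]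
  refine Real.rpow_le_rpow_of_exponent_le h1 ?_
  have : (i : ℝ) ≤ p.natDegree := by exact_mod_cast Finset.mem_range_succ_iff.1 hi
  linarith

/-- Decay of the weight times a polynomial of degree at most `N` in `(x + ε)²`. -/
theorem weight_mul_imagePoly_isBigO (a b : ℝ) (z z' : ℂ) {N j : ℕ} (hj : j ≤ N) :
    (fun x : ℕ => weight a b z z' (N + 1) x *
      (imagePoly a b z z' N j).eval (((x : ℂ) + eps a b) ^ 2)) =O[atTop]
      fun x : ℕ => (x : ℝ) ^ (-3 - 2 * (z + z' + b).re - 2 * N) := by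
  have h1 := isBigO_rpow_mul (weight_isBigO a b z z' (N + 1))
    (eval_sq_isBigO a b (imagePoly a b z z' N j))
  refine h1.trans (IsBigO.of_bound 1 ?_)
  filter_upwards [eventually_ge_atTop 1] with x hx
  have hx1 : (1 : ℝ) ≤ x := by exact_mod_cast hx
  rw [one_mul, Real.norm_of_nonneg (by positivity), Real.norm_of_nonneg (by positivity)]
  refine Real.rpow_le_rpow_of_exponent_le hx1 ?_
  rw [imagePoly_natDegree]
  have : (j : ℝ) ≤ N := by exact_mod_cast hj
  push_cast
  linarith

theorem summable_weight_mul_imagePoly {z z' : ℂ} (hσ : -1 < (z + z' + b).re) {N j : ℕ}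
    (hj : j ≤ N) : Summable fun x : ℕ => weight a b z z' (N + 1) x *
      (imagePoly a b z z' N j).eval (((x : ℂ) + eps a b) ^ 2) :=
  isBigO_rpow_summable (weight_mul_imagePoly_isBigO a b z z' hj)
    (by have : (0 : ℝ) ≤ N := N.cast_nonneg
        linarith)

theorem summable_weight_mul_imagePoly_mul_branchKernel (hb : -1 / 2 ≤ b) (hab : b ≤ a) {z z' : ℂ}
    (hσ : -1 < (z + z' + b).re) {N j : ℕ} (hN : 1 ≤ N) (hj : j ≤ N) (m : ℕ) :
    Summable fun x : ℕ => (weight a b z z' (N + 1) x *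
      (imagePoly a b z z' N j).eval (((x : ℂ) + eps a b) ^ 2)) * branchKernel a b x m :=
  isBigO_rpow_summable (isBigO_rpow_mul (weight_mul_imagePoly_isBigO a b z z' hj)
    (branchKernel_isBigO hb hab m))
    (by have : (1 : ℝ) ≤ N := by exact_mod_cast hN
        linarith)

theorem tendsto_flux_mul_branchKernel (hb : -1 / 2 ≤ b) (hab : b ≤ a) {z z' : ℂ}
    (hσ : -1 < (z + z' + b).re) {N j : ℕ} (hj : j < N) (m : ℕ) :
    Tendsto (fun l => flux a b (gammaFactor (2 * eps a b) (z - j) z' N) l * branchKernel a b l m)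
      atTop (𝓝 0) := by
  have h1 : (j : ℝ) + 1 ≤ N := by exact_mod_cast hj
  have h2 : (0 : ℝ) ≤ j := j.cast_nonneg
  refine isBigO_rpow_tendsto_zero (isBigO_rpow_mul (flux_isBigO hb hab (z - j) z' N)
    (branchKernel_isBigO hb hab m)) ?_
  simp at hσ ⊢
  linarith

theorem tendsto_flux (hb : -1 / 2 ≤ b) (hab : b ≤ a) {z z' : ℂ}
    (hσ : -1 < (z + z' + b).re) {N j : ℕ} (hj : j < N) :
    Tendsto (flux a b (gammaFactor (2 * eps a b) (z - j) z' N)) atTop (𝓝 0) := by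
  have h1 : (j : ℝ) + 1 ≤ N := by exact_mod_cast hj
  have h2 : (0 : ℝ) ≤ j := j.cast_nonneg
  refine isBigO_rpow_tendsto_zero (flux_isBigO hb hab (z - j) z' N) ?_
  simp at hσ ⊢
  linarith

theorem tendsto_gammaFactor (hb : -1 / 2 ≤ b) (hab : b ≤ a) {z z' : ℂ}
    (hσ : -1 < (z + z' + b).re) {N j : ℕ} (hj : j < N) :
    Tendsto (gammaFactor (2 * eps a b) (z - j) z' N) atTop (𝓝 0) := by
  have h1 : (j : ℝ) + 1 ≤ N := by exact_mod_cast hj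
  have h2 : (0 : ℝ) ≤ j := j.cast_nonneg
  refine isBigO_rpow_tendsto_zero (gammaFactor_isBigO (2 * eps a b) (z - j) z' N) ?_
  simp [eps] at hσ ⊢
  linarith

theorem tsum_weight_mul_imagePoly (hb : -1 / 2 ≤ b) (hab : b ≤ a) {z z' : ℂ}
    (hσ : -1 < (z + z' + b).re) {N j : ℕ} (hj : j < N) :
    ∑' x : ℕ, weight a b z z' (N + 1) x *
      (imagePoly a b z z' N (j + 1)).eval (((x : ℂ) + eps a b) ^ 2) = 0 := by
  have h0 := summable_weight_mul_imagePoly (a := a) hσ (Nat.succ_le_of_lt hj)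
  have h1 : Summable fun l => flux a b (gammaFactor (2 * eps a b) (z - j) z' N) (l + 1) -
      flux a b (gammaFactor (2 * eps a b) (z - j) z' N) l := by
    simp only [flux_sub_eq hb hab hσ hj]
    exact h0.mul_left _
  have h2 := hasSum_flux h1 (tendsto_flux hb hab hσ hj)
  simp only [flux_sub_eq hb hab hσ hj] at h2
  have h3 := (h0.hasSum.mul_left _).unique h2
  exact (mul_eq_zero.1 h3).resolve_left
    (mul_ne_zero (pow_ne_zero _ (by norm_num)) (opLead_ne_zero hb hab hσ hj))

theorem tsum_weight_mul_imagePoly_mul_branchKernel (hb : -1 / 2 ≤ b) (hab : b ≤ a) {z z' : ℂ}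
    (hσ : -1 < (z + z' + b).re) {N j : ℕ} (hj : j < N) (m : ℕ) :
    ∑' x : ℕ, (weight a b z z' (N + 1) x *
      (imagePoly a b z z' N (j + 1)).eval (((x : ℂ) + eps a b) ^ 2)) * branchKernel a b x m =
    (opLead a b (z - j) z' N)⁻¹ * (weight a b z z' N m *
      (lowerPoly a b z N j).eval (((m : ℂ) + eps a b) ^ 2)) := by
  have h0 := summable_weight_mul_imagePoly_mul_branchKernel hb hab hσ (by lia : 1 ≤ N)
    (Nat.succ_le_of_lt hj) m
  have h1 : Summable fun l => (flux a b (gammaFactor (2 * eps a b) (z - j) z' N) (l + 1) -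
      flux a b (gammaFactor (2 * eps a b) (z - j) z' N) l) * branchKernel a b l m := by
    simp only [flux_sub_eq hb hab hσ hj, mul_assoc]
    simp only [mul_assoc] at h0
    exact (h0.mul_left _).mul_left _
  have h2 := hasSum_flux_mul_branchKernel hb hab h1 (tendsto_gammaFactor hb hab hσ hj)
    (tendsto_flux_mul_branchKernel hb hab hσ hj m)
  simp only [flux_sub_eq hb hab hσ hj] at h2
  have h3 := (h0.hasSum.mul_left ((-1) ^ j * opLead a b (z - j) z' N)).unique
    (by simpa only [mul_assoc] using h2)
  have h4 := opLead_ne_zero hb hab hσ hj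
  have h5 : ((-1 : ℂ) ^ j) ≠ 0 := pow_ne_zero _ (by norm_num)
  rw [gammaFactor_sub_nat] at h3
  rw [eq_inv_mul_iff_mul_eq₀ h4]
  refine mul_left_cancel₀ h5 ?_
  rw [← mul_assoc, h3, weight_eq]
  ring

end

section

variable {a b : ℝ}

/-- The determinantal sum over the upper level. The functions `W_{N+1} Q_j` span the same space as
`W_{N+1}` times the even polynomials of `x + ε` of degree at most `2N`, so their determinant is a
Vandermonde product; the Andréief identity then reduces the sum over signatures to the sums of the
preceding lemmas. -/
theorem hasSum_weight_mul_linkDet (hb : -1 / 2 ≤ b) (hab : b ≤ a) {z z' : ℂ}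
    (hσ : -1 < (z + z' + b).re) (N : ℕ) (mu : GT N) :
    HasSum (fun lam : GT (N + 1) => (∏ i, weight a b z z' (N + 1) (shifted lam i)) *
        (sqVandermonde a b lam : ℂ) * (linkDet a b lam mu : ℂ))
      ((∑' x, weight a b z z' (N + 1) x) * (∏ j ∈ Finset.range N, opLead a b (z - j) z' N)⁻¹ *
        ((∏ i, weight a b z z' N (shifted mu i)) * (sqVandermonde a b mu : ℂ))) := by
  set Φ : Fin (N + 1) → ℕ → ℂ := fun i l => weight a b z z' (N + 1) l *
    (imagePoly a b z z' N (i.rev : ℕ)).eval (((l : ℂ) + eps a b) ^ 2) with hΦ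
  set Ψ : Fin (N + 1) → ℕ → ℂ := fun j l =>
    (Fin.snoc (fun j => (branchKernel a b l (shifted mu j) : ℂ)) 1 : Fin (N + 1) → ℂ) j with hΨ
  have hrev : ∀ i : Fin (N + 1), (i.rev : ℕ) ≤ N := fun i => Nat.lt_succ_iff.1 i.rev.2
  have hr : ∀ i : Fin N, (i.castSucc.rev : ℕ) = (i.rev : ℕ) + 1 := fun i => by
    rw [Fin.rev_castSucc]; rfl
  have hsum := hasSum_det_mul_det Φ Ψ (fun i j => by
    refine Summable.norm ?_
    refine Fin.lastCases ?_ (fun j => ?_) j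
    · simpa [hΦ, hΨ] using summable_weight_mul_imagePoly (a := a) hσ (hrev i)
    · simpa [hΦ, hΨ] using summable_weight_mul_imagePoly_mul_branchKernel hb hab hσ
        (by have := j.2; lia) (hrev i) (shifted mu j))
  have hdet1 : ∀ {n : ℕ} (lam : GT n) (w : ℕ → ℂ) (q : ℕ → Polynomial ℂ)
      (_ : ∀ k, (q k).natDegree = k) (_ : ∀ k, (q k).Monic),
      (Matrix.of fun i j => w (shifted lam j) * (q ((i : Fin n).rev : ℕ)).eval
        (((shifted lam j : ℂ) + eps a b) ^ 2)).det =
      (∏ i, w (shifted lam i)) * (sqVandermonde a b lam : ℂ) := by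
    intro n lam w q h1 h2
    have h3 := Matrix.det_mul_row (fun j => w (shifted lam j)) (Matrix.of fun i j =>
      (q ((i : Fin n).rev : ℕ)).eval (((shifted lam j : ℂ) + eps a b) ^ 2))
    simp only [Matrix.of_apply] at h3
    rw [h3, ← Matrix.det_transpose]
    have h4 := det_eval_rev_eq_prod q h1 h2 fun i => ((shifted lam i : ℂ) + eps a b) ^ 2
    congr 1
    refine Eq.trans ?_ (h4.trans ?_)
    · rfl
    · simp [sqVandermonde, sqShift]
  have hdet2 : ∀ lam : GT (N + 1), (Matrix.of fun i j => Ψ i (shifted lam j)).det =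
      (linkDet a b lam mu : ℂ) := fun lam => by
    rw [← Matrix.det_transpose, linkDet, ← Complex.ofRealHom_eq_coe, RingHom.map_det]
    congr 1
    ext i j
    refine Fin.lastCases ?_ (fun j => ?_) j <;> simp [hΨ]
  have hS : (Matrix.of fun i j => ∑' l, Φ i l * Ψ j l).det =
      (∑' x, weight a b z z' (N + 1) x) * (∏ j ∈ Finset.range N, opLead a b (z - j) z' N)⁻¹ *
        ((∏ i, weight a b z z' N (shifted mu i)) * (sqVandermonde a b mu : ℂ)) := by
    rw [Matrix.det_succ_column _ (Fin.last N), Fin.sum_univ_castSucc, Finset.sum_eq_zero, zero_add]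
    · have e1 : ∑' l, Φ (Fin.last N) l * Ψ (Fin.last N) l = ∑' x, weight a b z z' (N + 1) x := by
        refine tsum_congr fun l => ?_
        simp [hΦ, hΨ, imagePoly]
      have e2 : (Matrix.of fun i j => ∑' l, Φ i l * Ψ j l).submatrix (Fin.last N).succAbove
          (Fin.last N).succAbove = Matrix.of fun i j : Fin N =>
          (opLead a b (z - (i.rev : ℕ)) z' N)⁻¹ * (weight a b z z' N (shifted mu j) *
            (lowerPoly a b z N (i.rev : ℕ)).eval (((shifted mu j : ℂ) + eps a b) ^ 2)) := by
        ext i j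
        simp only [Matrix.submatrix_apply, Matrix.of_apply, Fin.succAbove_last]
        rw [← tsum_weight_mul_imagePoly_mul_branchKernel hb hab hσ i.rev.2]
        refine tsum_congr fun l => ?_
        simp only [hΦ, hΨ, hr, Fin.snoc_castSucc]
      rw [e2]
      have h3 := Matrix.det_mul_column (fun i : Fin N => (opLead a b (z - (i.rev : ℕ)) z' N)⁻¹)
        (Matrix.of fun i j : Fin N => (weight a b z z' N (shifted mu j) *
            (lowerPoly a b z N (i.rev : ℕ)).eval (((shifted mu j : ℂ) + eps a b) ^ 2)))
      simp only [Matrix.of_apply] at h3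
      rw [h3, hdet1 mu _ _ (lowerPoly_natDegree a b z N) (lowerPoly_monic a b z N)]
      have e3 : ∏ i : Fin N, (opLead a b (z - (i.rev : ℕ)) z' N)⁻¹ =
          (∏ j ∈ Finset.range N, opLead a b (z - j) z' N)⁻¹ := by
        rw [Finset.prod_range, ← Finset.prod_inv_distrib]
        exact Equiv.prod_comp Fin.revPerm fun j : Fin N => (opLead a b (z - (j : ℕ)) z' N)⁻¹
      rw [e3, Matrix.of_apply, e1]
      have e4 : (-1 : ℂ) ^
          (((Fin.last N : Fin (N + 1)) : ℕ) + (Fin.last N : Fin (N + 1))) = 1 := by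
        rw [← two_mul, pow_mul]; simp
      rw [e4]
      ring
    · intro i _
      have : ∑' l, Φ i.castSucc l * Ψ (Fin.last N) l = 0 := by
        rw [← tsum_weight_mul_imagePoly hb hab hσ i.rev.2]
        refine tsum_congr fun l => ?_
        simp only [hΦ, hΨ, hr, Fin.snoc_last, mul_one]
      rw [Matrix.of_apply, this]
      simp
  rw [hS] at hsum
  have e : (fun lam : GT (N + 1) => (Matrix.of fun i j => Φ i (shifted lam j)).det *
      (Matrix.of fun i j => Ψ i (shifted lam j)).det) = fun lam =>
      (∏ i, weight a b z z' (N + 1) (shifted lam i)) * (sqVandermonde a b lam : ℂ) *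
        (linkDet a b lam mu : ℂ) := funext fun lam => by
    rw [hdet2]
    exact congrArg (· * _)
      (hdet1 lam _ _ (imagePoly_natDegree a b z z' N) (imagePoly_monic a b z z' N))
  rw [e] at hsum
  exact hsum

end

end BCZMeasure

namespace BCZMeasure

open Filter Topology
open scoped ComplexOrder

/-! ### Positivity of the weights -/

section

/-- The sign of `Γ` is constant between consecutive integers. -/
theorem Gamma_mul_Gamma_pos (n : ℕ) : ∀ (m : ℤ) (x y : ℝ), -(n : ℤ) ≤ m → m < x → x < m + 1 →
    m < y → y < m + 1 → 0 < Real.Gamma x * Real.Gamma y := by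
  induction n with
  | zero =>
    intro m x y hm hx _ hy _
    have h : (0 : ℝ) ≤ m := by exact_mod_cast (by simpa using hm)
    exact mul_pos (Real.Gamma_pos_of_pos (by linarith)) (Real.Gamma_pos_of_pos (by linarith))
  | succ n ih =>
    intro m x y hm hx hx' hy hy'
    have h := ih (m + 1) (x + 1) (y + 1) (by push_cast at hm; lia) (by push_cast; linarith)
      (by push_cast; linarith) (by push_cast; linarith) (by push_cast; linarith)
    have hxy : 0 < x * y := by
      rcases le_or_gt 0 m with h0 | h0
      · have : (0 : ℝ) ≤ m := by exact_mod_cast h0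
        exact mul_pos (by linarith) (by linarith)
      · have : (m : ℝ) + 1 ≤ 0 := by exact_mod_cast h0
        exact mul_pos_of_neg_of_neg (by linarith) (by linarith)
    have hx0 : x ≠ 0 := left_ne_zero_of_mul hxy.ne'
    have hy0 : y ≠ 0 := right_ne_zero_of_mul hxy.ne'
    rw [Real.Gamma_add_one hx0, Real.Gamma_add_one hy0] at h
    have : x * Real.Gamma x * (y * Real.Gamma y) = x * y * (Real.Gamma x * Real.Gamma y) := by ring
    rw [this] at h
    exact (mul_pos_iff_of_pos_left hxy).1 h

/-- The union of the two series is stable under simultaneous integer shifts, and the product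
`Γ(z) Γ(z')` is positive on it. -/
theorem inv_Gamma_mul_inv_Gamma_pos {p : ℂ × ℂ} (hp : p ∈ Zprinc ∪ Zcompl) (k : ℤ) :
    0 < (Complex.Gamma (p.1 + k))⁻¹ * (Complex.Gamma (p.2 + k))⁻¹ := by
  rw [← mul_inv]
  suffices h : 0 < Complex.Gamma (p.1 + k) * Complex.Gamma (p.2 + k) from RCLike.inv_pos.2 h
  rcases hp with ⟨h1, h2⟩ | ⟨⟨h1, h2⟩, m, ⟨h3, h4⟩, h5, h6⟩
  · have h3 : p.2 + k = (starRingEnd ℂ) (p.1 + k) := by rw [h2]; simp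
    have h4 : p.1.im ≠ 0 := fun h => h1 ⟨h, by rw [h2]; simp [h]⟩
    rw [h3, Complex.Gamma_conj, Complex.mul_conj]
    have h5 : Complex.Gamma (p.1 + k) ≠ 0 := Complex.Gamma_ne_zero fun m h => h4 (by
      have := congrArg Complex.im h
      simpa using this)
    exact_mod_cast Complex.normSq_pos.2 h5
  · have e1 : p.1 + k = ((p.1.re + k : ℝ) : ℂ) := Complex.ext (by simp) (by simp [h1])
    have e2 : p.2 + k = ((p.2.re + k : ℝ) : ℂ) := Complex.ext (by simp) (by simp [h2])
    rw [e1, e2, Complex.Gamma_ofReal, Complex.Gamma_ofReal]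
    have := Gamma_mul_Gamma_pos (m + k).natAbs (m + k) (p.1.re + k) (p.2.re + k) (by lia)
      (by push_cast; linarith) (by push_cast; linarith) (by push_cast; linarith)
      (by push_cast; linarith)
    exact_mod_cast this

end

section

variable {a b : ℝ} {z z' : ℂ}

theorem gammaFactor_pos (hz : (z, z') ∈ admissible a b) (N x : ℕ) :
    0 < gammaFactor (2 * eps a b) z z' N x := by
  have h1 := inv_Gamma_mul_inv_Gamma_pos hz.1 ((N : ℤ) - x)
  have h2 := inv_Gamma_mul_inv_Gamma_pos hz.2.1 ((N : ℤ) + x)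
  have h3 := mul_pos h1 h2
  simp only [gammaFactor]
  convert h3 using 4
  all_goals push_cast; ring_nf

theorem weight_pos (hb : -1 / 2 ≤ b) (hab : b ≤ a) (hz : (z, z') ∈ admissible a b) (N x : ℕ) :
    0 < weight a b z z' N x := by
  rw [weight_eq]
  exact mul_pos (by exact_mod_cast plancherel_pos hb hab x) (gammaFactor_pos hz N x)

theorem admissible_im (hz : (z, z') ∈ admissible a b) : (z + z').im = 0 := by
  rcases hz.1 with ⟨_, h2⟩ | ⟨⟨h1, h2⟩, _⟩
  · simp only at h2; rw [h2]; simp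
  · simp only at h1 h2; simp [h1, h2]

/-- The Gamma functions `Γ(z + b + i)` and `Γ(z' + b + i)` of the normalization constant have no
poles. -/
theorem admissible_ne (hb : -1 / 2 ≤ b) (hz : (z, z') ∈ admissible a b) (n : ℕ) :
    z + b + 1 + n ≠ 0 ∧ z' + b + 1 + n ≠ 0 := by
  have hσ := hz.2.2
  simp only [Complex.add_re, Complex.ofReal_re] at hσ
  have hn : (0 : ℝ) ≤ n := n.cast_nonneg
  rcases hz.1 with ⟨h1, h2⟩ | ⟨⟨h1, h2⟩, m, ⟨h3, h4⟩, h5, h6⟩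
  · simp only at h1 h2
    constructor
    · intro h
      have := congrArg Complex.im h
      simp at this
      exact h1 ⟨this, by rw [h2]; simp [this]⟩
    · intro h
      have := congrArg Complex.im h
      rw [h2] at this
      simp at this
      exact h1 ⟨this, by rw [h2]; simp [this]⟩
  · -- in the complementary case `z + b` and `z' + b` both exceed `-1`
    have key : ∀ x y : ℝ, (m : ℝ) < x → y < m + 1 → -1 < x + y + b → -1 < x + b := by
      intro x y hx hy hs
      by_contra hlt
      have : (0 : ℝ) < m + 1 := by linarith
      have hm : (0 : ℤ) ≤ m := by
        have : (0 : ℤ) < m + 1 := by exact_mod_cast this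
        lia
      have : (0 : ℝ) ≤ m := by exact_mod_cast hm
      linarith
    simp only at h3 h4 h5 h6
    constructor
    · intro h
      have h7 := key _ _ h3 h6 hσ
      have := congrArg Complex.re h
      simp at this
      linarith
    · intro h
      have h7 := key _ _ h5 h4 (by linarith)
      have := congrArg Complex.re h
      simp at this
      linarith

theorem weight_shift (N k x : ℕ) :
    weight a b z z' (N + k) x = weight a b (z + k) (z' + k) N x := by
  rw [weight_eq, weight_eq, gammaFactor_shift]

/-- The total mass of the weight of level `N + 1`. -/
theorem hasSum_weight (hb : -1 / 2 ≤ b) (hab : b ≤ a) (hz : (z, z') ∈ admissible a b) (N : ℕ) :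
    HasSum (weight a b z z' (N + 1))
      (Complex.Gamma (a + 1) * Complex.Gamma (z + z' + 2 * N + b + 1) /
        (2 * (Complex.Gamma (z + N + 1) * Complex.Gamma (z' + N + 1) *
          Complex.Gamma (z + b + N + 1) * Complex.Gamma (z' + b + N + 1) *
            Complex.Gamma (z + z' + 2 * N + a + b + 2)))) := by
  have hσ := hz.2.2
  have hN : (0 : ℝ) ≤ N := N.cast_nonneg
  have h := hasSum_weight_one (z := z + N) (z' := z' + N) hb (hb.trans hab)
    (by simp at hσ ⊢; linarith)
    (fun n h => (admissible_ne hb hz (N + n)).1 (by rw [← h]; push_cast; ring))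
    (fun n h => (admissible_ne hb hz (N + n)).2 (by rw [← h]; push_cast; ring))
  rw [show weight a b z z' (N + 1) = weight a b (z + N) (z' + N) 1 from
    funext fun x => by rw [add_comm N 1, weight_shift]]
  convert h using 4 <;> ring_nf

theorem opLead_pos (hb : -1 / 2 ≤ b) (hab : b ≤ a) (hz : (z, z') ∈ admissible a b)
    {N j : ℕ} (hj : j < N) : 0 < opLead a b (z - j) z' N := by
  have h1 : (j : ℝ) + 1 ≤ N := by exact_mod_cast hj
  have h2 : (0 : ℝ) ≤ j := j.cast_nonneg
  have him := admissible_im hz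
  have hσ := hz.2.2
  simp only [Complex.add_re, Complex.ofReal_re] at hσ
  rw [Complex.add_im] at him
  refine mul_pos (Complex.pos_iff.2 ⟨?_, ?_⟩) (Complex.pos_iff.2 ⟨?_, ?_⟩)
  · simp; linarith
  · simp; linarith
  · simp; linarith
  · simp; linarith

/-- The ratio of two consecutive normalization constants. -/
def levelRatio (a b : ℝ) (z z' : ℂ) (N : ℕ) : ℂ :=
  ((2 ^ N * hypConst a N : ℝ) : ℂ)⁻¹ * ((∑' x, weight a b z z' (N + 1) x) *
    (∏ j ∈ Finset.range N, opLead a b (z - j) z' N)⁻¹)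

theorem levelRatio_pos (hb : -1 / 2 ≤ b) (hab : b ≤ a) (hz : (z, z') ∈ admissible a b) (N : ℕ) :
    0 < levelRatio a b z z' N := by
  have h1 : (0 : ℂ) < ((2 ^ N * hypConst a N : ℝ) : ℂ) := by
    have := hypConst_pos (hb.trans hab) N
    exact_mod_cast (by positivity : 0 < 2 ^ N * hypConst a N)
  have h2 : 0 < ∑' x, weight a b z z' (N + 1) x := by
    have hs := (hasSum_weight hb hab hz N).summable
    have e : ∀ x, weight a b z z' (N + 1) x = ((weight a b z z' (N + 1) x).re : ℂ) := fun x =>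
      Complex.ext (by simp) (by
        simpa using (Complex.pos_iff.1 (weight_pos hb hab hz (N + 1) x)).2.symm)
    have hs' : Summable fun x => (weight a b z z' (N + 1) x).re :=
      (Complex.hasSum_re hs.hasSum).summable
    rw [tsum_congr e, ← Complex.ofReal_tsum]
    exact_mod_cast hs'.tsum_pos
      (fun x => (Complex.pos_iff.1 (weight_pos hb hab hz (N + 1) x)).1.le) 0
      (Complex.pos_iff.1 (weight_pos hb hab hz (N + 1) 0)).1
  have h3 : 0 < ∏ j ∈ Finset.range N, opLead a b (z - j) z' N :=
    Finset.prod_pos fun j hj => opLead_pos hb hab hz (Finset.mem_range.1 hj)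
  exact mul_pos (RCLike.inv_pos.2 h1) (mul_pos h2 (RCLike.inv_pos.2 h3))

theorem Gamma_eq_prod_range {w : ℂ} (hw : 0 < w.re) (N : ℕ) :
    Complex.Gamma (w + N) = Complex.Gamma w * ∏ j ∈ Finset.range N, (w + N - 1 - j) := by
  have h : Complex.Gamma (w + N) = Complex.Gamma w * ∏ j ∈ Finset.range N, (w + j) := by
    induction N with
    | zero => simp
    | succ N ih =>
      have : w + N ≠ 0 := fun h => by
        have := congrArg Complex.re h
        simp at this
        have hN : (0 : ℝ) ≤ N := N.cast_nonneg
        linarith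
      rw [Finset.prod_range_succ, ← mul_assoc, ← ih, Nat.cast_add, Nat.cast_one, ← add_assoc,
        Complex.Gamma_add_one _ this, mul_comm]
  rw [h, ← Finset.prod_range_reflect]
  congr 1
  refine Finset.prod_congr rfl fun j hj => ?_
  have := Finset.mem_range.1 hj
  rw [Nat.sub_sub, Nat.cast_sub (by lia)]
  push_cast
  ring

theorem hypConst_mul_Gamma (ha : -1 / 2 ≤ a) (N : ℕ) :
    ((2 ^ N * hypConst a N : ℝ) : ℂ)⁻¹ * Complex.Gamma (a + 1) =
      Complex.Gamma (a + N + 1) * Complex.Gamma (N + 1) := by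
  induction N with
  | zero => simp [hypConst]
  | succ N ih =>
    have hN : (0 : ℝ) ≤ N := N.cast_nonneg
    have h1 : (a + N + 1 : ℂ) ≠ 0 := by
      have : a + N + 1 ≠ 0 := by linarith
      exact_mod_cast this
    have h2 : (N + 1 : ℂ) ≠ 0 := Nat.cast_add_one_ne_zero N
    have e : ((2 ^ (N + 1) * hypConst a (N + 1) : ℝ) : ℂ)⁻¹ =
        (a + N + 1) * (N + 1) * ((2 ^ N * hypConst a N : ℝ) : ℂ)⁻¹ := by
      have h3 : (2 ^ (N + 1) * hypConst a (N + 1) : ℝ)⁻¹ =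
        (a + N + 1) * (N + 1) * (2 ^ N * hypConst a N)⁻¹ := by
        rw [hypConst_succ]
        simp only [mul_inv, inv_inv, pow_succ]
        ring
      have := congrArg (fun x : ℝ => (x : ℂ)) h3
      push_cast at this ⊢
      exact this
    rw [e, mul_assoc, ih]
    have g1 := Complex.Gamma_add_one _ h1
    have g2 := Complex.Gamma_add_one _ h2
    push_cast
    rw [← add_assoc (a : ℂ), g1, g2]
    ring

theorem prod_Icc_Gamma_level (w : ℂ) (N : ℕ) :
    (∏ i ∈ Finset.Icc 1 (N + 1), Complex.Gamma (w + (N + 1 : ℕ) + i)) * Complex.Gamma (w + N + 1) =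
      (∏ i ∈ Finset.Icc 1 N, Complex.Gamma (w + N + i)) *
        (Complex.Gamma (w + 2 * N + 1) * Complex.Gamma (w + 2 * N + 2)) := by
  have e : ∀ n (f : ℕ → ℂ), ∏ i ∈ Finset.Icc 1 n, f i =
      ∏ i ∈ Finset.range n, f (i + 1) := fun n f => by
    induction n with
    | zero => simp
    | succ n ih => rw [Finset.prod_Icc_succ_top (by lia), ih, Finset.prod_range_succ]
  rw [e, e]
  have h1 := Finset.prod_range_succ' (fun i : ℕ => Complex.Gamma (w + N + 1 + i)) (N + 1)
  have h2 := Finset.prod_range_succ (fun i : ℕ => Complex.Gamma (w + N + 1 + i)) (N + 1)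
  have h3 := Finset.prod_range_succ (fun i : ℕ => Complex.Gamma (w + N + 1 + i)) N
  rw [h2, h3] at h1
  convert h1.symm using 1
  · congr 1
    · refine Finset.prod_congr rfl fun i _ => ?_
      push_cast; ring_nf
    · push_cast; ring_nf
  · rw [mul_assoc]
    congr 1
    · refine Finset.prod_congr rfl fun i _ => ?_
      push_cast; ring_nf
    · push_cast; ring_nf

end

end BCZMeasure

namespace BCZMeasure

open Filter Topology
open scoped ComplexOrder

/-! ### The z-measures are coherent probability measures -/

section

variable {a b : ℝ} {z z' : ℂ}

theorem levelRatio_eq (hb : -1 / 2 ≤ b) (hab : b ≤ a) (hz : (z, z') ∈ admissible a b) {N : ℕ}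
    (hN : 1 ≤ N) :
    levelRatio a b z z' N =
      Complex.Gamma (a + (N + 1 : ℕ)) * Complex.Gamma (b + z + z' + (N + 1 : ℕ)) *
      Complex.Gamma (N + 1 : ℕ) / (2 * (Complex.Gamma (z + (N + 1 : ℕ)) *
        Complex.Gamma (z' + (N + 1 : ℕ)) * Complex.Gamma (z + b + (N + 1 : ℕ)) *
        Complex.Gamma (z' + b + (N + 1 : ℕ)))) *
      (Complex.Gamma (z + z' + a + b + N + 1) *
        (Complex.Gamma (z + z' + a + b + 2 * N + 1) *
          Complex.Gamma (z + z' + a + b + 2 * N + 2))⁻¹) := by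
  have hσ := hz.2.2
  simp only [Complex.add_re, Complex.ofReal_re] at hσ
  have hN1 : (1 : ℝ) ≤ N := by exact_mod_cast hN
  have h1 := Gamma_eq_prod_range (w := z + z' + N + b + 1) (by simp; linarith) N
  have h2 := Gamma_eq_prod_range (w := z + z' + a + b + N + 1) (by simp; linarith) N
  have h3 := hypConst_mul_Gamma (hb.trans hab) N
  have h4 : ∏ j ∈ Finset.range N, opLead a b (z - j) z' N =
      (∏ j ∈ Finset.range N, (z + z' + a + b + N + 1 + N - 1 - j)) *
        ∏ j ∈ Finset.range N, (z + z' + N + b + 1 + N - 1 - j) := by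
    rw [← Finset.prod_mul_distrib]
    refine Finset.prod_congr rfl fun j _ => ?_
    rw [opLead]
    ring
  have g0 : Complex.Gamma (z + z' + a + b + N + 1) ≠ 0 :=
    Complex.Gamma_ne_zero_of_re_pos (by simp; linarith)
  have hne : ∏ j ∈ Finset.range N, opLead a b (z - j) z' N ≠ 0 :=
    Finset.prod_ne_zero_iff.2 fun j hj => opLead_ne_zero hb hab hz.2.2 (Finset.mem_range.1 hj)
  rw [levelRatio, (hasSum_weight hb hab hz N).tsum_eq]
  rw [h4] at hne ⊢
  have e1 : z + z' + 2 * N + b + 1 = z + z' + N + b + 1 + N := by ring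
  have e2 : z + z' + a + b + 2 * N + 1 = z + z' + a + b + N + 1 + N := by ring
  have e3 : z + z' + 2 * N + a + b + 2 = z + z' + a + b + 2 * N + 2 := by ring
  have e4 : b + z + z' + (N + 1 : ℕ) = z + z' + N + b + 1 := by push_cast; ring
  rw [e1, e2, e3, e4, h1, h2]
  push_cast
  simp only [← add_assoc]
  obtain ⟨hne1, hne2⟩ := mul_ne_zero_iff.1 hne
  generalize ∏ j ∈ Finset.range N, (z + z' + a + b + N + 1 + N - 1 - (j : ℂ)) = L1 at *
  generalize ∏ j ∈ Finset.range N, (z + z' + N + b + 1 + N - 1 - (j : ℂ)) = L2 at *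
  generalize Complex.Gamma (z + z' + a + b + N + 1) = G1 at *
  generalize Complex.Gamma (z + z' + a + b + 2 * N + 2) = G2 at *
  push_cast at h3
  have c1 : G1 * G1⁻¹ = 1 := mul_inv_cancel₀ g0
  have c2 : L2 * L2⁻¹ = 1 := mul_inv_cancel₀ hne2
  simp only [div_eq_mul_inv, mul_inv]
  calc _ = ((2 ^ N : ℂ)⁻¹ * (hypConst a N : ℂ)⁻¹ * Complex.Gamma (a + 1)) * (L2 * L2⁻¹) *
        (Complex.Gamma (z + z' + N + b + 1) * (2⁻¹ * ((Complex.Gamma (z + N + 1))⁻¹ *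
          (Complex.Gamma (z' + N + 1))⁻¹ * (Complex.Gamma (z + b + N + 1))⁻¹ *
            (Complex.Gamma (z' + b + N + 1))⁻¹ * G2⁻¹)) * L1⁻¹) := by ring
    _ = _ := by
        rw [← mul_inv, h3, c2]
        linear_combination (-(Complex.Gamma (a + N + 1) * Complex.Gamma (N + 1)) *
        (Complex.Gamma (z + z' + N + b + 1) * (2⁻¹ * ((Complex.Gamma (z + N + 1))⁻¹ *
          (Complex.Gamma (z' + N + 1))⁻¹ * (Complex.Gamma (z + b + N + 1))⁻¹ *
            (Complex.Gamma (z' + b + N + 1))⁻¹ * G2⁻¹)) * L1⁻¹)) * c1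

theorem normConst_succ (hb : -1 / 2 ≤ b) (hab : b ≤ a) (hz : (z, z') ∈ admissible a b) (N : ℕ) :
    normConst a b z z' (N + 1) = levelRatio a b z z' N * normConst a b z z' N := by
  rcases Nat.eq_zero_or_pos N with rfl | hN
  · -- the factor `Γ(z + z' + a + b + 1)`, possibly at a pole, does not occur at the lowest level
    rw [levelRatio, (hasSum_weight hb hab hz 0).tsum_eq]
    simp only [normConst, zero_add, Finset.Icc_self, Finset.prod_singleton, Finset.range_zero,
      Finset.prod_empty, hypConst_zero]
    norm_num
    ring_nf
  have hσ := hz.2.2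
  simp only [Complex.add_re, Complex.ofReal_re] at hσ
  have hN1 : (1 : ℝ) ≤ N := by exact_mod_cast hN
  have hsplit : ∀ M : ℕ, normConst a b z z' M =
      (∏ i ∈ Finset.Icc 1 M, Complex.Gamma (a + i) * Complex.Gamma (b + z + z' + i) *
        Complex.Gamma i / (2 * (Complex.Gamma (z + i) * Complex.Gamma (z' + i) *
          Complex.Gamma (z + b + i) * Complex.Gamma (z' + b + i)))) *
      (∏ i ∈ Finset.Icc 1 M, Complex.Gamma (z + z' + a + b + M + i))⁻¹ := fun M => by
    rw [normConst, ← Finset.prod_inv_distrib, ← Finset.prod_mul_distrib]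
    refine Finset.prod_congr rfl fun i _ => ?_
    rw [show z + z' + M + a + b + i = z + z' + a + b + M + i by ring]
    simp only [div_eq_mul_inv, mul_inv]
    ring
  have h1 := prod_Icc_Gamma_level (z + z' + a + b) N
  have g0 : Complex.Gamma (z + z' + a + b + N + 1) ≠ 0 :=
    Complex.Gamma_ne_zero_of_re_pos (by simp; linarith)
  rw [hsplit, hsplit, levelRatio_eq hb hab hz hN, Finset.prod_Icc_succ_top (by lia)]
  rw [← eq_div_iff g0] at h1
  rw [h1, inv_div, div_eq_mul_inv _ (_ * _), mul_inv]
  ring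

theorem normConst_pos (hb : -1 / 2 ≤ b) (hab : b ≤ a) (hz : (z, z') ∈ admissible a b) (N : ℕ) :
    0 < normConst a b z z' N := by
  induction N with
  | zero => simp [normConst]
  | succ N ih =>
    rw [normConst_succ hb hab hz]
    exact mul_pos (levelRatio_pos hb hab hz N) ih

theorem zMeasure_eq (N : ℕ) (lam : GT N) : zMeasure a b z z' N lam =
    (normConst a b z z' N)⁻¹ * (sqVandermonde a b lam : ℂ) ^ 2 *
      ∏ i, weight a b z z' N (shifted lam i) := by
  rw [zMeasure, Finset.prod_pow]
  congr 3
  simp [sqVandermonde, sqShift]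

theorem zMeasure_pos (hb : -1 / 2 ≤ b) (hab : b ≤ a) (hz : (z, z') ∈ admissible a b) (N : ℕ)
    (lam : GT N) : 0 < zMeasure a b z z' N lam := by
  rw [zMeasure_eq]
  refine mul_pos (mul_pos (RCLike.inv_pos.2 (normConst_pos hb hab hz N)) ?_)
    (Finset.prod_pos fun i _ => weight_pos hb hab hz N _)
  have := sqVandermonde_pos hb hab lam
  exact_mod_cast (by positivity : 0 < sqVandermonde a b lam ^ 2)

/-- Coherence: up to the constants, this is the determinantal sum `hasSum_weight_mul_linkDet`. -/
theorem hasSum_zMeasure_mul_link (hb : -1 / 2 ≤ b) (hab : b ≤ a) (hz : (z, z') ∈ admissible a b)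
    (N : ℕ) (mu : GT N) :
    HasSum (fun lam : GT (N + 1) => zMeasure a b z z' (N + 1) lam * (link a b lam mu : ℂ))
      (zMeasure a b z z' N mu) := by
  have h := (hasSum_weight_mul_linkDet hb hab hz.2.2 N mu).mul_left
    ((normConst a b z z' (N + 1))⁻¹ * ((2 ^ N * hypConst a N : ℝ) : ℂ)⁻¹ *
      (sqVandermonde a b mu : ℂ))
  have e : (fun lam : GT (N + 1) => zMeasure a b z z' (N + 1) lam * (link a b lam mu : ℂ)) =
      fun lam => (normConst a b z z' (N + 1))⁻¹ * ((2 ^ N * hypConst a N : ℝ) : ℂ)⁻¹ *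
        (sqVandermonde a b mu : ℂ) * ((∏ i, weight a b z z' (N + 1) (shifted lam i)) *
        (sqVandermonde a b lam : ℂ) * (linkDet a b lam mu : ℂ)) := funext fun lam => by
    have h1 : (sqVandermonde a b lam : ℂ) ≠ 0 := by
      exact_mod_cast (sqVandermonde_pos hb hab lam).ne'
    rw [zMeasure_eq, link_eq hb hab, linkFormula]
    push_cast
    field_simp
  rw [e]
  refine (congrArg (HasSum _) ?_).mpr h
  have h1 := (levelRatio_pos hb hab hz N).ne'
  rw [zMeasure_eq, normConst_succ hb hab hz, mul_inv]
  rw [levelRatio] at h1 ⊢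
  generalize ((2 ^ N * hypConst a N : ℝ) : ℂ)⁻¹ = H at *
  generalize (∑' x, weight a b z z' (N + 1) x) * (∏ j ∈ Finset.range N, opLead a b (z - j) z' N)⁻¹
    = S at *
  have c := mul_inv_cancel₀ h1
  linear_combination (-(normConst a b z z' N)⁻¹ * (sqVandermonde a b mu : ℂ) ^ 2 *
    ∏ i, weight a b z z' N (shifted mu i)) * c

/-- Interchange of summation for a nonnegative double series. -/
theorem hasSum_swap_of_nonneg {α β : Type*} {F : α → β → ℝ} {f : α → ℝ} {g : β → ℝ} {c : ℝ}
    (hF : ∀ x y, 0 ≤ F x y) (hg : ∀ y, HasSum (fun x => F x y) (g y))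
    (hf : ∀ x, HasSum (F x) (f x)) (h : HasSum g c) : HasSum f c := by
  have hs : Summable fun p : β × α => F p.2 p.1 := by
    refine (summable_prod_of_nonneg fun p => hF _ _).2 ⟨fun y => (hg y).summable, ?_⟩
    simpa only [(hg _).tsum_eq] using h.summable
  have h1 : HasSum (fun p : β × α => F p.2 p.1) c := by
    rw [← (hs.hasSum.prod_fiberwise hg).unique h]
    exact hs.hasSum
  have h2 : HasSum (fun p : α × β => F p.1 p.2) c := (Equiv.prodComm α β).hasSum_iff.2 h1
  exact h2.prod_fiberwise hf

theorem zMeasure_eq_re (hb : -1 / 2 ≤ b) (hab : b ≤ a) (hz : (z, z') ∈ admissible a b) (N : ℕ)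
    (lam : GT N) : zMeasure a b z z' N lam = ((zMeasure a b z z' N lam).re : ℂ) :=
  Complex.ext (by simp) (by simpa using (Complex.pos_iff.1 (zMeasure_pos hb hab hz N lam)).2.symm)

theorem hasSum_zMeasure_re_mul_link (hb : -1 / 2 ≤ b) (hab : b ≤ a)
    (hz : (z, z') ∈ admissible a b) (N : ℕ) (mu : GT N) :
    HasSum (fun lam : GT (N + 1) => (zMeasure a b z z' (N + 1) lam).re * link a b lam mu)
      (zMeasure a b z z' N mu).re := by
  simpa using Complex.hasSum_re (hasSum_zMeasure_mul_link hb hab hz N mu)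

instance : Unique (GT 0) where
  default := ⟨fun i => i.elim0, fun i => i.elim0⟩
  uniq _ := Subtype.ext (funext fun i => i.elim0)

/-- The total mass is `1` at level `0`, which is a single point, and stochastic links preserve
it. -/
theorem hasSum_zMeasure_re (hb : -1 / 2 ≤ b) (hab : b ≤ a) (hz : (z, z') ∈ admissible a b)
    (N : ℕ) : HasSum (fun lam : GT N => (zMeasure a b z z' N lam).re) 1 := by
  induction N with
  | zero =>
    have h : (zMeasure a b z z' 0 default).re = 1 := by
      simp [zMeasure_eq, normConst, sqVandermonde, ltPairs]
    rw [← h]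
    exact hasSum_unique _
  | succ N ih =>
    refine hasSum_swap_of_nonneg (fun lam mu => mul_nonneg
      (Complex.pos_iff.1 (zMeasure_pos hb hab hz _ lam)).1.le (link_nonneg hb hab lam mu))
      (hasSum_zMeasure_re_mul_link hb hab hz N) (fun lam => ?_) ih
    simpa using (hasSum_link hb hab lam).mul_left (zMeasure a b z z' (N + 1) lam).re

theorem zMeasure_mem_coherentSystems (hb : -1 / 2 ≤ b) (hab : b ≤ a)
    (hz : (z, z') ∈ admissible a b) :
    (fun n lam => (zMeasure a b z z' (n + 1) lam).re) ∈ coherentSystems a b :=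
  ⟨fun n lam => (Complex.pos_iff.1 (zMeasure_pos hb hab hz (n + 1) lam)).1.le,
    fun n => hasSum_zMeasure_re hb hab hz (n + 1),
    fun n mu => hasSum_zMeasure_re_mul_link hb hab hz (n + 1) mu⟩

end

end BCZMeasure

namespace BCZMeasure

open Filter Topology

/-! ### Coherent systems on a branching graph -/

/-- A sequence of sets with stochastic kernels from each set to the preceding one, all of whose rows
are finitely supported. -/
structure BranchingSystem (E : ℕ → Type) where
  /-- The row of the kernel at a vertex of level `n + 1`. -/
  kernel : ∀ n, E (n + 1) → E n →₀ ℝ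
  nonneg : ∀ n x y, 0 ≤ kernel n x y
  sum_eq_one : ∀ n x, ((kernel n x).sum fun _ r => r) = 1

namespace BranchingSystem

variable {E : ℕ → Type} (B : BranchingSystem E)

/-- The coherent systems of probability measures of a branching system. -/
def coherent : Set (∀ n, E n → ℝ) :=
  {M | (∀ n x, 0 ≤ M n x) ∧ (∀ n, HasSum (M n) 1) ∧
    ∀ n (y : E n), HasSum (fun x => M (n + 1) x * B.kernel n x y) (M n y)}

theorem sum_mul_nonneg {n : ℕ} (x : E (n + 1)) {g : E n → ℝ} (hg : ∀ y, 0 ≤ g y) :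
    0 ≤ (B.kernel n x).sum fun y r => r * g y :=
  Finset.sum_nonneg fun y _ => mul_nonneg (B.nonneg n x y) (hg y)

theorem sum_mul_le_one {n : ℕ} (x : E (n + 1)) {g : E n → ℝ} (hg : ∀ y, g y ≤ 1) :
    ((B.kernel n x).sum fun y r => r * g y) ≤ 1 := by
  rw [← B.sum_eq_one n x]
  exact Finset.sum_le_sum fun y _ => mul_le_of_le_one_right (B.nonneg n x y) (hg y)

/-- Jensen's inequality for the rows of the kernel. -/
theorem sq_sum_mul_le {n : ℕ} (x : E (n + 1)) (g : E n → ℝ) :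
    ((B.kernel n x).sum fun y r => r * g y) ^ 2 ≤ (B.kernel n x).sum fun y r => r * g y ^ 2 := by
  have h := (Even.convexOn_pow (𝕜 := ℝ) even_two).map_sum_le (t := (B.kernel n x).support)
    (w := B.kernel n x) (p := g) (fun y _ => B.nonneg n x y) (B.sum_eq_one n x) (by simp)
  simpa only [smul_eq_mul, Finsupp.sum] using h

open Classical in
/-- The composite link: the probability to reach the vertex `y` of level `k` from the vertex `x` of
level `n` along the kernels; it is `0` if `n < k`. -/
def compLink : ∀ n, E n → ∀ k, E k → ℝ
  | 0, x, k, y => if (⟨0, x⟩ : Σ n, E n) = ⟨k, y⟩ then 1 else 0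
  | n + 1, x, k, y => (if (⟨n + 1, x⟩ : Σ n, E n) = ⟨k, y⟩ then 1 else 0) +
      (B.kernel n x).sum fun w r => r * compLink n w k y

theorem compLink_of_lt {n k : ℕ} (h : n < k) (x : E n) (y : E k) : B.compLink n x k y = 0 := by
  induction n with
  | zero =>
    rw [compLink, if_neg]
    intro he
    have := congrArg Sigma.fst he
    simp only at this
    lia
  | succ n ih =>
    rw [compLink, if_neg]
    · simp [ih (by lia : n < k)]
    · intro he
      have := congrArg Sigma.fst he
      simp only at this
      lia

open Classical in
theorem compLink_self (n : ℕ) (x y : E n) : B.compLink n x n y = if x = y then 1 else 0 := by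
  cases n with
  | zero => simp [compLink]
  | succ n => simp [compLink, B.compLink_of_lt n.lt_succ_self]

theorem compLink_succ {n k : ℕ} (h : k ≤ n) (x : E (n + 1)) (y : E k) :
    B.compLink (n + 1) x k y = (B.kernel n x).sum fun w r => r * B.compLink n w k y := by
  rw [compLink, if_neg, zero_add]
  intro he
  have := congrArg Sigma.fst he
  simp only at this
  lia

theorem compLink_nonneg (n : ℕ) (x : E n) (k : ℕ) (y : E k) : 0 ≤ B.compLink n x k y := by
  induction n with
  | zero => rw [compLink]; split_ifs <;> norm_num
  | succ n ih =>
    rw [compLink]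
    refine add_nonneg (by split_ifs <;> norm_num) (B.sum_mul_nonneg x ih)

theorem compLink_le_one (n : ℕ) (x : E n) (k : ℕ) (y : E k) : B.compLink n x k y ≤ 1 := by
  rcases lt_trichotomy n k with h | rfl | h
  · rw [B.compLink_of_lt h]; norm_num
  · rw [compLink_self]; split_ifs <;> norm_num
  · induction n with
    | zero => lia
    | succ n ih =>
      rw [B.compLink_succ (by lia)]
      refine B.sum_mul_le_one x fun w => ?_
      rcases (Nat.lt_succ_iff.1 h).eq_or_lt with rfl | h'
      · rw [compLink_self]; split_ifs <;> norm_num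
      · exact ih w h'

theorem hasSum_compLink {n k : ℕ} (h : k ≤ n) (x : E n) : HasSum (B.compLink n x k) 1 := by
  classical
  induction n, h using Nat.le_induction with
  | base =>
    rw [show B.compLink k x k = fun y => if y = x then 1 else 0 from
      funext fun y => by rw [compLink_self]; simp only [eq_comm]]
    exact hasSum_ite_eq x 1
  | succ n h ih =>
    rw [show B.compLink (n + 1) x k = fun y => (B.kernel n x).sum fun w r => r * B.compLink n w k y
      from funext fun y => B.compLink_succ h x y, ← B.sum_eq_one n x]
    have := hasSum_sum (s := (B.kernel n x).support) fun w _ => (ih w).mul_left (B.kernel n x w)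
    simpa only [Finsupp.sum, mul_one] using this

/-- The composite links are coherent in their second argument below their starting level. -/
theorem hasSum_compLink_mul_kernel {n k : ℕ} (h : k + 1 ≤ n) (x : E n) (y : E k) :
    HasSum (fun w => B.compLink n x (k + 1) w * B.kernel k w y) (B.compLink n x k y) := by
  classical
  induction n, h using Nat.le_induction with
  | base =>
    have e : B.compLink (k + 1) x k y = B.kernel k x y := by
      rw [B.compLink_succ le_rfl, Finsupp.sum]
      simp only [compLink_self, mul_ite, mul_one, mul_zero]
      rw [Finset.sum_ite_eq']
      split_ifs with hy
      · rfl
      · exact (Finsupp.notMem_support_iff.1 hy).symm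
    rw [e]
    have : (fun w => B.compLink (k + 1) x (k + 1) w * B.kernel k w y) =
        fun w => if w = x then B.kernel k x y else 0 := funext fun w => by
      rw [compLink_self]
      by_cases hw : w = x
      · subst hw; simp
      · simp [hw, Ne.symm hw]
    rw [this]
    exact hasSum_ite_eq x _
  | succ n h ih =>
    rw [B.compLink_succ (by lia)]
    have := hasSum_sum (s := (B.kernel n x).support) fun w _ => (ih w).mul_left (B.kernel n x w)
    refine (congrArg (fun f => HasSum f _) (funext fun w => ?_)).mpr this
    rw [B.compLink_succ h, Finsupp.sum, Finset.sum_mul]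
    exact Finset.sum_congr rfl fun v _ => mul_assoc _ _ _

variable {B} {M : ∀ n, E n → ℝ}

theorem coherent_le_one (hM : M ∈ B.coherent) (n : ℕ) (x : E n) : M n x ≤ 1 :=
  le_hasSum (hM.2.1 n) x fun y _ => hM.1 n y

theorem coherent_summable_mul (hM : M ∈ B.coherent) {n : ℕ} {g : E n → ℝ} {C : ℝ}
    (hg : ∀ y, |g y| ≤ C) : Summable fun y => M n y * g y := by
  refine Summable.of_norm_bounded ((hM.2.1 n).summable.mul_right C) fun y => ?_
  rw [norm_mul, Real.norm_eq_abs, Real.norm_eq_abs, abs_of_nonneg (hM.1 n y)]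
  exact mul_le_mul_of_nonneg_left (hg y) (hM.1 n y)

theorem hasSum_mul_kernel_sum (hM : M ∈ B.coherent) {n : ℕ} {g : E n → ℝ}
    (hg0 : ∀ y, 0 ≤ g y) (hg1 : ∀ y, g y ≤ 1) :
    HasSum (fun x => M (n + 1) x * (B.kernel n x).sum fun y r => r * g y)
      (∑' y, M n y * g y) := by
  refine hasSum_swap_of_nonneg (F := fun x y => M (n + 1) x * B.kernel n x y * g y)
    (fun x y => mul_nonneg (mul_nonneg (hM.1 _ x) (B.nonneg n x y)) (hg0 y))
    (fun y => (hM.2.2 n y).mul_right (g y)) (fun x => ?_)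
    (coherent_summable_mul hM (C := 1) fun y => by rw [abs_of_nonneg (hg0 y)]; exact hg1 y).hasSum
  rw [Finsupp.sum, Finset.mul_sum]
  simp only [← mul_assoc]
  refine hasSum_sum_of_ne_finset_zero fun y hy => ?_
  rw [Finsupp.notMem_support_iff.1 hy]
  simp

theorem hasSum_mul_compLink (hM : M ∈ B.coherent) {n k : ℕ} (h : k ≤ n) (y : E k) :
    HasSum (fun x => M n x * B.compLink n x k y) (M k y) := by
  classical
  induction n, h using Nat.le_induction with
  | base =>
    simp only [compLink_self, mul_ite, mul_one, mul_zero]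
    rw [show (fun x => if x = y then M k x else 0) = fun x => if x = y then M k y else 0 from
      funext fun x => by split_ifs with hx <;> simp [hx]]
    exact hasSum_ite_eq y (M k y)
  | succ n h ih =>
    simp only [B.compLink_succ h]
    rw [← ih.tsum_eq]
    exact hasSum_mul_kernel_sum hM (fun _ => B.compLink_nonneg _ _ _ _)
      fun _ => B.compLink_le_one _ _ _ _

variable (B)

/-- The second moment of the composite link to `y` under the measure of level `n`. -/
def secondMoment (M : ∀ n, E n → ℝ) (k : ℕ) (y : E k) (n : ℕ) : ℝ :=
  ∑' x, M n x * B.compLink n x k y ^ 2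

/-- The limit of the second moments of the composite links to `y`; it is the infimum because the
moments decrease from level `k` on. -/
def limitMoment (M : ∀ n, E n → ℝ) (k : ℕ) (y : E k) : ℝ := ⨅ n, B.secondMoment M k y (k + n)

/-- A system is regular if the composite links have vanishing variances in the limit. -/
def IsRegular (M : ∀ n, E n → ℝ) : Prop := ∀ k (y : E k), B.limitMoment M k y = M k y ^ 2

variable {B}

theorem sq_compLink_mem (n : ℕ) (x : E n) (k : ℕ) (y : E k) :
    0 ≤ B.compLink n x k y ^ 2 ∧ B.compLink n x k y ^ 2 ≤ 1 :=
  ⟨sq_nonneg _, pow_le_one₀ (B.compLink_nonneg _ _ _ _) (B.compLink_le_one _ _ _ _)⟩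

theorem abs_sq_compLink_le (n : ℕ) (x : E n) (k : ℕ) (y : E k) : |B.compLink n x k y ^ 2| ≤ 1 := by
  rw [abs_of_nonneg (sq_nonneg _)]; exact (sq_compLink_mem n x k y).2

theorem summable_mul_sq_compLink (hM : M ∈ B.coherent) (k : ℕ) (y : E k) (n : ℕ) :
    Summable fun x => M n x * B.compLink n x k y ^ 2 :=
  coherent_summable_mul hM (C := 1) fun x => abs_sq_compLink_le n x k y

theorem secondMoment_nonneg (hM : M ∈ B.coherent) (k : ℕ) (y : E k) (n : ℕ) :
    0 ≤ B.secondMoment M k y n := tsum_nonneg fun x => mul_nonneg (hM.1 n x) (sq_nonneg _)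

theorem secondMoment_le_one (hM : M ∈ B.coherent) (k : ℕ) (y : E k) (n : ℕ) :
    B.secondMoment M k y n ≤ 1 := by
  rw [← (hM.2.1 n).tsum_eq]
  exact (summable_mul_sq_compLink hM k y n).tsum_le_tsum
    (fun x => mul_le_of_le_one_right (hM.1 n x) (sq_compLink_mem n x k y).2) (hM.2.1 n).summable

/-- The second moments decrease with the level, by Jensen's inequality for the rows of the
kernel. -/
theorem secondMoment_antitone (hM : M ∈ B.coherent) (k : ℕ) (y : E k) :
    Antitone fun n => B.secondMoment M k y (k + n) := by
  refine antitone_nat_of_succ_le fun n => ?_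
  have h1 := hasSum_mul_kernel_sum hM (n := k + n) (g := fun x => B.compLink (k + n) x k y ^ 2)
    (fun x => (sq_compLink_mem _ x k y).1) (fun x => (sq_compLink_mem _ x k y).2)
  rw [secondMoment, secondMoment, ← h1.tsum_eq]
  refine (summable_mul_sq_compLink hM k y (k + n + 1)).tsum_le_tsum (fun x => ?_) h1.summable
  refine mul_le_mul_of_nonneg_left ?_ (hM.1 _ x)
  have h2 := B.compLink_succ (Nat.le_add_right k n) x y
  exact (congrArg (· ^ 2) h2).le.trans (B.sq_sum_mul_le x _)

theorem tendsto_secondMoment (hM : M ∈ B.coherent) (k : ℕ) (y : E k) :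
    Tendsto (B.secondMoment M k y) atTop (𝓝 (B.limitMoment M k y)) := by
  have h := tendsto_atTop_ciInf (secondMoment_antitone hM k y)
    ⟨0, by rintro _ ⟨n, rfl⟩; exact secondMoment_nonneg hM k y _⟩
  rw [← tendsto_add_atTop_iff_nat k]
  have e : (fun n => B.secondMoment M k y (n + k)) = fun n => B.secondMoment M k y (k + n) :=
    funext fun n => by rw [add_comm]
  rw [e]
  exact h

/-- The centered second moment. -/
theorem hasSum_mul_sq_sub (hM : M ∈ B.coherent) {k n : ℕ} (h : k ≤ n) (y : E k) :
    HasSum (fun x => M n x * (B.compLink n x k y - M k y) ^ 2)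
      (B.secondMoment M k y n - M k y ^ 2) := by
  have h1 := ((summable_mul_sq_compLink hM k y n).hasSum.sub
    ((hasSum_mul_compLink hM h y).mul_right (2 * M k y))).add ((hM.2.1 n).mul_right (M k y ^ 2))
  have e : (fun x => M n x * (B.compLink n x k y - M k y) ^ 2) = fun x =>
      M n x * B.compLink n x k y ^ 2 - M n x * B.compLink n x k y * (2 * M k y) +
        M n x * M k y ^ 2 := funext fun x => by ring
  have e' : B.secondMoment M k y n - M k y ^ 2 = (∑' x, M n x * B.compLink n x k y ^ 2) -
      M k y * (2 * M k y) + 1 * M k y ^ 2 := by unfold secondMoment; ring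
  rw [e, e']
  exact h1

theorem sq_le_limitMoment (hM : M ∈ B.coherent) (k : ℕ) (y : E k) :
    M k y ^ 2 ≤ B.limitMoment M k y := by
  refine ge_of_tendsto (tendsto_secondMoment hM k y) ?_
  filter_upwards [eventually_ge_atTop k] with n hn
  exact sub_nonneg.1 ((hasSum_mul_sq_sub hM hn y).nonneg fun x =>
    mul_nonneg (hM.1 n x) (sq_nonneg _))

/-- Regular systems are extreme: the limit of the second moments is an affine function of the
system that dominates the strictly convex function `M k y ^ 2`. -/
theorem IsRegular.mem_extremePoints (hM : M ∈ B.coherent) (hr : B.IsRegular M) :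
    M ∈ B.coherent.extremePoints ℝ := by
  refine ⟨hM, fun P hP Q hQ hseg => ?_⟩
  obtain ⟨s, t, hs, ht, hst, rfl⟩ := hseg
  funext k y
  have h1 : B.limitMoment (s • P + t • Q) k y =
      s * B.limitMoment P k y + t * B.limitMoment Q k y := by
    refine tendsto_nhds_unique (tendsto_secondMoment hM k y) ?_
    refine (((tendsto_secondMoment hP k y).const_mul s).add
      ((tendsto_secondMoment hQ k y).const_mul t)).congr fun n => ?_
    rw [secondMoment, secondMoment, secondMoment, ← tsum_mul_left, ← tsum_mul_left,
      ← ((summable_mul_sq_compLink hP k y n).mul_left s).tsum_add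
        ((summable_mul_sq_compLink hQ k y n).mul_left t)]
    refine tsum_congr fun x => ?_
    simp only [Pi.add_apply, Pi.smul_apply, smul_eq_mul]
    ring
  have h2 := hr k y
  rw [h1] at h2
  have h3 := sq_le_limitMoment hP k y
  have h4 := sq_le_limitMoment hQ k y
  simp only [Pi.add_apply, Pi.smul_apply, smul_eq_mul] at h2 ⊢
  obtain rfl : t = 1 - s := by linarith
  have h5 : s * (1 - s) * (P k y - Q k y) ^ 2 ≤ 0 := by
    have h6 := mul_le_mul_of_nonneg_left h3 hs.le
    have h7 := mul_le_mul_of_nonneg_left h4 ht.le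
    nlinarith
  have h6 : (P k y - Q k y) ^ 2 ≤ 0 := by
    by_contra h
    exact absurd h5 (not_le.2 (mul_pos (mul_pos hs ht) (not_le.1 h)))
  have h7 : P k y = Q k y := by
    have := pow_eq_zero_iff (two_ne_zero) |>.1 (le_antisymm h6 (sq_nonneg _))
    linarith
  rw [h7]
  ring

end BranchingSystem

end BCZMeasure

namespace BCZMeasure

open Filter Topology MeasureTheory

/-! ### Limits of coherent systems as measures on a cube -/

namespace BranchingSystem

variable {E : ℕ → Type} (B : BranchingSystem E)

/-- The compact space of all functions on the vertices with values in `[0, 1]`. -/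
abbrev Cube (E : ℕ → Type) : Type := ∀ n, E n → unitInterval

/-- The underlying real-valued function of a point of the cube. -/
def toReal (ω : Cube E) : ∀ n, E n → ℝ := fun n x => ω n x

/-- The point of the cube whose coordinates are the composite links from the vertex `x`. -/
def point (n : ℕ) (x : E n) : Cube E := fun k y =>
  ⟨B.compLink n x k y, B.compLink_nonneg n x k y, B.compLink_le_one n x k y⟩

@[simp] theorem toReal_point (n : ℕ) (x : E n) : toReal (B.point n x) = B.compLink n x := rfl

theorem continuous_toReal (n : ℕ) (x : E n) : Continuous fun ω : Cube E => toReal ω n x :=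
  continuous_subtype_val.comp ((continuous_apply x).comp (continuous_apply n))

theorem toReal_nonneg (ω : Cube E) (n : ℕ) (x : E n) : 0 ≤ toReal ω n x := (ω n x).2.1

theorem toReal_le_one (ω : Cube E) (n : ℕ) (x : E n) : toReal ω n x ≤ 1 := (ω n x).2.2

theorem exists_abs_le (f : C(Cube E, ℝ)) : ∃ C, ∀ ω, |f ω| ≤ C :=
  ⟨‖f‖, fun ω => f.norm_coe_le_norm ω⟩

/-- The image of the measure of level `n` of a system in the cube. -/
def levelMeasure (M : ∀ n, E n → ℝ) (n : ℕ) : Measure (Cube E) :=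
  Measure.sum fun x => ENNReal.ofReal (M n x) • Measure.dirac (B.point n x)

variable {B} {M : ∀ n, E n → ℝ}

theorem isProbabilityMeasure_levelMeasure (hM : M ∈ B.coherent) (n : ℕ) :
    IsProbabilityMeasure (B.levelMeasure M n) := by
  refine ⟨?_⟩
  rw [levelMeasure, Measure.sum_apply _ MeasurableSet.univ]
  simp only [Measure.smul_apply, measure_univ, smul_eq_mul, mul_one]
  rw [← ENNReal.ofReal_tsum_of_nonneg (hM.1 n) (hM.2.1 n).summable, (hM.2.1 n).tsum_eq,
    ENNReal.ofReal_one]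

/-- The measure `ν` is the weak limit along `U` of the images of the levels of the system `M`. -/
def IsLimit (B : BranchingSystem E) (M : ∀ n, E n → ℝ) (U : Filter ℕ) (ν : Measure (Cube E)) :
    Prop :=
  ∀ f : C(Cube E, ℝ), Tendsto (fun n => ∑' x, M n x * f (B.point n x)) U (𝓝 (∫ ω, f ω ∂ν))

variable {U : Filter ℕ} [U.NeBot] {ν : Measure (Cube E)}

theorem IsLimit.integral_coord (h : B.IsLimit M U ν) (hU : U ≤ atTop) (hM : M ∈ B.coherent)
    (k : ℕ) (y : E k) : ∫ ω, toReal ω k y ∂ν = M k y := by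
  refine tendsto_nhds_unique (h ⟨fun ω => toReal ω k y, continuous_toReal k y⟩)
    (tendsto_const_nhds.congr' ?_)
  filter_upwards [hU (eventually_ge_atTop k)] with n hn
  simp only [ContinuousMap.coe_mk, toReal_point]
  exact (hasSum_mul_compLink hM hn y).tsum_eq.symm

theorem IsLimit.integral_sq (h : B.IsLimit M U ν) (hU : U ≤ atTop) (hM : M ∈ B.coherent)
    (k : ℕ) (y : E k) : ∫ ω, toReal ω k y ^ 2 ∂ν = B.limitMoment M k y := by
  refine tendsto_nhds_unique
    (h ⟨fun ω => toReal ω k y ^ 2, (continuous_toReal k y).pow 2⟩) ?_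
  exact (tendsto_secondMoment hM k y).mono_left hU

variable [∀ n, Countable (E n)]

theorem measurable_toReal (n : ℕ) (x : E n) : Measurable fun ω : Cube E => toReal ω n x :=
  (continuous_toReal n x).measurable

theorem integral_levelMeasure (hM : M ∈ B.coherent) (n : ℕ) (f : C(Cube E, ℝ)) :
    ∫ ω, f ω ∂(B.levelMeasure M n) = ∑' x, M n x * f (B.point n x) := by
  have := isProbabilityMeasure_levelMeasure hM n
  obtain ⟨C, hC⟩ := exists_abs_le f
  have hi : Integrable f (B.levelMeasure M n) :=
    Integrable.of_bound f.continuous.measurable.aestronglyMeasurable C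
      (Eventually.of_forall hC)
  have h := (hasSum_integral_measure (μ := fun x => ENNReal.ofReal (M n x) •
    Measure.dirac (B.point n x)) hi).tsum_eq
  rw [levelMeasure, ← h]
  refine tsum_congr fun x => ?_
  rw [integral_smul_measure, integral_dirac, ENNReal.toReal_ofReal (hM.1 n x), smul_eq_mul]

/-- The space of probability measures on the cube is compact, so limits along ultrafilters exist. -/
theorem exists_isLimit (hM : M ∈ B.coherent) (U : Ultrafilter ℕ) :
    ∃ ν : ProbabilityMeasure (Cube E), B.IsLimit M U ν := by
  let m : ℕ → ProbabilityMeasure (Cube E) := fun n =>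
    ⟨B.levelMeasure M n, isProbabilityMeasure_levelMeasure hM n⟩
  refine ⟨(U.map m).lim, fun f => ?_⟩
  have h : Tendsto m U (𝓝 (U.map m).lim) := (U.map m).le_nhds_lim
  have h1 := (ProbabilityMeasure.tendsto_iff_forall_integral_tendsto.1 h)
    (BoundedContinuousFunction.mkOfCompact f)
  refine h1.congr fun n => ?_
  exact integral_levelMeasure hM n f

section limit

variable [IsProbabilityMeasure ν]

/-- A closed condition that holds for all composite links of high level holds almost surely in the
limit. -/
theorem IsLimit.ae_le (h : B.IsLimit M U ν) (hU : U ≤ atTop) (f : C(Cube E, ℝ)) {m : ℕ}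
    (hf : ∀ n, m ≤ n → ∀ x, f (B.point n x) ≤ 0) : ∀ᵐ ω ∂ν, f ω ≤ 0 := by
  have h1 := h (f ⊔ 0)
  have h2 : Tendsto (fun n => ∑' x, M n x * (f ⊔ 0) (B.point n x)) U (𝓝 0) := by
    refine tendsto_const_nhds.congr' ?_
    filter_upwards [hU (eventually_ge_atTop m)] with n hn
    have : ∀ x, M n x * (f ⊔ 0) (B.point n x) = 0 := fun x => by
      simp [hf n hn x]
    rw [tsum_congr this, tsum_zero]
  have h3 := tendsto_nhds_unique h1 h2
  obtain ⟨C, hC⟩ := exists_abs_le (f ⊔ 0)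
  have hi : Integrable (fun ω => (f ⊔ 0) ω) ν :=
    Integrable.of_bound (f ⊔ 0).continuous.measurable.aestronglyMeasurable C
      (Eventually.of_forall hC)
  rw [integral_eq_zero_iff_of_nonneg (fun ω => by simp) hi] at h3
  filter_upwards [h3] with ω hω
  simpa using hω

theorem integrable_toReal (ν : Measure (Cube E)) [IsProbabilityMeasure ν] (k : ℕ) (y : E k) :
    Integrable (fun ω => toReal ω k y) ν :=
  Integrable.of_bound (measurable_toReal k y).aestronglyMeasurable 1 <|
    Eventually.of_forall fun ω => by
    rw [Real.norm_of_nonneg (toReal_nonneg ω k y)]; exact toReal_le_one ω k y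

/-- A nonnegative series with almost surely bounded partial sums sums up to the bound, if the sum of
the expectations is the expectation of the bound. -/
theorem ae_hasSum_of_integral {α Ω : Type*} [Countable α] [MeasurableSpace Ω] {ν : Measure Ω}
    {F : α → Ω → ℝ} {G : Ω → ℝ} (hF0 : ∀ x ω, 0 ≤ F x ω) (hFi : ∀ x, Integrable (F x) ν)
    (hGi : Integrable G ν) (hle : ∀ s : Finset α, ∀ᵐ ω ∂ν, ∑ x ∈ s, F x ω ≤ G ω)
    (hsum : HasSum (fun x => ∫ ω, F x ω ∂ν) (∫ ω, G ω ∂ν)) :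
    ∀ᵐ ω ∂ν, HasSum (fun x => F x ω) (G ω) := by
  have h1 : ∀ᵐ ω ∂ν, ∀ s : Finset α, ∑ x ∈ s, F x ω ≤ G ω := ae_all_iff.2 hle
  have h2 : ∀ᵐ ω ∂ν, Summable (fun x => F x ω) ∧ ∑' x, F x ω ≤ G ω := by
    filter_upwards [h1] with ω hω
    have hs : Summable fun x => F x ω := summable_of_sum_le (fun x => hF0 x ω) hω
    exact ⟨hs, hs.tsum_le_of_sum_le hω⟩
  have h3 : Integrable (fun ω => ∑' x, F x ω) ν := by
    refine hGi.mono' ?_ ?_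
    · have hm : ∀ x, AEMeasurable (F x) ν := fun x => (hFi x).aemeasurable
      have : AEMeasurable (fun ω => (∑' x, ENNReal.ofReal (F x ω)).toReal) ν :=
        (AEMeasurable.tsum fun x => (hm x).ennreal_ofReal).ennreal_toReal
      refine (this.congr ?_).aestronglyMeasurable
      filter_upwards [h2] with ω hω
      rw [← ENNReal.ofReal_tsum_of_nonneg (fun x => hF0 x ω) hω.1,
        ENNReal.toReal_ofReal (tsum_nonneg fun x => hF0 x ω)]
    · filter_upwards [h2] with ω hω
      rw [Real.norm_of_nonneg (tsum_nonneg fun x => hF0 x ω)]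
      exact hω.2
  have h4 : HasSum (fun x => ∫ ω, F x ω ∂ν) (∫ ω, ∑' x, F x ω ∂ν) := by
    refine hasSum_integral_of_dominated_convergence F (fun x => (hFi x).aestronglyMeasurable)
      (fun x => Eventually.of_forall fun ω => by rw [Real.norm_of_nonneg (hF0 x ω)]) ?_ h3 ?_
    · filter_upwards [h2] with ω hω using hω.1
    · filter_upwards [h2] with ω hω using hω.1.hasSum
  have h5 : ∫ ω, (G ω - ∑' x, F x ω) ∂ν = 0 := by
    rw [integral_sub hGi h3, h4.unique hsum, sub_self]
  have h6 : Integrable (fun ω => G ω - ∑' x, F x ω) ν := hGi.sub h3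
  rw [integral_eq_zero_iff_of_nonneg_ae ?_ h6] at h5
  · filter_upwards [h5, h2] with ω hω hω2
    have : G ω = ∑' x, F x ω := by simpa [sub_eq_zero] using hω
    rw [this]
    exact hω2.1.hasSum
  · filter_upwards [h2] with ω hω using sub_nonneg.2 hω.2

theorem IsLimit.ae_coherent (h : B.IsLimit M U ν) (hU : U ≤ atTop) (hM : M ∈ B.coherent) :
    ∀ᵐ ω ∂ν, toReal ω ∈ B.coherent := by
  have h1 : ∀ n, ∀ᵐ ω ∂ν, HasSum (toReal ω n) 1 := fun n => by
    refine ae_hasSum_of_integral (F := fun x ω => toReal ω n x) (G := fun _ => 1)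
      (fun x ω => toReal_nonneg ω n x) (integrable_toReal ν n) (integrable_const 1) (fun s => ?_) ?_
    · have h2 := h.ae_le hU (m := n) ⟨fun ω => ∑ x ∈ s, toReal ω n x - 1,
        (continuous_finsetSum _ fun x _ => continuous_toReal n x).sub continuous_const⟩
        fun m hm x => by
          simp only [ContinuousMap.coe_mk, toReal_point, sub_nonpos]
          exact sum_le_hasSum s (fun y _ => B.compLink_nonneg _ _ _ _) (B.hasSum_compLink hm x)
      filter_upwards [h2] with ω hω
      simpa using hω
    · simp only [h.integral_coord hU hM]
      simpa using hM.2.1 n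
  have h2 : ∀ n (y : E n), ∀ᵐ ω ∂ν,
      HasSum (fun x => toReal ω (n + 1) x * B.kernel n x y) (toReal ω n y) := fun n y => by
    refine ae_hasSum_of_integral (F := fun x ω => toReal ω (n + 1) x * B.kernel n x y)
      (G := fun ω => toReal ω n y) (fun x ω => mul_nonneg (toReal_nonneg ω _ x) (B.nonneg n x y))
      (fun x => (integrable_toReal ν (n + 1) x).mul_const _) (integrable_toReal ν n y)
      (fun s => ?_) ?_
    · have h2 := h.ae_le hU (m := n + 1)
        ⟨fun ω => ∑ x ∈ s, toReal ω (n + 1) x * B.kernel n x y - toReal ω n y,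
        (continuous_finsetSum _ fun x _ => (continuous_toReal (n + 1) x).mul continuous_const).sub
          (continuous_toReal n y)⟩
        fun m hm x => by
          simp only [ContinuousMap.coe_mk, toReal_point, sub_nonpos]
          exact sum_le_hasSum s (fun w _ => mul_nonneg (B.compLink_nonneg _ _ _ _) (B.nonneg _ _ _))
            (B.hasSum_compLink_mul_kernel hm x y)
      filter_upwards [h2] with ω hω
      simpa using hω
    · simp only [integral_mul_const, h.integral_coord hU hM]
      exact hM.2.2 n y
  filter_upwards [ae_all_iff.2 h1, ae_all_iff.2 fun n => ae_all_iff.2 (h2 n)] with ω hω1 hω2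
  exact ⟨toReal_nonneg ω, hω1, hω2⟩

end limit

/-! ### Averages of coherent systems -/

section average

variable {Ω : Type*} [MeasurableSpace Ω] {P : Measure Ω}
  {φ : Ω → ∀ n, E n → ℝ}

/-- Integration of bounded functionals of a level, by dominated convergence. -/
theorem hasSum_integral_mul (hφ : ∀ n x, Measurable fun ω => φ ω n x)
    (hc : ∀ᵐ ω ∂P, φ ω ∈ B.coherent) {w : Ω → ℝ} (hw : Integrable w P)
    (n : ℕ) {g : E n → ℝ} {C : ℝ} (hg : ∀ x, |g x| ≤ C) :
    HasSum (fun x => (∫ ω, φ ω n x * w ω ∂P) * g x)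
      (∫ ω, (∑' x, φ ω n x * g x) * w ω ∂P) := by
  simp only [← integral_mul_const]
  refine hasSum_integral_of_dominated_convergence (fun x ω => φ ω n x * (‖w ω‖ * C)) (fun x => ?_)
    (fun x => ?_) ?_ ?_ ?_
  · exact (((hφ n x).aestronglyMeasurable).mul hw.aestronglyMeasurable).mul_const _
  · filter_upwards [hc] with ω hω
    rw [norm_mul, norm_mul, Real.norm_of_nonneg (hω.1 n x), mul_assoc]
    exact mul_le_mul_of_nonneg_left (mul_le_mul_of_nonneg_left (hg x) (norm_nonneg _)) (hω.1 n x)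
  · filter_upwards [hc] with ω hω
    exact (hω.2.1 n).summable.mul_right _
  · refine (hw.norm.mul_const C).congr ?_
    filter_upwards [hc] with ω hω
    rw [((hω.2.1 n).mul_right _).tsum_eq, one_mul]
  · filter_upwards [hc] with ω hω
    have := (coherent_summable_mul hω hg).hasSum.mul_right (w ω)
    refine (congrArg (fun f => HasSum f _) (funext fun x => ?_)).mpr this
    ring

/-- A weighted average of coherent systems is coherent. -/
theorem average_mem_coherent (hφ : ∀ n x, Measurable fun ω => φ ω n x)
    (hc : ∀ᵐ ω ∂P, φ ω ∈ B.coherent) {w : Ω → ℝ} (hw : Integrable w P) (hw0 : ∀ᵐ ω ∂P, 0 ≤ w ω)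
    (hw1 : ∫ ω, w ω ∂P = 1) : (fun n x => ∫ ω, φ ω n x * w ω ∂P) ∈ B.coherent := by
  refine ⟨fun n x => integral_nonneg_of_ae ?_, fun n => ?_, fun n y => ?_⟩
  · filter_upwards [hc, hw0] with ω h1 h2 using mul_nonneg (h1.1 n x) h2
  · have h := hasSum_integral_mul hφ hc hw n (g := fun _ => 1) (C := 1) (by simp)
    simp only [mul_one] at h
    refine (congrArg (HasSum _) ?_).mpr h
    rw [← hw1]
    refine integral_congr_ae ?_
    filter_upwards [hc] with ω hω
    rw [(hω.2.1 n).tsum_eq, one_mul]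
  · have h := hasSum_integral_mul hφ hc hw (n + 1) (g := fun x => B.kernel n x y) (C := 1)
      fun x => by
        rw [abs_of_nonneg (B.nonneg n x y)]
        by_cases hy : y ∈ (B.kernel n x).support
        · rw [← B.sum_eq_one n x]
          exact Finset.single_le_sum (f := fun y => B.kernel n x y) (fun y _ => B.nonneg n x y) hy
        · rw [Finsupp.notMem_support_iff.1 hy]; norm_num
    refine (congrArg (HasSum _) ?_).mpr h
    refine integral_congr_ae ?_
    filter_upwards [hc] with ω hω
    rw [(hω.2.2 n y).tsum_eq]

end average

end BranchingSystem

end BCZMeasure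

namespace BCZMeasure

open Filter Topology MeasureTheory

/-! ### The boundary measure of a coherent system -/

namespace BranchingSystem

variable {E : ℕ → Type} {B : BranchingSystem E} [∀ n, Countable (E n)] {M : ∀ n, E n → ℝ}

theorem aemeasurable_tsum {Ω : Type*} [MeasurableSpace Ω] {P : Measure Ω}
    {φ : Ω → ∀ n, E n → ℝ} (hφ : ∀ n x, Measurable fun ω => φ ω n x) (n : ℕ) (g : E n → ℝ) :
    AEMeasurable (fun ω => ∑' x, φ ω n x * g x) P :=
  AEMeasurable.tsum fun x => ((hφ n x).mul_const (g x)).aemeasurable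

/-- Bounded functionals of the levels that converge for almost all coherent systems `φ ω` converge
for their barycenter `M` to the mean value. -/
theorem tendsto_tsum_of_barycenter {Ω : Type*} [MeasurableSpace Ω] {P : Measure Ω}
    [IsProbabilityMeasure P] {φ : Ω → ∀ n, E n → ℝ} (hφ : ∀ n x, Measurable fun ω => φ ω n x)
    (hc : ∀ᵐ ω ∂P, φ ω ∈ B.coherent) (hM : ∀ n x, ∫ ω, φ ω n x ∂P = M n x)
    {g : ∀ n, E n → ℝ} {C : ℝ} (hg : ∀ n x, |g n x| ≤ C) {G : Ω → ℝ}
    (hG : ∀ᵐ ω ∂P, Tendsto (fun n => ∑' x, φ ω n x * g n x) atTop (𝓝 (G ω))) :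
    Tendsto (fun n => ∑' x, M n x * g n x) atTop (𝓝 (∫ ω, G ω ∂P)) := by
  have h1 : ∀ n, ∑' x, M n x * g n x = ∫ ω, ∑' x, φ ω n x * g n x ∂P := fun n => by
    have := hasSum_integral_mul hφ hc (integrable_const (1 : ℝ)) n (hg n)
    simp only [mul_one, hM] at this
    exact this.tsum_eq
  simp only [h1]
  refine tendsto_integral_of_dominated_convergence (fun _ => C)
    (fun n => (aemeasurable_tsum hφ n (g n)).aestronglyMeasurable) (integrable_const C)
    (fun n => ?_) hG
  filter_upwards [hc] with ω hω
  have h2 : HasSum (fun x => φ ω n x * C) C := by simpa using (hω.2.1 n).mul_right C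
  refine tsum_of_norm_bounded h2 fun x => ?_
  rw [norm_mul, Real.norm_of_nonneg (hω.1 n x)]
  exact mul_le_mul_of_nonneg_left (hg n x) (hω.1 n x)

/-- Almost every point of the limit measure is regular: the mean values of `limitMoment` and of the
square of the coordinate agree, and the former dominates the latter. -/
theorem IsLimit.ae_regular {U : Filter ℕ} [U.NeBot] {ν : Measure (Cube E)} [IsProbabilityMeasure ν]
    (h : B.IsLimit M U ν) (hU : U ≤ atTop) (hM : M ∈ B.coherent) :
    ∀ᵐ ω ∂ν, B.IsRegular (toReal ω) := by
  have hc := h.ae_coherent hU hM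
  refine ae_all_iff.2 fun k => ae_all_iff.2 fun y => ?_
  have hlim : ∀ᵐ ω ∂ν, Tendsto (fun n => ∑' x, toReal ω n x * B.compLink n x k y ^ 2) atTop
      (𝓝 (B.limitMoment (toReal ω) k y)) := by
    filter_upwards [hc] with ω hω using tendsto_secondMoment hω k y
  have h1 := tendsto_nhds_unique (tendsto_tsum_of_barycenter measurable_toReal hc
    (h.integral_coord hU hM) (fun n x => abs_sq_compLink_le n x k y) hlim)
    (tendsto_secondMoment hM k y)
  rw [← h.integral_sq hU hM k y] at h1
  have hm : AEMeasurable (fun ω => B.limitMoment (toReal ω) k y) ν :=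
    aemeasurable_of_tendsto_metrizable_ae atTop
      (fun n => aemeasurable_tsum measurable_toReal n _) hlim
  have hi1 : Integrable (fun ω => B.limitMoment (toReal ω) k y) ν := by
    refine Integrable.of_bound hm.aestronglyMeasurable 1 ?_
    filter_upwards [hc] with ω hω
    have h2 := tendsto_secondMoment hω k y
    rw [Real.norm_of_nonneg (ge_of_tendsto' h2 (secondMoment_nonneg hω k y))]
    exact le_of_tendsto' h2 (secondMoment_le_one hω k y)
  have hi2 : Integrable (fun ω => toReal ω k y ^ 2) ν :=
    Integrable.of_bound ((measurable_toReal k y).pow_const 2).aestronglyMeasurable 1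
      (Eventually.of_forall fun ω => by
        rw [Real.norm_of_nonneg (sq_nonneg _)]
        exact pow_le_one₀ (toReal_nonneg ω k y) (toReal_le_one ω k y))
  have h3 : ∫ ω, (B.limitMoment (toReal ω) k y - toReal ω k y ^ 2) ∂ν = 0 := by
    rw [integral_sub hi1 hi2, h1, sub_self]
  have hi3 : Integrable (fun ω => B.limitMoment (toReal ω) k y - toReal ω k y ^ 2) ν := hi1.sub hi2
  rw [integral_eq_zero_iff_of_nonneg_ae ?_ hi3] at h3
  · filter_upwards [h3] with ω hω
    simpa [sub_eq_zero] using hω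
  · filter_upwards [hc] with ω hω using sub_nonneg.2 (sq_le_limitMoment hω k y)

theorem integral_sq_sub (ν : Measure (Cube E)) [IsProbabilityMeasure ν] (k : ℕ) (y : E k) (c : ℝ) :
    ∫ ω, (toReal ω k y - c) ^ 2 ∂ν =
      ∫ ω, toReal ω k y ^ 2 ∂ν - 2 * c * ∫ ω, toReal ω k y ∂ν + c ^ 2 := by
  have hi2 : Integrable (fun ω => toReal ω k y ^ 2) ν :=
    Integrable.of_bound ((measurable_toReal k y).pow_const 2).aestronglyMeasurable 1
      (Eventually.of_forall fun ω => by
        rw [Real.norm_of_nonneg (sq_nonneg _)]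
        exact pow_le_one₀ (toReal_nonneg ω k y) (toReal_le_one ω k y))
  have hi1 := (integrable_toReal ν k y).const_mul (2 * c)
  have e : ∀ ω : Cube E, (toReal ω k y - c) ^ 2 = toReal ω k y ^ 2 - 2 * c * toReal ω k y + c ^ 2 :=
    fun ω => by ring
  have hi3 : Integrable (fun ω => toReal ω k y ^ 2 - 2 * c * toReal ω k y) ν := hi2.sub hi1
  simp only [e]
  rw [integral_add hi3 (integrable_const _), integral_sub hi2 hi1, integral_const_mul]
  simp

/-- An extreme coherent system is regular: otherwise some coordinate has positive variance under the
limit measure, and weighting that measure by `1 ± (ω k y - M k y)` splits `M`. -/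
theorem isRegular_of_mem_extremePoints (hM : M ∈ B.coherent.extremePoints ℝ) : B.IsRegular M := by
  intro k y
  obtain ⟨ν, hν⟩ := exists_isLimit hM.1 (Filter.hyperfilter ℕ)
  have hU : (Filter.hyperfilter ℕ : Filter ℕ) ≤ atTop := Nat.hyperfilter_le_atTop
  have hc := hν.ae_coherent hU hM.1
  set h : Cube E → ℝ := fun ω => toReal ω k y - M k y with hh
  have hbd : ∀ ω, |h ω| ≤ 1 := fun ω => by
    have h1 := toReal_nonneg ω k y
    have h2 := toReal_le_one ω k y
    have h3 := hM.1.1 k y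
    have h4 := coherent_le_one hM.1 k y
    rw [abs_le]
    constructor <;> simp only [hh] <;> linarith
  have hhm : Measurable h := (measurable_toReal k y).sub_const _
  have hint : Integrable h ν :=
    Integrable.of_bound hhm.aestronglyMeasurable 1 (Eventually.of_forall hbd)
  have hmean : ∫ ω, h ω ∂(ν : Measure (Cube E)) = 0 := by
    simp only [hh]
    rw [integral_sub (integrable_toReal _ k y) (integrable_const _), hν.integral_coord hU hM.1]
    simp
  have hadd : Integrable (fun ω => 1 + h ω) ν := (integrable_const 1).add hint
  have hsub : Integrable (fun ω => 1 - h ω) ν := (integrable_const 1).sub hint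
  have h1 := average_mem_coherent measurable_toReal hc (w := fun ω => 1 + h ω) hadd
    (Eventually.of_forall fun ω => by have := (abs_le.1 (hbd ω)).1; linarith)
    (by rw [integral_add (integrable_const 1) hint, hmean]; simp)
  have h2 := average_mem_coherent measurable_toReal hc (w := fun ω => 1 - h ω) hsub
    (Eventually.of_forall fun ω => by have := (abs_le.1 (hbd ω)).2; linarith)
    (by rw [integral_sub (integrable_const 1) hint, hmean]; simp)
  have hprod : ∀ n x, Integrable (fun ω => toReal ω n x * h ω) ν := fun n x =>
    Integrable.of_bound ((measurable_toReal n x).mul hhm).aestronglyMeasurable 1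
      (Eventually.of_forall fun ω => by
        rw [norm_mul, Real.norm_of_nonneg (toReal_nonneg ω n x)]
        exact mul_le_one₀ (toReal_le_one ω n x) (norm_nonneg _) (hbd ω))
  have e1 : ∀ n x, ∫ ω, toReal ω n x * (1 + h ω) ∂(ν : Measure (Cube E)) =
      M n x + ∫ ω, toReal ω n x * h ω ∂(ν : Measure (Cube E)) := fun n x => by
    simp only [mul_add, mul_one]
    rw [integral_add (integrable_toReal _ n x) (hprod n x), hν.integral_coord hU hM.1]
  have e2 : ∀ n x, ∫ ω, toReal ω n x * (1 - h ω) ∂(ν : Measure (Cube E)) =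
      M n x - ∫ ω, toReal ω n x * h ω ∂(ν : Measure (Cube E)) := fun n x => by
    simp only [mul_sub, mul_one]
    rw [integral_sub (integrable_toReal _ n x) (hprod n x), hν.integral_coord hU hM.1]
  have h3 := hM.2 h1 h2 ⟨1 / 2, 1 / 2, by norm_num, by norm_num, by norm_num, by
    funext n x
    simp only [Pi.add_apply, Pi.smul_apply, smul_eq_mul, e1, e2]
    ring⟩
  have h4 := congrFun (congrFun h3 k) y
  simp only [e1] at h4
  have h5 : ∫ ω, toReal ω k y * h ω ∂(ν : Measure (Cube E)) = 0 := by linarith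
  have h6 := integral_sq_sub (ν : Measure (Cube E)) k y (M k y)
  have h7 : ∫ ω, (toReal ω k y - M k y) ^ 2 ∂(ν : Measure (Cube E)) = 0 := by
    have e3 : ∀ ω : Cube E, (toReal ω k y - M k y) ^ 2 = toReal ω k y * h ω - M k y * h ω :=
      fun ω => by simp only [hh]; ring
    simp only [e3]
    rw [integral_sub (hprod k y) (hint.const_mul _), h5, integral_const_mul, hmean]
    simp
  rw [h7, hν.integral_sq hU hM.1, hν.integral_coord hU hM.1] at h6
  linarith

/-- The point of the cube given by a coherent system. -/
def toCube (hM : M ∈ B.coherent) : Cube E := fun n x => ⟨M n x, hM.1 n x, coherent_le_one hM n x⟩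

/-- The levels of a regular system converge weakly to the unit mass at the system itself. -/
theorem IsRegular.tendsto (hr : B.IsRegular M) (hM : M ∈ B.coherent) (f : C(Cube E, ℝ)) :
    Tendsto (fun n => ∑' x, M n x * f (B.point n x)) atTop (𝓝 (f (toCube hM))) := by
  rw [tendsto_iff_ultrafilter]
  intro U hU
  obtain ⟨ν, hν⟩ := exists_isLimit hM U
  have h1 : ∀ᵐ ω ∂(ν : Measure (Cube E)), ω = toCube hM := by
    have h2 : ∀ k (y : E k), ∀ᵐ ω ∂(ν : Measure (Cube E)), toReal ω k y = M k y := fun k y => by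
      have h3 := integral_sq_sub (ν : Measure (Cube E)) k y (M k y)
      rw [hν.integral_sq hU hM, hν.integral_coord hU hM, hr k y] at h3
      have h4 : ∫ ω, (toReal ω k y - M k y) ^ 2 ∂(ν : Measure (Cube E)) = 0 := by rw [h3]; ring
      rw [integral_eq_zero_iff_of_nonneg (fun ω => sq_nonneg _) ?_] at h4
      · filter_upwards [h4] with ω hω
        have : toReal ω k y - M k y = 0 := by simpa using hω
        linarith
      · refine Integrable.of_bound
          (((measurable_toReal k y).sub_const _).pow_const 2).aestronglyMeasurable 1
          (Eventually.of_forall fun ω => ?_)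
        rw [Real.norm_of_nonneg (sq_nonneg _), sq_le_one_iff_abs_le_one, abs_le]
        have h1 := toReal_nonneg ω k y
        have h2 := toReal_le_one ω k y
        have h3 := hM.1 k y
        have h4 := coherent_le_one hM k y
        constructor <;> linarith
    filter_upwards [ae_all_iff.2 fun k => ae_all_iff.2 (h2 k)] with ω hω
    funext k y
    exact Subtype.ext (hω k y)
  have h2 : ∫ ω, f ω ∂(ν : Measure (Cube E)) = f (toCube hM) := by
    rw [integral_congr_ae (g := fun _ => f (toCube hM))]
    · simp
    · filter_upwards [h1] with ω hω
      rw [hω]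
  rw [← h2]
  exact hν f

/-- A probability measure on the boundary is determined by its barycenter. -/
theorem eq_of_barycenter_eq {P Q : ProbabilityMeasure (B.coherent.extremePoints ℝ)}
    (hP : ∀ n x, ∫ ω, ω.1 n x ∂(P : Measure (B.coherent.extremePoints ℝ)) = M n x)
    (hQ : ∀ n x, ∫ ω, ω.1 n x ∂(Q : Measure (B.coherent.extremePoints ℝ)) = M n x) : P = Q := by
  let ι : B.coherent.extremePoints ℝ → Cube E := fun ω => toCube ω.2.1
  have hcoord : ∀ n (x : E n), Measurable fun ω : B.coherent.extremePoints ℝ => ω.1 n x :=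
    fun n x => (measurable_pi_apply x).comp ((measurable_pi_apply n).comp measurable_subtype_coe)
  have hι : Measurable ι := measurable_pi_iff.2 fun n => measurable_pi_iff.2 fun x =>
    (hcoord n x).subtype_mk
  have key : ∀ R : ProbabilityMeasure (B.coherent.extremePoints ℝ),
      (∀ n x, ∫ ω, ω.1 n x ∂(R : Measure (B.coherent.extremePoints ℝ)) = M n x) →
      ∀ f : C(Cube E, ℝ), Tendsto (fun n => ∑' x, M n x * f (B.point n x)) atTop
        (𝓝 (∫ ω, f (ι ω) ∂(R : Measure (B.coherent.extremePoints ℝ)))) := fun R hR f => by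
    obtain ⟨C, hC⟩ := exists_abs_le f
    exact tendsto_tsum_of_barycenter (φ := fun ω : B.coherent.extremePoints ℝ => ω.1) hcoord
      (Eventually.of_forall fun ω => ω.2.1) hR (fun n x => hC _)
      (Eventually.of_forall fun ω => (isRegular_of_mem_extremePoints ω.2).tendsto ω.2.1 f)
  have hmap : (P : Measure (B.coherent.extremePoints ℝ)).map ι =
      (Q : Measure (B.coherent.extremePoints ℝ)).map ι := by
    have := Measure.isProbabilityMeasure_map
      (μ := (P : Measure (B.coherent.extremePoints ℝ))) hι.aemeasurable
    have := Measure.isProbabilityMeasure_map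
      (μ := (Q : Measure (B.coherent.extremePoints ℝ))) hι.aemeasurable
    refine ext_of_forall_integral_eq_of_IsFiniteMeasure fun f => ?_
    rw [integral_map hι.aemeasurable f.continuous.measurable.aestronglyMeasurable,
      integral_map hι.aemeasurable f.continuous.measurable.aestronglyMeasurable]
    exact tendsto_nhds_unique (key P hP f.toContinuousMap) (key Q hQ f.toContinuousMap)
  refine Subtype.ext (Measure.ext fun s hs => ?_)
  obtain ⟨t, ht, rfl⟩ := hs
  have hr : Measurable (toReal : Cube E → ∀ n, E n → ℝ) :=
    measurable_pi_iff.2 fun n => measurable_pi_iff.2 fun x => measurable_toReal n x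
  have h1 := congrArg (fun m : Measure (Cube E) => m (toReal ⁻¹' t)) hmap
  simp only [Measure.map_apply hι (hr ht)] at h1
  exact h1

theorem exists_boundary_measure (hM : M ∈ B.coherent) :
    ∃ P : ProbabilityMeasure (B.coherent.extremePoints ℝ),
      ∀ n x, ∫ ω, ω.1 n x ∂(P : Measure (B.coherent.extremePoints ℝ)) = M n x := by
  classical
  obtain ⟨ν, hν⟩ := exists_isLimit hM (Filter.hyperfilter ℕ)
  have hU : (Filter.hyperfilter ℕ : Filter ℕ) ≤ atTop := Nat.hyperfilter_le_atTop
  have hext : ∀ᵐ ω ∂(ν : Measure (Cube E)), toReal ω ∈ B.coherent.extremePoints ℝ := by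
    filter_upwards [hν.ae_coherent hU hM, hν.ae_regular hU hM] with ω h1 h2
    exact h2.mem_extremePoints h1
  obtain ⟨ω₀, hω₀⟩ := hext.exists
  -- modify `toReal` on a measurable null set so that it takes values in the boundary
  set S : Set (Cube E) := toMeasurable ν {ω | toReal ω ∉ B.coherent.extremePoints ℝ} with hS
  have hS0 : (ν : Measure (Cube E)) S = 0 := by rw [hS, measure_toMeasurable]; exact hext
  let T : Cube E → ∀ n, E n → ℝ := fun ω => if ω ∈ S then toReal ω₀ else toReal ω
  have hT : ∀ ω, T ω ∈ B.coherent.extremePoints ℝ := fun ω => by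
    simp only [T]
    split_ifs with h
    · exact hω₀
    · by_contra h'
      exact h (subset_toMeasurable _ _ h')
  have hr : Measurable (toReal : Cube E → ∀ n, E n → ℝ) :=
    measurable_pi_iff.2 fun n => measurable_pi_iff.2 fun x => measurable_toReal n x
  have hTm : Measurable T := Measurable.ite (measurableSet_toMeasurable _ _) measurable_const hr
  have hTm' : Measurable fun ω => (⟨T ω, hT ω⟩ : B.coherent.extremePoints ℝ) := hTm.subtype_mk
  refine ⟨ν.map hTm'.aemeasurable, fun n x => ?_⟩
  have hcoord : Measurable fun ω : B.coherent.extremePoints ℝ => ω.1 n x :=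
    (measurable_pi_apply x).comp ((measurable_pi_apply n).comp measurable_subtype_coe)
  rw [ProbabilityMeasure.toMeasure_map, integral_map hTm'.aemeasurable hcoord.aestronglyMeasurable,
    ← hν.integral_coord hU hM n x]
  refine integral_congr_ae ?_
  filter_upwards [measure_eq_zero_iff_ae_notMem.1 hS0] with ω hω
  simp only [T, if_neg hω]

/-- Every coherent system is the barycenter of a unique probability measure on the boundary. -/
theorem existsUnique_boundary_measure (hM : M ∈ B.coherent) :
    ∃! P : ProbabilityMeasure (B.coherent.extremePoints ℝ),
      ∀ n x, ∫ ω, ω.1 n x ∂(P : Measure (B.coherent.extremePoints ℝ)) = M n x := by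
  obtain ⟨P, hP⟩ := exists_boundary_measure hM
  exact ⟨P, hP, fun Q hQ => eq_of_barycenter_eq hQ hP⟩

end BranchingSystem

/-! ### The branching system of signatures -/

/-- The branching system formed by the signatures and the links. -/
def signatureSystem (a b : ℝ) (hb : -1 / 2 ≤ b) (hab : b ≤ a) :
    BranchingSystem fun n => GT (n + 1) where
  kernel _ lam := Finsupp.onFinset (finite_shifted_lt _ (shifted lam 0)).toFinset (link a b lam)
    fun _ h => by_contra fun h' => h (link_eq_zero hb hab h')
  nonneg _ lam mu := link_nonneg hb hab lam mu
  sum_eq_one _ lam := by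
    rw [Finsupp.onFinset_sum _ fun _ => rfl]
    exact (hasSum_sum_of_ne_finset_zero fun _ h => link_eq_zero hb hab h).unique
      (hasSum_link hb hab lam)

end BCZMeasure

end

theorem mainTheorem6 (a b : ℝ) (hb : -1 / 2 ≤ b) (hab : b ≤ a) (z z' : ℂ)
    (hz : (z, z') ∈ BCZMeasure.admissible a b) :
    (∀ N : ℕ, 1 ≤ N →
      (∀ lam : BCZMeasure.GT N, (BCZMeasure.zMeasure a b z z' N lam).im = 0 ∧
        0 < (BCZMeasure.zMeasure a b z z' N lam).re) ∧
      HasSum (fun lam : BCZMeasure.GT N => BCZMeasure.zMeasure a b z z' N lam) 1) ∧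
    (∀ N : ℕ, 1 ≤ N → ∀ mu : BCZMeasure.GT N,
      HasSum (fun lam : BCZMeasure.GT (N + 1) =>
          BCZMeasure.zMeasure a b z z' (N + 1) lam * (BCZMeasure.link a b lam mu : ℂ))
        (BCZMeasure.zMeasure a b z z' N mu)) ∧
    (∃! P : MeasureTheory.ProbabilityMeasure (BCZMeasure.Boundary a b),
      ∀ (n : ℕ) (lam : BCZMeasure.GT (n + 1)),
        ∫ ω, ω.1 n lam ∂(P : MeasureTheory.Measure (BCZMeasure.Boundary a b)) =
          (BCZMeasure.zMeasure a b z z' (n + 1) lam).re) := by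
  refine ⟨fun N _ => ⟨fun lam => ?_, ?_⟩, fun N _ mu => ?_, ?_⟩
  · have h := Complex.pos_iff.1 (BCZMeasure.zMeasure_pos hb hab hz N lam)
    exact ⟨h.2.symm, h.1⟩
  · have h := Complex.hasSum_ofReal.2 (BCZMeasure.hasSum_zMeasure_re hb hab hz N)
    simpa only [← BCZMeasure.zMeasure_eq_re hb hab hz, Complex.ofReal_one] using h
  · exact BCZMeasure.hasSum_zMeasure_mul_link hb hab hz N mu
  · exact BCZMeasure.BranchingSystem.existsUnique_boundary_measure
      (B := BCZMeasure.signatureSystem a b hb hab)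
      (BCZMeasure.zMeasure_mem_coherentSystems hb hab hz)
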